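/- Let $k$ be a field of characteristic $p>0$ and let $R=\bigoplus_{n\ge 0}R_n$ be a standard graded Gorenstein $k$-algebra (that is, $R_0=k$, and $R$ is generated as a $k$-algebra by finitely many elements of degree $1$) of Krull dimension $d>0$. Put $R_+=\bigoplus_{n>0}R_n$, and let $a$ be the $a$-invariant of $R$, i.e. the largest degree in which the local cohomology module $H^d_{R_+}(R)$ is nonzero. Let $x_1,\dots,x_d$ be a homogeneous system of parameters of $R$, and let $I_t=(x_1^t,\dots,x_d^t)$ for $t\ge 1$. Notation: $R^\circ$ is the set of elements of $R$ that lie in no minimal prime, $q=p^e$ denotes a power of $p$, and $I^{[q]}$ is the ideal generated by all $i^q$ with $i\in I$. For ideals $I,\mathfrak a$ of $R$ and a real number $r\ge 0$, $I^*$ is the tight closure of $I$ (all $x\in R$ for which there is $c\in R^\circ$ with $cx^q\in I^{[q]}$ for all $q\gg 0$), and $I^{*\mathfrak a^r}$ is the ideal of all $x\in R$ for which there is $c\in R^\circ$ with $c\,x^q\,\mathfrak a^{\lceil rq\rceil}\subseteq I^{[q]}$ for all $q$. Further, $\tau(R)=\bigcap_I (I:I^*)$ and $\tau(\mathfrak a^r)=\bigcap_I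 (I:I^{*\mathfrak a^r})$, where $I$ ranges over all ideals of $R$. We set $R_+^n=R$ for integers $n\le 0$. Then for every real number $r\ge 0$ and every integer $t\ge 1$, $$I_t^{*R_+^r}=I_t^*+\bigl(I_t:R_+^{\,a+1+\lfloor r\rfloor}\bigr),$$ and consequently, for every real number $r\ge 0$, $$\tau(R_+^r)=\tau(R)\cap R_+^{\,a+1+\lfloor r\rfloor}.$$ -/

import Mathlib

namespace ATightClosure

section Closure

variable {R : Type*} [CommRing R]

variable (R) in
/-- `R°`: the elements of `R` that are in no minimal prime of `R`. -/
def circ : Submonoid R where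
  carrier := {c | ∀ P ∈ minimalPrimes R, c ∉ P}
  one_mem' := fun P hP h => hP.1.1.ne_top ((Ideal.eq_top_iff_one P).2 h)
  mul_mem' := fun ha hb P hP h =>
    (hP.1.1.mem_or_mem h).elim (ha P hP) (hb P hP)

/-- `I^{[q]}`: the ideal generated by all `i ^ q` with `i ∈ I`. -/
def bracketPower (I : Ideal R) (q : ℕ) : Ideal R :=
  Ideal.span ((fun i => i ^ q) '' (I : Set R))

variable (p : ℕ) [Fact p.Prime] [CharP R p]

/-- The tight closure `I^*`: those `x` for which some `c ∈ R°` satisfies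
`c x ^ q ∈ I^{[q]}` for all large powers `q = p ^ e` of the characteristic. -/
def tightClosure (I : Ideal R) : Ideal R where
  carrier := {x | ∃ c ∈ circ R, ∀ᶠ e : ℕ in Filter.atTop,
    c * x ^ p ^ e ∈ bracketPower I (p ^ e)}
  zero_mem' := by
    refine ⟨1, (circ R).one_mem, Filter.Eventually.of_forall fun e => ?_⟩
    rw [zero_pow (pow_ne_zero _ (Fact.out : p.Prime).ne_zero), mul_zero]
    exact Ideal.zero_mem _
  add_mem' := by
    rintro x y ⟨c, hc, hx⟩ ⟨c', hc', hy⟩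
    refine ⟨c * c', (circ R).mul_mem hc hc', ?_⟩
    filter_upwards [hx, hy] with e h1 h2
    have h : c * c' * (x + y) ^ p ^ e = c' * (c * x ^ p ^ e) + c * (c' * y ^ p ^ e) := by
      rw [add_pow_char_pow]; ring
    rw [h]
    exact Ideal.add_mem _ (Ideal.mul_mem_left _ _ h1) (Ideal.mul_mem_left _ _ h2)
  smul_mem' := by
    rintro b x ⟨c, hc, hx⟩
    refine ⟨c, hc, ?_⟩
    filter_upwards [hx] with e h1
    have h : c * (b • x) ^ p ^ e = b ^ p ^ e * (c * x ^ p ^ e) := by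
      rw [smul_eq_mul, mul_pow]; ring
    rw [h]
    exact Ideal.mul_mem_left _ _ h1

/-- The Hara–Yoshida closure `I^{*𝔞^t}` with real exponent `t`: those `x` for which some
`c ∈ R°` satisfies `c x ^ q 𝔞 ^ ⌈t q⌉ ⊆ I^{[q]}` for all powers `q = p ^ e`. -/
def aTightClosure (𝔞 : Ideal R) (t : ℝ) (I : Ideal R) : Ideal R where
  carrier := {x | ∃ c ∈ circ R, ∀ e : ℕ, ∀ y ∈ 𝔞 ^ ⌈t * (p : ℝ) ^ e⌉₊,
    c * x ^ p ^ e * y ∈ bracketPower I (p ^ e)}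
  zero_mem' := by
    refine ⟨1, (circ R).one_mem, fun e y _ => ?_⟩
    rw [zero_pow (pow_ne_zero _ (Fact.out : p.Prime).ne_zero), mul_zero, zero_mul]
    exact Ideal.zero_mem _
  add_mem' := by
    rintro x z ⟨c, hc, hx⟩ ⟨c', hc', hz⟩
    refine ⟨c * c', (circ R).mul_mem hc hc', fun e y hy => ?_⟩
    have h : c * c' * (x + z) ^ p ^ e * y =
        c' * (c * x ^ p ^ e * y) + c * (c' * z ^ p ^ e * y) := by
      rw [add_pow_char_pow]; ring
    rw [h]
    exact Ideal.add_mem _ (Ideal.mul_mem_left _ _ (hx e y hy))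
      (Ideal.mul_mem_left _ _ (hz e y hy))
  smul_mem' := by
    rintro b x ⟨c, hc, hx⟩
    refine ⟨c, hc, fun e y hy => ?_⟩
    have h : c * (b • x) ^ p ^ e * y = b ^ p ^ e * (c * x ^ p ^ e * y) := by
      rw [smul_eq_mul, mul_pow]; ring
    rw [h]
    exact Ideal.mul_mem_left _ _ (hx e y hy)

variable (R) in
/-- The test ideal `τ(R) = ⋂ (I : I^*)`, over all ideals `I` of `R`. -/
def testIdeal : Ideal R :=
  ⨅ I : Ideal R, Submodule.colon I (tightClosure p I : Set R)

/-- The test ideal `τ(𝔞^t) = ⋂ (I : I^{*𝔞^t})`, over all ideals `I` of `R`. -/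
def aTestIdeal (𝔞 : Ideal R) (t : ℝ) : Ideal R :=
  ⨅ I : Ideal R, Submodule.colon I (aTightClosure p 𝔞 t I : Set R)

end Closure

section Gorenstein

/-- A Noetherian local ring is Gorenstein if it is Cohen–Macaulay of type one: some regular
sequence generates an ideal that is primary to the maximal ideal (so that the ring is
Cohen–Macaulay and the sequence is a system of parameters) and irreducible, that is, not an
intersection of two strictly larger ideals (so that the quotient has one-dimensional socle). -/
def IsGorensteinLocal (A : Type*) [CommRing A] [IsLocalRing A] : Prop :=
  IsNoetherianRing A ∧ ∃ rs : List A, RingTheory.Sequence.IsRegular A rs ∧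
    (Ideal.ofList rs).radical = IsLocalRing.maximalIdeal A ∧ InfIrred (Ideal.ofList rs)

/-- A Noetherian ring is Gorenstein if its localizations at maximal ideals are. -/
def IsGorenstein (R : Type*) [CommRing R] : Prop :=
  IsNoetherianRing R ∧
    ∀ (M : Ideal R) [M.IsMaximal], IsGorensteinLocal (Localization.AtPrime M)

end Gorenstein

section Graded

variable {k R : Type*} [Field k] [CommRing R] [Algebra k R] (𝒜 : ℕ → Submodule k R)

/-- A graded `k`-algebra `R = ⨁ 𝒜 n` with `𝒜 0 = k` is standard graded if it is generated, as an
algebra, by finitely many elements of degree one. -/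
def IsStandardGraded : Prop :=
  𝒜 0 = 1 ∧ ∃ S : Finset R, (S : Set R) ⊆ 𝒜 1 ∧ Algebra.adjoin k (S : Set R) = ⊤

/-- `x₁, …, x_d` is a homogeneous system of parameters, with `deg x_i = e_i`: `d` is the Krull
dimension, and the ideal generated by the `x_i` is primary to `R₊`. -/
def IsHomogeneousSOP [GradedAlgebra 𝒜] {d : ℕ} (x : Fin d → R) (e : Fin d → ℕ) : Prop :=
  ringKrullDim R = d ∧ (∀ i, x i ∈ 𝒜 (e i)) ∧
    (Ideal.span (Set.range x)).radical = (HomogeneousIdeal.irrelevant 𝒜).toIdeal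

/-- The coboundaries of the Čech complex of `x₁, …, x_d` in top degree: the submodule
`∑ i, R_{x₁ ⋯ x_{i-1} x_{i+1} ⋯ x_d}` of `R_{x₁ ⋯ x_d}`. The quotient is the top local cohomology
`H^d` of `R` with support in the ideal generated by the `x_i`. -/
def cechBoundary {d : ℕ} (x : Fin d → R) : Submodule R (Localization.Away (∏ i, x i)) :=
  Submodule.span R {z | ∃ (i : Fin d) (n : ℕ) (b : R),
    algebraMap R _ ((∏ j ∈ Finset.univ.erase i, x j) ^ n) * z = algebraMap R _ b}

/-- The elements of degree `n` of the graded ring `R_{x₁ ⋯ x_d}`, when `deg x_i = e_i`: the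
fractions `b / (x₁ ⋯ x_d) ^ t` with `b` homogeneous of degree `n + t ∑ e_i`. -/
def cechDegree {d : ℕ} (x : Fin d → R) (e : Fin d → ℕ) (n : ℤ) :
    Set (Localization.Away (∏ i, x i)) :=
  {z | ∃ (t m : ℕ), (m : ℤ) = n + t * ∑ i, (e i : ℤ) ∧ ∃ b ∈ 𝒜 m,
    algebraMap R _ ((∏ i, x i) ^ t) * z = algebraMap R _ b}

/-- The `a`-invariant: the largest degree in which the graded module `H^d_{R₊}(R)`, computed by the
Čech complex of a homogeneous system of parameters `x`, with `deg x_i = e_i`, is nonzero. -/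
noncomputable def aInvariant {d : ℕ} (x : Fin d → R) (e : Fin d → ℕ) : ℤ :=
  sSup {n : ℤ | ∃ z ∈ cechDegree 𝒜 x e n, z ∉ cechBoundary x}

/-- `R₊ ^ n` for an integer `n`, which is `R` for `n ≤ 0`. -/
noncomputable def irrelevantPow [GradedAlgebra 𝒜] (n : ℤ) : Ideal R :=
  (HomogeneousIdeal.irrelevant 𝒜).toIdeal ^ n.toNat

/-- `I_t = (x₁ ^ t, …, x_d ^ t)`. -/
def powIdeal {d : ℕ} (x : Fin d → R) (t : ℕ) : Ideal R :=
  Ideal.span (Set.range fun i => x i ^ t)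

end Graded

end ATightClosure

/-!
Duality in the artinian quotients `R / I_t` carries the proof. Since `R` is Gorenstein, the powers
of the parameters form regular sequences in every order, and `R / I_t` has a one-dimensional socle
in degree `a + t ∑ deg x_i` (`IsHomogeneousSOP.exists_hasSocleDegree_powIdeal`): forms of larger
degree are in `I_t`, and a form outside `I_t` has a multiple in the socle degree that is outside
`I_t`.

*The closures of `I_t`.* Frobenius acts on leading forms, so a condition
`c z ^ q R₊ ^ ⌈r q⌉ ⊆ I_t^{[q]} = I_{tq}` passes to the homogeneous components of `z`
(`proj_mul_pow_char_pow`). For a form `z` of degree `j`, the products `c z ^ q y` with `y` of degree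
`⌈r q⌉` have degree about `(j + r) q`, to be compared with the socle degree `a + t q ∑ deg x_i`. If
`j ≥ t ∑ deg x_i - ⌊r⌋`, they are above the socle for degree reasons, and so is
`z R₊ ^ (a + 1 + ⌊r⌋)` in `R / I_t`; if `j` is smaller, `c z ^ q` is too far below the socle of
`R / I_{tq}` to be killed by `R₊ ^ ⌈r q⌉` without being in `I_{tq}`. This is
`IsHomogeneousSOP.aTightClosure_powIdeal_eq`.

*The test ideals.* The ideals `I_t` compute both test ideals, without any theory of test elements:
if `c` multiplies the closure of each `I_t` into `I_t`, then it does so for every ideal `I`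
(`IsHomogeneousSOP.mul_mem_of_mem_exponentClosure`). By Krull's intersection theorem `I` may be
replaced by `I + M ^ N` with `M` maximal. By the Nullstellensatz this ideal contains
`J = (f(x₁), …, f(x_d))` for a monic polynomial `f` over `k`, and duality in the quotient by `J`, a
deformation of some `R / I_n`, reduces the claim to `J` (`IsHomogeneousSOP.exists_mul_notMem_span`).
For `J` itself, write `f(x_i) = x_i ^ n - B_i` with `B_i` of lower degree, and multiply by
`G_i = ∑ (x_i ^ n) ^ a B_i ^ b`, the sum over `a + b = s - 1`, to get
`f(x_i) G_i = x_i ^ {n s} - B_i ^ s`. For large `s` the second term is of so low a degree, compared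
with `c` and `z`, that a relation modulo `(f(x_i) G_i)` can be read off from leading forms, modulo
`I_{n s}`; this uses that regular sequences of leading forms admit no cancellation
(`RegularFamily.exists_sum_of_mem_span`).

The formula for the test ideals follows by intersecting the colon ideals over `t`, where
`R₊ ^ n` is recovered from the ideals `I_t : R₊ ^ n` by duality
(`IsHomogeneousSOP.mem_irrelevantPow_of_forall`).
-/

namespace ATightClosure

/-! ### Regular sequences and socles modulo ideals of a local ring -/

section Local

variable {A : Type*} [CommRing A]

/-- `r` is a nonzerodivisor on `A ⧸ K`. -/
def RegMod (K : Ideal A) (r : A) : Prop := ∀ b, r * b ∈ K → b ∈ K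

/-- `rs` is a weakly regular sequence on `A ⧸ K`. -/
def RegListMod : Ideal A → List A → Prop
  | _, [] => True
  | K, r :: rs => RegMod K r ∧ RegListMod (K ⊔ Ideal.span {r}) rs

lemma RegListMod.of_append {r : A} {rs' : List A} : ∀ {rs : List A} {K : Ideal A},
    RegListMod K (rs ++ r :: rs') → RegMod (K ⊔ Ideal.ofList rs) r
  | [], K, h => by simpa using h.1
  | a :: rs, K, h => by
    have := RegListMod.of_append (rs := rs) h.2
    rwa [Ideal.ofList_cons, ← sup_assoc]

variable [IsLocalRing A]

open IsLocalRing

/-- The socle of `A ⧸ K` has dimension at most one over the residue field: any two of its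
elements satisfy a linear relation with a unit coefficient. -/
def SocleLEOne (K : Ideal A) : Prop :=
  ∀ u v, (∀ a ∈ maximalIdeal A, a * u ∈ K) → (∀ a ∈ maximalIdeal A, a * v ∈ K) →
    ∃ c c' : A, (c ∉ maximalIdeal A ∨ c' ∉ maximalIdeal A) ∧ c * u - c' * v ∈ K

/-- Some regular sequence of length `n` on `A ⧸ K` has a quotient with socle of dimension at most
one. If `A ⧸ K` has dimension `n`, this says that `A ⧸ K` is Gorenstein. -/
def GorensteinMod : ℕ → Ideal A → Prop
  | 0, K => SocleLEOne K
  | n + 1, K => ∃ r ∈ maximalIdeal A, RegMod K r ∧ GorensteinMod n (K ⊔ Ideal.span {r})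

lemma mem_sup_span_singleton_iff {A : Type*} [CommRing A] {K : Ideal A} {r b : A} :
    b ∈ K ⊔ Ideal.span {r} ↔ ∃ c, b - r * c ∈ K := by
  constructor
  · intro h
    obtain ⟨k, hk, z, hz, rfl⟩ := Submodule.mem_sup.1 h
    obtain ⟨c, rfl⟩ := Ideal.mem_span_singleton'.1 hz
    exact ⟨c, by simpa [mul_comm r c] using hk⟩
  · rintro ⟨c, hc⟩
    have := Submodule.add_mem_sup hc (Ideal.mem_span_singleton'.2 ⟨c, mul_comm c r⟩)
    simpa using this

/-- Nakayama's lemma for an ideal `T` that is contained in `K + r T`. -/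
lemma le_of_forall_sub_mul_mem [IsNoetherianRing A] {K T : Ideal A} {r : A}
    (hr : r ∈ maximalIdeal A) (h : ∀ b ∈ T, ∃ c ∈ T, b - r * c ∈ K) : T ≤ K := by
  refine Submodule.le_of_le_smul_of_le_jacobson_bot (I := maximalIdeal A)
    (IsNoetherian.noetherian T) (maximalIdeal_le_jacobson _) fun b hb => ?_
  obtain ⟨c, hc, hbc⟩ := h b hb
  simpa using Submodule.add_mem_sup hbc (Submodule.smul_mem_smul hr hc)

lemma RegMod.swap [IsNoetherianRing A] {K : Ideal A} {r z : A}
    (hr : r ∈ maximalIdeal A) (hKr : RegMod K r) (hKz : RegMod (K ⊔ Ideal.span {r}) z) :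
    RegMod K z ∧ RegMod (K ⊔ Ideal.span {z}) r := by
  have hz : RegMod K z := by
    have : Submodule.comap (LinearMap.mulLeft A z) K ≤ K := by
      refine le_of_forall_sub_mul_mem hr fun b hb => ?_
      obtain ⟨c, hc⟩ := mem_sup_span_singleton_iff.1 (hKz b (le_sup_left (a := K) hb))
      refine ⟨c, hKr _ ?_, hc⟩
      have hb' : z * b ∈ K := hb
      have h2 := K.sub_mem hb' (K.mul_mem_left z hc)
      have e : z * b - z * (b - r * c) = r * (z * c) := by ring
      rwa [e] at h2
    exact fun b hb => this hb
  refine ⟨hz, fun b hb => ?_⟩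
  obtain ⟨c, hc⟩ := mem_sup_span_singleton_iff.1 hb
  have hzc : z * c ∈ K ⊔ Ideal.span {r} := by
    refine mem_sup_span_singleton_iff.2 ⟨b, ?_⟩
    have := K.neg_mem hc
    rwa [neg_sub] at this
  obtain ⟨c', hc'⟩ := mem_sup_span_singleton_iff.1 (hKz c hzc)
  refine mem_sup_span_singleton_iff.2 ⟨c', hKr _ ?_⟩
  have := K.add_mem hc (K.mul_mem_left z hc')
  have e : r * b - z * c + z * (c - r * c') = r * (b - z * c') := by ring
  rwa [e] at this

/-- If `A ⧸ K₁` and `A ⧸ K₂` have zero socle, some element of the maximal ideal is a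
nonzerodivisor on both. -/
lemma exists_regMod_of_socle_eq_bot [IsNoetherianRing A] {K₁ K₂ : Ideal A}
    (h₁ : ∀ u, (∀ a ∈ maximalIdeal A, a * u ∈ K₁) → u ∈ K₁)
    (h₂ : ∀ u, (∀ a ∈ maximalIdeal A, a * u ∈ K₂) → u ∈ K₂) :
    ∃ z ∈ maximalIdeal A, RegMod K₁ z ∧ RegMod K₂ z := by
  have hs : Subsingleton ((A ⧸ maximalIdeal A) →ₗ[A] ((A ⧸ K₁) × (A ⧸ K₂))) := by
    refine subsingleton_of_forall_eq 0 fun f => ?_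
    have key : ∀ a ∈ maximalIdeal A, a • f 1 = 0 := by
      intro a ha
      rw [← map_smul, Algebra.smul_def, Ideal.Quotient.algebraMap_eq,
        Ideal.Quotient.eq_zero_iff_mem.2 ha, zero_mul, map_zero]
    obtain ⟨u₁, h1⟩ := Ideal.Quotient.mk_surjective (f 1).1
    obtain ⟨u₂, h2⟩ := Ideal.Quotient.mk_surjective (f 1).2
    have e₁ : (f 1).1 = 0 := by
      rw [← h1]
      refine Ideal.Quotient.eq_zero_iff_mem.2 (h₁ u₁ fun a ha => ?_)
      have := congrArg Prod.fst (key a ha)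
      rw [Prod.smul_fst, ← h1, Algebra.smul_def, Ideal.Quotient.algebraMap_eq, ← map_mul] at this
      exact Ideal.Quotient.eq_zero_iff_mem.1 this
    have e₂ : (f 1).2 = 0 := by
      rw [← h2]
      refine Ideal.Quotient.eq_zero_iff_mem.2 (h₂ u₂ fun a ha => ?_)
      have := congrArg Prod.snd (key a ha)
      rw [Prod.smul_snd, ← h2, Algebra.smul_def, Ideal.Quotient.algebraMap_eq, ← map_mul] at this
      exact Ideal.Quotient.eq_zero_iff_mem.1 this
    have e : f 1 = 0 := Prod.ext e₁ e₂
    refine LinearMap.ext fun w => ?_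
    obtain ⟨w, rfl⟩ := Ideal.Quotient.mk_surjective w
    have hw : Ideal.Quotient.mk (maximalIdeal A) w = w • 1 := by
      rw [Algebra.smul_def, mul_one, Ideal.Quotient.algebraMap_eq]
    rw [hw, map_smul, e, smul_zero, LinearMap.zero_apply]
  obtain ⟨z, hz, hreg⟩ := IsSMulRegular.subsingleton_linearMap_iff.1 hs
  rw [Ideal.annihilator_quotient] at hz
  refine ⟨z, hz, fun b hb => ?_, fun b hb => ?_⟩
  · have : (Ideal.Quotient.mk K₁ b, (0 : A ⧸ K₂)) = 0 := by
      refine hreg ?_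
      ext
      · simpa [Algebra.smul_def, ← map_mul] using Ideal.Quotient.eq_zero_iff_mem.2 hb
      · simp
    exact Ideal.Quotient.eq_zero_iff_mem.1 (congrArg Prod.fst this)
  · have : ((0 : A ⧸ K₁), Ideal.Quotient.mk K₂ b) = 0 := by
      refine hreg ?_
      ext
      · simp
      · simpa [Algebra.smul_def, ← map_mul] using Ideal.Quotient.eq_zero_iff_mem.2 hb
    exact Ideal.Quotient.eq_zero_iff_mem.1 (congrArg Prod.snd this)

/-- For `A ⧸ K`-regular elements `r` and `b` of the maximal ideal, the socle of `A ⧸ (K, b)`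
is carried to that of `A ⧸ (K, r)` by `u ↦ u'`, where `r u = b u'` modulo `K`. -/
lemma exists_socle_transfer {K : Ideal A} {r b u : A} (hr : r ∈ maximalIdeal A)
    (hKb : RegMod K b)
    (hu : ∀ a ∈ maximalIdeal A, a * u ∈ K ⊔ Ideal.span {b}) :
    ∃ u', r * u - b * u' ∈ K ∧ ∀ a ∈ maximalIdeal A, a * u' ∈ K ⊔ Ideal.span {r} := by
  obtain ⟨u', hu'⟩ := mem_sup_span_singleton_iff.1 (hu r hr)
  refine ⟨u', hu', fun a ha => ?_⟩
  obtain ⟨w, hw⟩ := mem_sup_span_singleton_iff.1 (hu a ha)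
  refine mem_sup_span_singleton_iff.2 ⟨w, hKb _ ?_⟩
  have := K.sub_mem (K.mul_mem_left r hw) (K.mul_mem_left a hu')
  have e : r * (a * u - b * w) - a * (r * u - b * u') = b * (a * u' - r * w) := by ring
  rwa [e] at this

lemma SocleLEOne.exchange {K : Ideal A} {r b : A} (hr : r ∈ maximalIdeal A)
    (hKr : RegMod K r) (hKb : RegMod K b) (h : SocleLEOne (K ⊔ Ideal.span {r})) :
    SocleLEOne (K ⊔ Ideal.span {b}) := by
  intro u v hu hv
  obtain ⟨u', hu1, hu2⟩ := exists_socle_transfer hr hKb hu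
  obtain ⟨v', hv1, hv2⟩ := exists_socle_transfer hr hKb hv
  obtain ⟨c, c', hc, hcc⟩ := h u' v' hu2 hv2
  obtain ⟨w, hw⟩ := mem_sup_span_singleton_iff.1 hcc
  refine ⟨c, c', hc, mem_sup_span_singleton_iff.2 ⟨w, hKr _ ?_⟩⟩
  have := K.add_mem (K.sub_mem (K.mul_mem_left c hu1) (K.mul_mem_left c' hv1))
    (K.mul_mem_left b hw)
  have e : c * (r * u - b * u') - c' * (r * v - b * v') + b * (c * u' - c' * v' - r * w) =
    r * (c * u - c' * v - b * w) := by ring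
  rwa [e] at this

/-- The Gorenstein property passes to the quotient by any nonzerodivisor. -/
lemma GorensteinMod.exchange [IsNoetherianRing A] : ∀ {n : ℕ} {K : Ideal A} {b : A},
    GorensteinMod (n + 1) K → b ∈ maximalIdeal A → RegMod K b →
      GorensteinMod n (K ⊔ Ideal.span {b})
  | 0, K, b, ⟨r, hr, hKr, h⟩, _, hKb => SocleLEOne.exchange hr hKr hKb h
  | n + 1, K, b, ⟨r, hr, hKr, h⟩, hb, hKb => by
    have h₁ : ∀ u, (∀ a ∈ maximalIdeal A, a * u ∈ K ⊔ Ideal.span {r}) →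
        u ∈ K ⊔ Ideal.span {r} := by
      obtain ⟨z₀, hz₀, hreg, -⟩ := h
      exact fun u hu => hreg u (hu z₀ hz₀)
    have h₂ : ∀ u, (∀ a ∈ maximalIdeal A, a * u ∈ K ⊔ Ideal.span {b}) →
        u ∈ K ⊔ Ideal.span {b} := by
      intro u hu
      obtain ⟨u', hu1, hu2⟩ := exists_socle_transfer hr hKb hu
      obtain ⟨w, hw⟩ := mem_sup_span_singleton_iff.1 (h₁ u' hu2)
      refine mem_sup_span_singleton_iff.2 ⟨w, hKr _ ?_⟩
      have := K.add_mem hu1 (K.mul_mem_left b hw)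
      have e : r * u - b * u' + b * (u' - r * w) = r * (u - b * w) := by ring
      rwa [e] at this
    -- an auxiliary `z`, regular modulo both `(K, r)` and `(K, b)`, mediates between `r` and `b`
    obtain ⟨z, hz, hrz, hbz⟩ := exists_regMod_of_socle_eq_bot h₁ h₂
    obtain ⟨-, hzr⟩ := hKr.swap hr hrz
    obtain ⟨-, hzb⟩ := hKb.swap hb hbz
    have h3 : GorensteinMod (n + 1) (K ⊔ Ideal.span {z}) := by
      refine ⟨r, hr, hzr, ?_⟩
      rw [sup_right_comm]
      exact h.exchange hz hrz
    refine ⟨z, hz, hbz, ?_⟩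
    rw [sup_right_comm]
    exact h3.exchange hb hzb

/-- Associated primes of `A ⧸ K` have dimension at least the depth. -/
lemma GorensteinMod.le_ringKrullDim_quotient [IsNoetherianRing A] : ∀ {n : ℕ} {K P : Ideal A}
    {u : A}, GorensteinMod n K → P.IsPrime → (∀ a, a ∈ P ↔ a * u ∈ K) →
      (n : WithBot ℕ∞) ≤ ringKrullDim (A ⧸ P)
  | 0, K, P, u, _, hP, _ => by
    have := Ideal.Quotient.nontrivial_iff.2 hP.ne_top
    simpa using ringKrullDim_nonneg_of_nontrivial
  | n + 1, K, P, u, ⟨r, hr, hKr, h⟩, hP, hu => by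
    have huK : u ∉ K := fun h => hP.ne_top ((Ideal.eq_top_iff_one P).2 ((hu 1).2 (by simpa)))
    -- the elements killed by `P` modulo `K` do not all lie in `(K, r)`, by Nakayama's lemma
    obtain ⟨v, hvP, hv⟩ : ∃ v, (∀ a ∈ P, a * v ∈ K) ∧ v ∉ K ⊔ Ideal.span {r} := by
      by_contra! hcon
      let T : Ideal A :=
        { carrier := {v | ∀ a ∈ P, a * v ∈ K}
          zero_mem' := fun a _ => by simp
          add_mem' := fun hx hy a ha => by
            rw [mul_add]; exact K.add_mem (hx a ha) (hy a ha)
          smul_mem' := fun c v hv a ha => by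
            rw [smul_eq_mul, mul_left_comm]; exact K.mul_mem_left _ (hv a ha) }
      have hT : T ≤ K := by
        refine le_of_forall_sub_mul_mem hr fun b hb => ?_
        obtain ⟨c, hc⟩ := mem_sup_span_singleton_iff.1 (hcon b hb)
        refine ⟨c, fun a ha => hKr _ ?_, hc⟩
        have := K.sub_mem (hb a ha) (K.mul_mem_left a hc)
        have e : a * b - a * (b - r * c) = r * (a * c) := by ring
        rwa [e] at this
      exact huK (hT fun a ha => (hu a).1 ha)
    have hv0 : Ideal.Quotient.mk (K ⊔ Ideal.span {r}) v ≠ 0 := fun h =>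
      hv (Ideal.Quotient.eq_zero_iff_mem.1 h)
    obtain ⟨Q, hQ, hQv⟩ := exists_le_isAssociatedPrime_of_isNoetherianRing A _ hv0
    rw [isAssociatedPrime_iff] at hQ
    obtain ⟨hQp, w, hw⟩ := hQ
    obtain ⟨w, rfl⟩ := Ideal.Quotient.mk_surjective w
    have hmem : ∀ (a w : A), a ∈ (⊥ : Submodule A (A ⧸ K ⊔ Ideal.span {r})).colon
        {Ideal.Quotient.mk _ w} ↔ a * w ∈ K ⊔ Ideal.span {r} := by
      intro a w
      rw [Submodule.mem_colon_singleton, Submodule.mem_bot, Algebra.smul_def,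
        Ideal.Quotient.algebraMap_eq, ← map_mul, Ideal.Quotient.eq_zero_iff_mem]
    have ih := h.le_ringKrullDim_quotient hQp (u := w) fun a => by rw [hw, hmem]
    have hPQ : P ≤ Q := fun a ha => hQv ((hmem a v).2 (le_sup_left (a := K) (hvP a ha)))
    have hrQ : r ∈ Q := hQv ((hmem r v).2 (mem_sup_span_singleton_iff.2 ⟨v, by simp⟩))
    have hrP : r ∉ P := fun h => huK (hKr u ((hu r).1 h))
    have hlt := ringKrullDim_succ_le_of_surjective (Ideal.Quotient.factor hPQ)
      (Ideal.Quotient.factor_surjective hPQ) (r := Ideal.Quotient.mk P r)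
      (mem_nonZeroDivisors_of_ne_zero fun h => hrP (Ideal.Quotient.eq_zero_iff_mem.1 h))
      (by simpa using Ideal.Quotient.eq_zero_iff_mem.2 hrQ)
    rw [Nat.cast_add, Nat.cast_one]
    exact (add_le_add_left ih 1).trans hlt

lemma ringKrullDim_quotient_le_length [IsNoetherianRing A] {Q : Ideal A} (hQ : Q.IsPrime)
    {ys : List A} (hys : ∀ y ∈ ys, y ∈ maximalIdeal A)
    (h : ∀ P : Ideal A, P.IsPrime → Q ≤ P → (∀ y ∈ ys, y ∈ P) → P = maximalIdeal A) :
    ringKrullDim (A ⧸ Q) ≤ ys.length := by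
  classical
  have := Ideal.Quotient.nontrivial_iff.2 hQ.ne_top
  let f := Ideal.Quotient.mk Q
  let s : Finset (A ⧸ Q) := (ys.map f).toFinset
  have hloc : IsLocalRing (A ⧸ Q) := .of_surjective' f Ideal.Quotient.mk_surjective
  have hs : (s : Set (A ⧸ Q)) ⊆ Ring.jacobson (A ⧸ Q) := by
    rw [IsLocalRing.ringJacobson_eq_maximalIdeal]
    intro z hz
    obtain ⟨y, hy, rfl⟩ : ∃ y ∈ ys, f y = z := by simpa [s] using hz
    have := hys y hy
    rw [SetLike.mem_coe, mem_maximalIdeal, mem_nonunits_iff]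
    intro hu
    obtain ⟨b, hb⟩ := hu.exists_right_inv
    obtain ⟨b, rfl⟩ := Ideal.Quotient.mk_surjective b
    have h1 : y * b - 1 ∈ Q := by
      rw [← Ideal.Quotient.eq_zero_iff_mem, map_sub, map_mul, map_one, sub_eq_zero]
      exact hb
    have h2 := (maximalIdeal A).sub_mem (Ideal.mul_mem_right b _ this)
      (le_maximalIdeal hQ.ne_top h1)
    rw [sub_sub_cancel] at h2
    exact (Ideal.ne_top_iff_one _).1 (maximalIdeal.isMaximal A).ne_top h2
  refine (ringKrullDim_le_ringKrullDim_quotient_add_card s hs).trans ?_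
  have h0 : ringKrullDim ((A ⧸ Q) ⧸ Ideal.span (s : Set (A ⧸ Q))) ≤ 0 := by
    have : Ring.KrullDimLE 0 ((A ⧸ Q) ⧸ Ideal.span (s : Set (A ⧸ Q))) := by
      rw [Ring.krullDimLE_zero_iff]
      intro P hP
      let g := (Ideal.Quotient.mk (Ideal.span (s : Set (A ⧸ Q)))).comp f
      have hg : Function.Surjective g :=
        Ideal.Quotient.mk_surjective.comp Ideal.Quotient.mk_surjective
      have hm : P.comap g = maximalIdeal A := by
        refine h _ (hP.comap g) (fun a ha => ?_) fun y hy => ?_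
        · have : f a = 0 := Ideal.Quotient.eq_zero_iff_mem.2 ha
          simp [g, Ideal.mem_comap, this]
        · have : f y ∈ Ideal.span (s : Set (A ⧸ Q)) :=
            Ideal.subset_span (by simpa [s] using ⟨y, hy, rfl⟩)
          rw [Ideal.mem_comap, RingHom.comp_apply, Ideal.Quotient.eq_zero_iff_mem.2 this]
          exact P.zero_mem
      rw [← Ideal.map_comap_of_surjective g hg P]
      refine (Ideal.map_eq_top_or_isMaximal_of_surjective g hg
        (by rw [hm]; exact maximalIdeal.isMaximal A)).resolve_left ?_
      rw [Ideal.map_comap_of_surjective g hg P]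
      exact hP.ne_top
    simpa using Ring.krullDimLE_iff.1 this
  calc _ ≤ (0 : WithBot ℕ∞) + s.card := by gcongr
    _ ≤ ys.length := by
      rw [zero_add]
      exact_mod_cast (List.toFinset_card_le _).trans (by simp)

/-- In a Gorenstein quotient `A ⧸ K` of dimension `n`, every system of parameters of length `n` is
a regular sequence, and the quotient by it has a one-dimensional socle. -/
theorem GorensteinMod.regListMod_and_socleLEOne [IsNoetherianRing A] : ∀ {ys : List A}
    {K : Ideal A}, GorensteinMod ys.length K → (∀ y ∈ ys, y ∈ maximalIdeal A) →
      (∀ P : Ideal A, P.IsPrime → K ≤ P → (∀ y ∈ ys, y ∈ P) → P = maximalIdeal A) →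
      RegListMod K ys ∧ SocleLEOne (K ⊔ Ideal.ofList ys)
  | [], K, h, _, _ => by
    refine ⟨trivial, ?_⟩
    rwa [Ideal.ofList_nil, sup_bot_eq]
  | y :: ys, K, h, hys, hP => by
    have hy := hys y List.mem_cons_self
    have hreg : RegMod K y := by
      by_contra hcon
      obtain ⟨b, hb, hbK⟩ : ∃ b, y * b ∈ K ∧ b ∉ K := by simpa [RegMod] using hcon
      have hb0 : Ideal.Quotient.mk K b ≠ 0 := fun h =>
        hbK (Ideal.Quotient.eq_zero_iff_mem.1 h)
      obtain ⟨Q, hQ, hQb⟩ := exists_le_isAssociatedPrime_of_isNoetherianRing A _ hb0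
      rw [isAssociatedPrime_iff] at hQ
      obtain ⟨hQp, w, hw⟩ := hQ
      obtain ⟨w, rfl⟩ := Ideal.Quotient.mk_surjective w
      have hmem : ∀ (a w : A), a ∈ (⊥ : Submodule A (A ⧸ K)).colon
          {Ideal.Quotient.mk _ w} ↔ a * w ∈ K := by
        intro a w
        rw [Submodule.mem_colon_singleton, Submodule.mem_bot, Algebra.smul_def,
          Ideal.Quotient.algebraMap_eq, ← map_mul, Ideal.Quotient.eq_zero_iff_mem]
      have h1 := h.le_ringKrullDim_quotient hQp (u := w) fun a => by rw [hw, hmem]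
      have hKQ : K ≤ Q := fun a ha => by
        rw [hw, hmem]; exact K.mul_mem_right w ha
      have hyQ : y ∈ Q := hQb ((hmem y b).2 hb)
      have h2 := ringKrullDim_quotient_le_length hQp (ys := ys)
        (fun z hz => hys z (List.mem_cons_of_mem _ hz)) fun P hPp hQP hPys =>
          hP P hPp (hKQ.trans hQP) fun z hz => by
            rcases List.mem_cons.1 hz with rfl | hz
            · exact hQP hyQ
            · exact hPys z hz
      have h3 : (((y :: ys).length : ℕ) : WithBot ℕ∞) ≤ (ys.length : ℕ) := h1.trans h2
      have h4 : (y :: ys).length ≤ ys.length := by exact_mod_cast h3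
      simp at h4
    have ih := GorensteinMod.regListMod_and_socleLEOne (ys := ys)
      (h.exchange hy hreg) (fun z hz => hys z (List.mem_cons_of_mem _ hz))
      fun P hPp hKP hPys => hP P hPp (le_sup_left.trans hKP) fun z hz => by
        rcases List.mem_cons.1 hz with rfl | hz
        · exact hKP (le_sup_right (a := K) (Ideal.mem_span_singleton_self z))
        · exact hPys z hz
    rw [Ideal.ofList_cons, ← sup_assoc]
    exact ⟨⟨hreg, ih.1⟩, ih.2⟩

/-- An irreducible ideal has a socle of dimension at most one. -/
lemma SocleLEOne.of_infIrred {K : Ideal A} (h : InfIrred K) : SocleLEOne K := by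
  intro u v hu hv
  by_contra! hcon
  have huv : ∀ c c' : A, c * u - c' * v ∈ K → c ∈ maximalIdeal A ∧ c' ∈ maximalIdeal A := by
    intro c c' hcc
    by_contra hc
    exact hcon c c' (by tauto) hcc
  have hinf : (K ⊔ Ideal.span {u}) ⊓ (K ⊔ Ideal.span {v}) = K := by
    refine le_antisymm (fun b hb => ?_) (le_inf le_sup_left le_sup_left)
    obtain ⟨c, hc⟩ := mem_sup_span_singleton_iff.1 hb.1
    obtain ⟨c', hc'⟩ := mem_sup_span_singleton_iff.1 hb.2
    have h1 := huv c c' (by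
      have := K.sub_mem hc' hc
      have e : b - v * c' - (b - u * c) = c * u - c' * v := by ring
      rwa [e] at this)
    have := K.add_mem hc (hu c h1.1)
    rwa [mul_comm u c, sub_add_cancel] at this
  rcases h.2 hinf with h1 | h1
  · have : u ∈ K := by
      rw [← h1]; exact le_sup_right (a := K) (Ideal.mem_span_singleton_self u)
    exact (maximalIdeal.isMaximal A).ne_top ((Ideal.eq_top_iff_one _).2
      (huv 1 0 (by simpa)).1)
  · have : v ∈ K := by
      rw [← h1]; exact le_sup_right (a := K) (Ideal.mem_span_singleton_self v)
    exact (maximalIdeal.isMaximal A).ne_top ((Ideal.eq_top_iff_one _).2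
      (huv 0 1 (by simpa using K.neg_mem this)).2)

lemma GorensteinMod.of_isWeaklyRegular : ∀ {rs : List A} {K : Ideal A},
    (∀ i (h : i < rs.length), RegMod (K ⊔ Ideal.ofList (rs.take i)) rs[i]) →
    (∀ r ∈ rs, r ∈ maximalIdeal A) → SocleLEOne (K ⊔ Ideal.ofList rs) →
    GorensteinMod rs.length K
  | [], K, _, _, h => by simpa [GorensteinMod] using h
  | r :: rs, K, hreg, hrs, h => by
    refine ⟨r, hrs r List.mem_cons_self, ?_, ?_⟩
    · have := hreg 0 (by simp)
      rwa [List.take_zero, Ideal.ofList_nil, sup_bot_eq] at this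
    refine GorensteinMod.of_isWeaklyRegular (rs := rs) (fun i hi => ?_)
      (fun z hz => hrs z (List.mem_cons_of_mem _ hz)) ?_
    · have := hreg (i + 1) (by simpa using hi)
      simpa [Ideal.ofList_cons, sup_assoc] using this
    · rwa [Ideal.ofList_cons, ← sup_assoc] at h

lemma IsGorensteinLocal.gorensteinMod (h : IsGorensteinLocal A) {n : ℕ}
    (hn : ringKrullDim A = n) : GorensteinMod n (⊥ : Ideal A) := by
  obtain ⟨hN, rs, hreg, hrad, hirr⟩ := h
  have hmem : ∀ r ∈ rs, r ∈ maximalIdeal A := fun r hr => by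
    rw [← hrad]; exact Ideal.le_radical (Ideal.subset_span hr)
  have hdim := _root_.ringKrullDim_add_length_eq_ringKrullDim_of_isRegular rs hreg
  have h0 : ringKrullDim (A ⧸ Ideal.ofList rs) = 0 := by
    have hne : Ideal.ofList rs ≠ ⊤ := fun h => by
      rw [h, Ideal.radical_top] at hrad
      exact (maximalIdeal.isMaximal A).ne_top hrad.symm
    have := Ideal.Quotient.nontrivial_iff.2 hne
    refine le_antisymm ?_ ringKrullDim_nonneg_of_nontrivial
    have : Ring.KrullDimLE 0 (A ⧸ Ideal.ofList rs) := by
      rw [Ring.krullDimLE_zero_iff]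
      intro P hP
      have hs := Ideal.Quotient.mk_surjective (I := Ideal.ofList rs)
      have hm : P.comap (Ideal.Quotient.mk (Ideal.ofList rs)) = maximalIdeal A := by
        refine le_antisymm (le_maximalIdeal (hP.comap _).ne_top) ?_
        rw [← hrad]
        refine (hP.comap _).radical_le_iff.2 fun a ha => ?_
        rw [Ideal.mem_comap, Ideal.Quotient.eq_zero_iff_mem.2 ha]
        exact P.zero_mem
      rw [← Ideal.map_comap_of_surjective _ hs P]
      refine (Ideal.map_eq_top_or_isMaximal_of_surjective _ hs
        (by rw [hm]; exact maximalIdeal.isMaximal A)).resolve_left ?_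
      rw [Ideal.map_comap_of_surjective _ hs P]
      exact hP.ne_top
    simpa using Ring.krullDimLE_iff.1 this
  rw [h0, zero_add, hn] at hdim
  have hlen : rs.length = n := by exact_mod_cast hdim
  rw [← hlen]
  refine GorensteinMod.of_isWeaklyRegular (fun i hi b hb => ?_) hmem
    (.of_infIrred (by rwa [bot_sup_eq]))
  have h1 := hreg.toIsWeaklyRegular.regular_mod_prev i hi
  rw [bot_sup_eq] at hb ⊢
  have h2 := mem_of_isSMulRegular_quotient_of_smul_mem h1 (x := b) (by simpa using hb)
  simpa using h2

end Local

/-! ### Graded algebras: degree filtration and standard gradings -/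

section GradedBasics

open DirectSum

variable {k R : Type*} [Field k] [CommRing R] [Algebra k R] (𝒜 : ℕ → Submodule k R)
  [GradedAlgebra 𝒜]

lemma proj_mem (i : ℕ) (r : R) : GradedRing.proj 𝒜 i r ∈ 𝒜 i := SetLike.coe_mem _

variable {𝒜}

lemma proj_of_mem {i : ℕ} {r : R} (h : r ∈ 𝒜 i) : GradedRing.proj 𝒜 i r = r :=
  decompose_of_mem_same 𝒜 h

lemma proj_of_mem_ne {i j : ℕ} {r : R} (h : r ∈ 𝒜 i) (hij : i ≠ j) :
    GradedRing.proj 𝒜 j r = 0 :=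
  decompose_of_mem_ne 𝒜 h hij

lemma proj_mul_of_left_mem {i : ℕ} (j : ℕ) {a : R} (b : R) (h : a ∈ 𝒜 i) :
    GradedRing.proj 𝒜 (i + j) (a * b) = a * GradedRing.proj 𝒜 j b :=
  coe_decompose_mul_add_of_left_mem 𝒜 h

lemma proj_mul_of_left_mem_of_lt {i n : ℕ} {a : R} (b : R) (h : a ∈ 𝒜 i) (hn : n < i) :
    GradedRing.proj 𝒜 n (a * b) = 0 :=
  coe_decompose_mul_of_left_mem_of_not_le 𝒜 h (not_le.2 hn)

lemma proj_mul_of_right_mem {j : ℕ} (i : ℕ) (a : R) {b : R} (h : b ∈ 𝒜 j) :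
    GradedRing.proj 𝒜 (i + j) (a * b) = GradedRing.proj 𝒜 i a * b :=
  coe_decompose_mul_add_of_right_mem 𝒜 h

variable (𝒜) in
lemma exists_forall_proj_eq_zero (r : R) : ∃ N : ℕ, ∀ i, N < i → GradedRing.proj 𝒜 i r = 0 := by
  classical
  refine ⟨(decompose 𝒜 r).support.sup id, fun i hi => ?_⟩
  by_contra h
  exact absurd (Finset.le_sup (f := id) ((GradedRing.mem_support_iff 𝒜 r i).2 h)) (not_le.2 hi)

lemma sum_proj_eq {r : R} {N : ℕ} (h : ∀ i, N < i → GradedRing.proj 𝒜 i r = 0) :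
    ∑ i ∈ Finset.range (N + 1), GradedRing.proj 𝒜 i r = r := by
  classical
  conv_rhs => rw [← DirectSum.sum_support_decompose 𝒜 r]
  refine (Finset.sum_subset (fun i hi => ?_) fun i _ hi => ?_).symm
  · rw [Finset.mem_range, Nat.lt_succ_iff]
    by_contra hc
    exact (GradedRing.mem_support_iff 𝒜 r i).1 hi (h i (not_le.1 hc))
  · by_contra hc
    exact hi ((GradedRing.mem_support_iff 𝒜 r i).2 hc)

lemma mem_of_forall_proj_mem {I : Ideal R} {r : R} (h : ∀ i, GradedRing.proj 𝒜 i r ∈ I) :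
    r ∈ I := by
  obtain ⟨N, hN⟩ := exists_forall_proj_eq_zero 𝒜 r
  rw [← sum_proj_eq hN]
  exact I.sum_mem fun i _ => h i

lemma ext_proj {r s : R} (h : ∀ i, GradedRing.proj 𝒜 i r = GradedRing.proj 𝒜 i s) : r = s := by
  rw [← sub_eq_zero, ← Ideal.mem_bot]
  refine mem_of_forall_proj_mem (𝒜 := 𝒜) fun i => ?_
  rw [map_sub, h, sub_self]
  exact Ideal.zero_mem _

lemma span_isHomogeneous {ι : Type*} {x : ι → R} {e : ι → ℕ} (h : ∀ i, x i ∈ 𝒜 (e i))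
    (S : Set ι) : (Ideal.span (x '' S)).IsHomogeneous 𝒜 := by
  refine Ideal.homogeneous_span 𝒜 _ ?_
  rintro _ ⟨i, -, rfl⟩
  exact ⟨e i, h i⟩

variable (𝒜) in
/-- The elements of `R` all of whose homogeneous components have degree at most `D`. The bound `D`
is an integer, so that degrees can be subtracted; for `D < 0` only zero remains. -/
def degLE (D : ℤ) : Submodule k R where
  carrier := {z | ∀ i : ℕ, D < i → GradedRing.proj 𝒜 i z = 0}
  zero_mem' := fun i _ => map_zero _
  add_mem' := fun hx hy i hi => by rw [map_add, hx i hi, hy i hi, add_zero]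
  smul_mem' := fun c z hz i hi => by
    have := (GradedAlgebra.proj 𝒜 i).map_smul c z
    simp only [GradedAlgebra.proj_apply] at this
    rw [GradedRing.proj_apply, this, ← GradedRing.proj_apply, hz i hi, smul_zero]

lemma degLE_mono {D E : ℤ} (h : D ≤ E) : degLE 𝒜 D ≤ degLE 𝒜 E :=
  fun _ hz i hi => hz i (h.trans_lt hi)

lemma mem_degLE_of_mem {i : ℕ} {D : ℤ} (h : (i : ℤ) ≤ D) {z : R} (hz : z ∈ 𝒜 i) :
    z ∈ degLE 𝒜 D := fun j hj => proj_of_mem_ne hz (by omega)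

variable (𝒜) in
lemma exists_mem_degLE (z : R) : ∃ D : ℕ, z ∈ degLE 𝒜 D := by
  obtain ⟨N, hN⟩ := exists_forall_proj_eq_zero 𝒜 z
  exact ⟨N, fun i hi => hN i (by exact_mod_cast hi)⟩

lemma eq_zero_of_mem_degLE {D : ℤ} (hD : D < 0) {z : R} (hz : z ∈ degLE 𝒜 D) : z = 0 :=
  ext_proj fun i => by rw [hz i (by omega), map_zero]

lemma sum_proj_of_mem_degLE {D : ℕ} {z : R} (hz : z ∈ degLE 𝒜 D) :
    ∑ i ∈ Finset.range (D + 1), GradedRing.proj 𝒜 i z = z :=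
  sum_proj_eq fun i hi => hz i (by exact_mod_cast hi)

lemma mul_mem_degLE {D E : ℤ} {a b : R} (ha : a ∈ degLE 𝒜 D) (hb : b ∈ degLE 𝒜 E) :
    a * b ∈ degLE 𝒜 (D + E) := by
  rcases lt_or_ge D 0 with hD | hD
  · rw [eq_zero_of_mem_degLE hD ha, zero_mul]; exact zero_mem _
  lift D to ℕ using hD
  rw [← sum_proj_of_mem_degLE ha, Finset.sum_mul]
  refine sum_mem fun i hi n hn => ?_
  rw [Finset.mem_range] at hi
  rcases lt_or_ge n i with h | h
  · exact proj_mul_of_left_mem_of_lt _ (proj_mem 𝒜 i a) h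
  · obtain ⟨j, rfl⟩ := Nat.exists_eq_add_of_le h
    rw [proj_mul_of_left_mem _ _ (proj_mem 𝒜 i a), hb j (by push_cast at hn; omega), mul_zero]

lemma one_mem_degLE : (1 : R) ∈ degLE 𝒜 0 :=
  mem_degLE_of_mem (i := 0) (by simp) (SetLike.GradedOne.one_mem)

lemma pow_mem_degLE {D : ℤ} {a : R} (ha : a ∈ degLE 𝒜 D) (n : ℕ) :
    a ^ n ∈ degLE 𝒜 (n * D) := by
  induction n with
  | zero => simpa using one_mem_degLE (𝒜 := 𝒜)
  | succ n ih =>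
    rw [pow_succ]
    have := mul_mem_degLE ih ha
    convert this using 2
    push_cast; ring

lemma prod_mem_degLE {ι : Type*} (s : Finset ι) {D : ι → ℤ} {a : ι → R}
    (ha : ∀ i ∈ s, a i ∈ degLE 𝒜 (D i)) : ∏ i ∈ s, a i ∈ degLE 𝒜 (∑ i ∈ s, D i) := by
  classical
  induction s using Finset.induction_on with
  | empty => simpa using one_mem_degLE (𝒜 := 𝒜)
  | insert i s hi ih =>
    rw [Finset.prod_insert hi, Finset.sum_insert hi]
    exact mul_mem_degLE (ha i (Finset.mem_insert_self i s))
      (ih fun j hj => ha j (Finset.mem_insert_of_mem hj))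

lemma sub_proj_mem_degLE {D : ℕ} {z : R} (hz : z ∈ degLE 𝒜 D) :
    z - GradedRing.proj 𝒜 D z ∈ degLE 𝒜 (D - 1) := by
  intro i hi
  rw [map_sub]
  rcases eq_or_ne i D with rfl | h
  · rw [proj_of_mem (proj_mem 𝒜 i z), sub_self]
  · rw [proj_of_mem_ne (proj_mem 𝒜 D z) h.symm, sub_zero]
    exact hz i (by omega)

/-- The component of maximal degree of a product. -/
lemma proj_add_mul_of_mem_degLE {D E : ℕ} {a b : R} (ha : a ∈ degLE 𝒜 D) (hb : b ∈ degLE 𝒜 E) :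
    GradedRing.proj 𝒜 (D + E) (a * b) = GradedRing.proj 𝒜 D a * GradedRing.proj 𝒜 E b := by
  have h := mul_mem_degLE (sub_proj_mem_degLE ha) hb (D + E) (by push_cast; omega)
  rw [sub_mul, map_sub, proj_mul_of_left_mem _ _ (proj_mem 𝒜 D a), sub_eq_zero] at h
  exact h

end GradedBasics

section StandardGraded

open DirectSum

variable {k R : Type*} [Field k] [CommRing R] [Algebra k R] {𝒜 : ℕ → Submodule k R}
  [GradedAlgebra 𝒜]

variable (𝒜) in
/-- The irrelevant ideal `R₊`, as an ideal. -/
abbrev irrIdeal : Ideal R := (HomogeneousIdeal.irrelevant 𝒜).toIdeal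

lemma mem_irrelevant_iff_proj {z : R} : z ∈ irrIdeal 𝒜 ↔ GradedRing.proj 𝒜 0 z = 0 :=
  HomogeneousIdeal.mem_irrelevant_iff 𝒜 z

omit [GradedAlgebra 𝒜] in
lemma IsStandardGraded.exists_algebraMap_eq (h : IsStandardGraded 𝒜) {z : R} (hz : z ∈ 𝒜 0) :
    ∃ c : k, algebraMap k R c = z := by
  rw [h.1] at hz
  exact Submodule.mem_one.1 hz

lemma IsStandardGraded.exists_eq_pow (h : IsStandardGraded 𝒜) :
    ∃ V : Submodule k R, V.FG ∧ ∀ n, 𝒜 n = V ^ n := by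
  obtain ⟨h0, S, hS, hadj⟩ := h
  let V := Submodule.span k (S : Set R)
  have hV : V ≤ 𝒜 1 := Submodule.span_le.2 hS
  have hle : ∀ n, V ^ n ≤ 𝒜 n := by
    intro n
    induction n with
    | zero => rw [pow_zero, h0]
    | succ n ih =>
      rw [pow_succ]
      exact Submodule.mul_le.2 fun a ha b hb => SetLike.GradedMul.mul_mem (ih ha) (hV hb)
  refine ⟨V, ⟨S, rfl⟩, fun n => le_antisymm (fun r hr => ?_) (hle n)⟩
  have key : ∀ r : R, ∀ n, GradedRing.proj 𝒜 n r ∈ V ^ n := by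
    intro r
    have hr : r ∈ Algebra.adjoin k (S : Set R) := by rw [hadj]; trivial
    induction hr using Algebra.adjoin_induction with
    | mem s hs =>
      intro n
      by_cases hn : 1 = n
      · subst hn
        rw [proj_of_mem (hS hs), pow_one]
        exact Submodule.subset_span hs
      · rw [proj_of_mem_ne (hS hs) hn]; exact zero_mem _
    | algebraMap c =>
      intro n
      have hc : algebraMap k R c ∈ 𝒜 0 := by
        rw [h0]; exact Submodule.mem_one.2 ⟨c, rfl⟩
      by_cases hn : 0 = n
      · subst hn
        rw [proj_of_mem hc, pow_zero]
        exact Submodule.mem_one.2 ⟨c, rfl⟩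
      · rw [proj_of_mem_ne hc hn]; exact zero_mem _
    | add a b _ _ iha ihb =>
      intro n
      rw [map_add]; exact add_mem (iha n) (ihb n)
    | mul a b _ _ iha ihb =>
      intro n
      obtain ⟨N, hN⟩ := exists_forall_proj_eq_zero 𝒜 a
      rw [← sum_proj_eq hN, Finset.sum_mul, map_sum]
      refine sum_mem fun i _ => ?_
      rcases lt_or_ge n i with h | h
      · rw [proj_mul_of_left_mem_of_lt _ (proj_mem 𝒜 i a) h]; exact zero_mem _
      · obtain ⟨j, rfl⟩ := Nat.exists_eq_add_of_le h
        rw [proj_mul_of_left_mem _ _ (proj_mem 𝒜 i a), pow_add]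
        exact Submodule.mul_mem_mul (iha i) (ihb j)
  rw [← proj_of_mem hr]
  exact key r n

lemma IsStandardGraded.fg (h : IsStandardGraded 𝒜) (n : ℕ) : (𝒜 n).FG := by
  obtain ⟨V, hV, hn⟩ := h.exists_eq_pow
  rw [hn]; exact hV.pow n

omit [GradedAlgebra 𝒜] in
lemma IsStandardGraded.finiteType (h : IsStandardGraded 𝒜) : Algebra.FiniteType k R := by
  obtain ⟨-, S, -, hS⟩ := h
  exact ⟨S, hS⟩

lemma IsStandardGraded.mem_irrelevant_pow_iff (h : IsStandardGraded 𝒜) {n : ℕ} {z : R} :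
    z ∈ irrIdeal 𝒜 ^ n ↔ ∀ i < n, GradedRing.proj 𝒜 i z = 0 := by
  constructor
  · induction n generalizing z with
    | zero => intro _ i hi; omega
    | succ n ih =>
      intro hz i hi
      rw [pow_succ] at hz
      induction hz using Submodule.mul_induction_on' generalizing i with
      | mem_mul_mem a ha b hb =>
        obtain ⟨N, hN⟩ := exists_forall_proj_eq_zero 𝒜 a
        rw [← sum_proj_eq hN, Finset.sum_mul, map_sum]
        refine Finset.sum_eq_zero fun j _ => ?_
        rcases lt_or_ge j n with hj | hj
        · rw [ih ha j hj, zero_mul, map_zero]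
        rcases lt_or_ge i j with h | h
        · exact proj_mul_of_left_mem_of_lt _ (proj_mem 𝒜 j a) h
        · have hij : i = j + 0 := by omega
          rw [hij, proj_mul_of_left_mem _ _ (proj_mem 𝒜 j a), mem_irrelevant_iff_proj.1 hb,
            mul_zero]
      | add a _ b _ iha ihb => rw [map_add, iha i hi, ihb i hi, add_zero]
  · intro hz
    obtain ⟨V, hV, hn⟩ := h.exists_eq_pow
    have hle : ∀ n, ∀ z ∈ V ^ n, z ∈ irrIdeal 𝒜 ^ n := by
      intro n
      induction n with
      | zero => intro z _; rw [pow_zero, Ideal.one_eq_top]; trivial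
      | succ n ih =>
        intro z hz
        rw [pow_succ] at hz ⊢
        induction hz using Submodule.mul_induction_on' with
        | mem_mul_mem a ha b hb =>
          refine Ideal.mul_mem_mul (ih a ha) ?_
          rw [← pow_one V, ← hn] at hb
          exact mem_irrelevant_iff_proj.2 (proj_of_mem_ne hb (by simp))
        | add a _ b _ iha ihb => exact add_mem iha ihb
    refine mem_of_forall_proj_mem (𝒜 := 𝒜) fun i => ?_
    rcases lt_or_ge i n with hi | hi
    · rw [hz i hi]; exact zero_mem _
    · exact Ideal.pow_le_pow_right hi (hle i _ (by rw [← hn]; exact proj_mem 𝒜 i z))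

lemma IsStandardGraded.mem_irrelevant_pow (h : IsStandardGraded 𝒜) {n i : ℕ} {z : R}
    (hz : z ∈ 𝒜 i) (hi : n ≤ i) : z ∈ irrIdeal 𝒜 ^ n :=
  h.mem_irrelevant_pow_iff.2 fun _ hj => proj_of_mem_ne hz (by omega)

/-- The power `R₊ ^ n` of the irrelevant ideal is generated by the elements of degree `n`. -/
lemma IsStandardGraded.irrelevant_pow_le (h : IsStandardGraded 𝒜) {n : ℕ} {I : Ideal R}
    (hI : ∀ y ∈ 𝒜 n, y ∈ I) : irrIdeal 𝒜 ^ n ≤ I := by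
  obtain ⟨V, hV, hn⟩ := h.exists_eq_pow
  intro z hz
  refine mem_of_forall_proj_mem (𝒜 := 𝒜) fun i => ?_
  rcases lt_or_ge i n with hi | hi
  · rw [h.mem_irrelevant_pow_iff.1 hz i hi]; exact zero_mem _
  · have hi' := proj_mem 𝒜 i z
    obtain ⟨j, rfl⟩ := Nat.exists_eq_add_of_le hi
    rw [hn, pow_add] at hi'
    generalize GradedRing.proj 𝒜 (n + j) z = w at hi'
    induction hi' using Submodule.mul_induction_on' with
    | mem_mul_mem a ha b _ => exact I.mul_mem_right _ (hI a (by rwa [hn]))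
    | add a _ b _ iha ihb => exact add_mem iha ihb

lemma irrelevant_isMaximal (h : IsStandardGraded 𝒜) [Nontrivial R] : (irrIdeal 𝒜).IsMaximal := by
  rw [Ideal.isMaximal_iff]
  refine ⟨fun h1 => ?_, fun J z hJ hz hzJ => ?_⟩
  · have := mem_irrelevant_iff_proj.1 h1
    rw [proj_of_mem SetLike.GradedOne.one_mem] at this
    exact one_ne_zero this
  · obtain ⟨c, hc⟩ := h.exists_algebraMap_eq (proj_mem 𝒜 0 z)
    have hc0 : c ≠ 0 := by
      rintro rfl
      rw [map_zero] at hc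
      exact hz (mem_irrelevant_iff_proj.2 hc.symm)
    have h1 : z - algebraMap k R c ∈ J := hJ (mem_irrelevant_iff_proj.2 (by
      rw [hc, map_sub, proj_of_mem (proj_mem 𝒜 0 z), sub_self]))
    have h2 : algebraMap k R c ∈ J := by simpa using J.sub_mem hzJ h1
    have h3 := J.mul_mem_left (algebraMap k R c⁻¹) h2
    rwa [← map_mul, inv_mul_cancel₀ hc0, map_one] at h3

/-- A homogeneous ideal is contracted from the localization at the irrelevant ideal. -/
lemma IsStandardGraded.mem_of_mul_mem (h : IsStandardGraded 𝒜) {K : Ideal R}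
    (hK : K.IsHomogeneous 𝒜) {s u : R} (hs : s ∉ irrIdeal 𝒜) (hsu : s * u ∈ K) : u ∈ K := by
  obtain ⟨c, hc⟩ := h.exists_algebraMap_eq (proj_mem 𝒜 0 s)
  have hc0 : c ≠ 0 := by
    rintro rfl
    rw [map_zero] at hc
    exact hs (mem_irrelevant_iff_proj.2 hc.symm)
  -- `u ≡ a ^ n u` modulo `K` for all `n`, where `a = 1 - c⁻¹ s` is in the irrelevant ideal
  set a := 1 - algebraMap k R c⁻¹ * s with ha
  have ham : a ∈ irrIdeal 𝒜 := by
    rw [mem_irrelevant_iff_proj, ha, map_sub, proj_of_mem SetLike.GradedOne.one_mem]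
    have hc' : algebraMap k R c⁻¹ ∈ 𝒜 0 := by
      rw [h.1]; exact Submodule.mem_one.2 ⟨_, rfl⟩
    have := proj_mul_of_left_mem 0 s hc'
    rw [zero_add] at this
    rw [this, ← hc, ← map_mul, inv_mul_cancel₀ hc0, map_one, sub_self]
  have hau : ∀ n, u - a ^ n * u ∈ K := by
    intro n
    induction n with
    | zero => simp
    | succ n ih =>
      have := K.add_mem ih (K.mul_mem_left (a ^ n * algebraMap k R c⁻¹) hsu)
      have e : u - a ^ n * u + a ^ n * algebraMap k R c⁻¹ * (s * u) = u - a ^ (n + 1) * u := by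
        rw [pow_succ, ha]; ring
      rwa [e] at this
  refine mem_of_forall_proj_mem (𝒜 := 𝒜) fun i => ?_
  have h1 := hK i (hau (i + 1))
  have h2 := h.mem_irrelevant_pow_iff.1
    (Ideal.mul_mem_right u _ (Ideal.pow_mem_pow ham (i + 1))) i (Nat.lt_succ_self i)
  change GradedRing.proj 𝒜 i _ ∈ K at h1
  rwa [map_sub, h2, sub_zero] at h1

end StandardGraded

/-! ### Combinations of homogeneous generators -/

section Representation

variable {k R : Type*} [Field k] [CommRing R] [Algebra k R] {𝒜 : ℕ → Submodule k R}
  [GradedAlgebra 𝒜]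

lemma exists_truncation (E : ℤ) (h : R) :
    ∃ h' ∈ degLE 𝒜 E, ∀ i : ℕ, (i : ℤ) ≤ E → GradedRing.proj 𝒜 i (h - h') = 0 := by
  rcases lt_or_ge E 0 with hE | hE
  · exact ⟨0, zero_mem _, fun i hi => by omega⟩
  lift E to ℕ using hE
  refine ⟨∑ i ∈ Finset.range (E + 1), GradedRing.proj 𝒜 i h, sum_mem fun i hi => ?_, ?_⟩
  · rw [Finset.mem_range] at hi
    exact mem_degLE_of_mem (by omega) (proj_mem 𝒜 i h)
  · intro i hi
    rw [map_sub, map_sum, Finset.sum_eq_single i, proj_of_mem (proj_mem 𝒜 i h), sub_self]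
    · intro j _ hj
      exact proj_of_mem_ne (proj_mem 𝒜 j h) hj
    · intro hi'
      exact absurd (Finset.mem_range.2 (by omega)) hi'

/-- A member of degree at most `D` of an ideal with homogeneous generators `X i`, of degrees `ε i`,
is a combination of them with coefficients of degree at most `D - ε i`. -/
lemma exists_sum_of_mem_span_homogeneous {ι : Type*} {X : ι → R} {ε : ι → ℕ}
    (hX : ∀ i, X i ∈ 𝒜 (ε i)) {s : Finset ι} {D : ℤ} {z : R}
    (hz : z ∈ Ideal.span (X '' s)) (hD : z ∈ degLE 𝒜 D) :
    ∃ h : ι → R, (∀ i, h i ∈ degLE 𝒜 (D - ε i)) ∧ z = ∑ i ∈ s, h i * X i := by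
  classical
  obtain ⟨h, rfl⟩ : ∃ h : ι → R, z = ∑ i ∈ s, h i * X i := by
    obtain ⟨h, hh⟩ := (Submodule.mem_span_image_finset_iff_exists_fun R).1 hz
    refine ⟨fun i => if hi : i ∈ s then h ⟨i, hi⟩ else 0, ?_⟩
    rw [← hh, ← Finset.sum_coe_sort s]
    exact Finset.sum_congr rfl fun i _ => by simp
  choose h' h'mem h'proj using fun i => exists_truncation (𝒜 := 𝒜) (D - ε i) (h i)
  refine ⟨h', h'mem, ext_proj (𝒜 := 𝒜) fun n => ?_⟩
  rcases lt_or_ge D n with hn | hn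
  · rw [hD n hn, eq_comm]
    refine sum_mem (S := degLE 𝒜 D) (fun i _ => ?_) n hn
    have := mul_mem_degLE (h'mem i) (mem_degLE_of_mem le_rfl (hX i))
    rwa [sub_add_cancel] at this
  · rw [← sub_eq_zero, ← map_sub, ← Finset.sum_sub_distrib, map_sum]
    refine Finset.sum_eq_zero fun i _ => ?_
    rw [← sub_mul]
    rcases lt_or_ge n (ε i) with hi | hi
    · rw [mul_comm]
      exact proj_mul_of_left_mem_of_lt _ (hX i) hi
    · obtain ⟨j, rfl⟩ := Nat.exists_eq_add_of_le' hi
      rw [proj_mul_of_right_mem _ _ (hX i), h'proj i j (by push_cast at hn; omega), zero_mul]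

end Representation

/-! ### Finiteness over a system of parameters, and the height of the irrelevant ideal -/

section SOP

variable {k R : Type*} [Field k] [CommRing R] [Algebra k R] {𝒜 : ℕ → Submodule k R}
  [GradedAlgebra 𝒜] {d : ℕ} {x : Fin d → R} {e : Fin d → ℕ}

lemma IsHomogeneousSOP.radical_span (hx : IsHomogeneousSOP 𝒜 x e) :
    (Ideal.span (Set.range x)).radical = irrIdeal 𝒜 := hx.2.2

lemma IsHomogeneousSOP.mem_irrIdeal (hx : IsHomogeneousSOP 𝒜 x e) (i : Fin d) :
    x i ∈ irrIdeal 𝒜 := by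
  rw [← hx.radical_span]
  exact Ideal.le_radical (Ideal.subset_span ⟨i, rfl⟩)

lemma IsHomogeneousSOP.exists_irrIdeal_pow_le [IsNoetherianRing R]
    (hx : IsHomogeneousSOP 𝒜 x e) :
    ∃ N, irrIdeal 𝒜 ^ N ≤ Ideal.span (Set.range x) := by
  obtain ⟨N, hN⟩ := (Ideal.span (Set.range x)).exists_radical_pow_le_of_fg
    (IsNoetherian.noetherian _)
  exact ⟨N, by rwa [hx.radical_span] at hN⟩

lemma IsHomogeneousSOP.nontrivial (hx : IsHomogeneousSOP 𝒜 x e) : Nontrivial R := by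
  by_contra h
  rw [not_nontrivial_iff_subsingleton] at h
  have := ringKrullDim_eq_bot_of_subsingleton (R := R)
  rw [hx.1] at this
  exact absurd this (WithBot.natCast_ne_bot d)

/-- `R` is a finite module over the polynomial ring on a homogeneous system of parameters. -/
lemma IsHomogeneousSOP.finite [IsNoetherianRing R] (hx : IsHomogeneousSOP 𝒜 x e)
    (hstd : IsStandardGraded 𝒜) :
    (MvPolynomial.aeval x : MvPolynomial (Fin d) k →ₐ[k] R).toRingHom.Finite := by
  obtain ⟨N, hN⟩ := hx.exists_irrIdeal_pow_le
  let f := (MvPolynomial.aeval x : MvPolynomial (Fin d) k →ₐ[k] R).toRingHom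
  let := f.toAlgebra
  have halg : ∀ i, algebraMap (MvPolynomial (Fin d) k) R (MvPolynomial.X i) = x i := fun i =>
    MvPolynomial.aeval_X x i
  have : IsScalarTower k (MvPolynomial (Fin d) k) R := .of_algebraMap_eq fun c =>
    ((MvPolynomial.aeval x : MvPolynomial (Fin d) k →ₐ[k] R).commutes c).symm
  choose T hT using fun n => hstd.fg n
  classical
  let G : Finset R := (Finset.range (N + 1)).biUnion T
  let W : Submodule (MvPolynomial (Fin d) k) R := Submodule.span _ (G : Set R)
  have hlow : ∀ n ≤ N, ∀ z ∈ 𝒜 n, z ∈ W := by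
    intro n hn z hz
    rw [← hT n] at hz
    have h1 : Submodule.span k (T n : Set R) ≤ W.restrictScalars k :=
      Submodule.span_le.2 fun t ht => Submodule.subset_span
        (Finset.mem_coe.2 (Finset.mem_biUnion.2 ⟨n, Finset.mem_range.2 (by omega), ht⟩))
    exact h1 hz
  have key : ∀ n : ℕ, ∀ z ∈ degLE 𝒜 n, z ∈ W := by
    intro n
    induction n with
    | zero =>
      intro z hz
      rw [← sum_proj_of_mem_degLE hz]
      exact W.sum_mem fun i hi => hlow i (by simp at hi; omega) _ (proj_mem 𝒜 i z)
    | succ n ih =>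
      intro z hz
      have h1 := sub_proj_mem_degLE hz
      have h2 : GradedRing.proj 𝒜 (n + 1) z ∈ W := by
        rcases le_or_gt (n + 1) N with hn | hn
        · exact hlow _ hn _ (proj_mem 𝒜 _ z)
        · have h3 := hN (hstd.mem_irrelevant_pow (proj_mem 𝒜 (n + 1) z) hn.le)
          rw [← Set.image_univ, ← Finset.coe_univ] at h3
          obtain ⟨h, hh, hsum⟩ := exists_sum_of_mem_span_homogeneous hx.2.1 h3
            (mem_degLE_of_mem le_rfl (proj_mem 𝒜 (n + 1) z))
          rw [hsum]
          refine W.sum_mem fun i _ => ?_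
          rcases Nat.eq_zero_or_pos (e i) with hi | hi
          · have h0 := mem_irrelevant_iff_proj.1 (hx.mem_irrIdeal i)
            have h4 := hx.2.1 i
            rw [hi] at h4
            rw [proj_of_mem h4] at h0
            rw [h0, mul_zero]
            exact W.zero_mem
          · rw [mul_comm, ← halg i, ← Algebra.smul_def]
            exact W.smul_mem _ (ih _ (degLE_mono (by push_cast; omega) (hh i)))
      have h3 := W.add_mem (ih _ (degLE_mono (by push_cast; omega) h1)) h2
      rwa [sub_add_cancel] at h3
  have hW : W = ⊤ := by
    rw [eq_top_iff]
    intro z _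
    obtain ⟨D, hD⟩ := exists_mem_degLE 𝒜 z
    exact key D z hD
  exact ⟨⟨G, hW⟩⟩

/-- The endomorphism of the polynomial ring that sends `X i` to zero for `i < j` and fixes the other
variables. -/
noncomputable def killBelow (k : Type*) [Field k] (d j : ℕ) :
    MvPolynomial (Fin d) k →ₐ[k] MvPolynomial (Fin d) k :=
  MvPolynomial.aeval fun i : Fin d => if (i : ℕ) < j then 0 else MvPolynomial.X i

section KillBelow

variable {k : Type*} [Field k] {d j : ℕ} {i : Fin d}

lemma killBelow_X_of_lt (h : (i : ℕ) < j) : killBelow k d j (MvPolynomial.X i) = 0 := by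
  rw [killBelow, MvPolynomial.aeval_X, if_pos h]

lemma killBelow_X_of_le (h : j ≤ (i : ℕ)) :
    killBelow k d j (MvPolynomial.X i) = MvPolynomial.X i := by
  rw [killBelow, MvPolynomial.aeval_X, if_neg (not_lt.2 h)]

lemma killBelow_comp (k : Type*) [Field k] (d j : ℕ) :
    (killBelow k d (j + 1)).comp (killBelow k d j) = killBelow k d (j + 1) := by
  ext i : 1
  rw [AlgHom.comp_apply]
  rcases lt_or_ge (i : ℕ) j with h | h
  · rw [killBelow_X_of_lt h, map_zero, killBelow_X_of_lt (h.trans (Nat.lt_succ_self j))]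
  · rw [killBelow_X_of_le h]

end KillBelow

/-- The chain of primes `0 ⊂ (X₀) ⊂ (X₀, X₁) ⊂ ⋯` of a polynomial ring. -/
noncomputable def mvPolynomialChain (k : Type*) [Field k] (d : ℕ) :
    LTSeries (PrimeSpectrum (MvPolynomial (Fin d) k)) where
  length := d
  toFun j := ⟨RingHom.ker (killBelow k d j), RingHom.ker_isPrime _⟩
  step j := by
    change RingHom.ker (killBelow k d j) < RingHom.ker (killBelow k d (j + 1))
    refine lt_of_le_of_ne (fun a ha => ?_) fun h => ?_
    · rw [RingHom.mem_ker] at ha ⊢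
      rw [← killBelow_comp, AlgHom.comp_apply, ha, map_zero]
    · have h1 : MvPolynomial.X (R := k) j ∈ RingHom.ker (killBelow k d (j + 1)) :=
        killBelow_X_of_lt (Nat.lt_succ_self _)
      rw [← h, RingHom.mem_ker, killBelow_X_of_le le_rfl] at h1
      exact MvPolynomial.X_ne_zero j h1

/-- The irrelevant ideal has height `d`, by going up along the polynomial ring on the parameters. -/
lemma IsHomogeneousSOP.le_height [IsNoetherianRing R] (hx : IsHomogeneousSOP 𝒜 x e)
    (hstd : IsStandardGraded 𝒜) : (d : ℕ∞) ≤ (irrIdeal 𝒜).height := by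
  have := hx.nontrivial
  have hmax := irrelevant_isMaximal hstd
  let f := (MvPolynomial.aeval x : MvPolynomial (Fin d) k →ₐ[k] R).toRingHom
  let := f.toAlgebra
  have hfin : Module.Finite (MvPolynomial (Fin d) k) R := hx.finite hstd
  have hint : Algebra.IsIntegral (MvPolynomial (Fin d) k) R := inferInstance
  let A := MvPolynomial (Fin d) k
  have hstrict : StrictMono (PrimeSpectrum.comap (algebraMap A R)) := by
    intro P Q hPQ
    obtain ⟨hle, z, hzQ, hzP⟩ := SetLike.lt_iff_le_and_exists.1
      (show P.asIdeal < Q.asIdeal from hPQ)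
    exact Ideal.comap_lt_comap_of_integral_mem_sdiff hle ⟨hzQ, hzP⟩ (hint.isIntegral z)
  obtain ⟨l, hl⟩ := Order.le_krullDim_iff.1
    (show (d : WithBot ℕ∞) ≤ Order.krullDim (PrimeSpectrum R) from hx.1.ge)
  let l' := l.map _ hstrict
  -- the chain below contracts to a chain starting at zero, because `A` has dimension `d`
  have hhead : (PrimeSpectrum.comap (algebraMap A R) l.head).asIdeal = ⊥ := by
    by_contra hne
    have hlt : (⟨⊥, Ideal.isPrime_bot⟩ : PrimeSpectrum A) < l'.head := by
      change (⊥ : Ideal A) < _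
      rw [bot_lt_iff_ne_bot]
      exact hne
    have h1 : ((l'.cons _ hlt).length : WithBot ℕ∞) ≤ Order.krullDim (PrimeSpectrum A) :=
      Order.le_krullDim_iff.2 ⟨_, rfl⟩
    have h2 : Order.krullDim (PrimeSpectrum A) = d := by
      have := MvPolynomial.ringKrullDim_of_isNoetherianRing (R := k) (ι := Fin d)
      rw [ringKrullDim_eq_zero_of_field, zero_add, Nat.card_fin] at this
      exact this
    rw [h2] at h1
    have h3 : (l'.cons _ hlt).length ≤ d := by exact_mod_cast h1
    have h4 : (l'.cons _ hlt).length = l.length + 1 := by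
      simp [l']
    omega
  have hlo : l.head.asIdeal.LiesOver (RelSeries.head (mvPolynomialChain k d)).asIdeal := by
    refine ⟨?_⟩
    change _ = (PrimeSpectrum.comap (algebraMap A R) l.head).asIdeal
    rw [hhead]
    change RingHom.ker (killBelow k d 0) = ⊥
    have : killBelow k d 0 = AlgHom.id k _ := by
      ext i : 1
      exact killBelow_X_of_le (Nat.zero_le _)
    rw [this]
    exact (RingHom.injective_iff_ker_eq_bot _).1 fun a b h => h
  obtain ⟨L, hLlen, -, hL⟩ := Ideal.exists_ltSeries_of_hasGoingUp (mvPolynomialChain k d)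
    l.head.asIdeal
  have hlast : PrimeSpectrum.comap (algebraMap A R) L.last = (mvPolynomialChain k d).last := by
    rw [← RelSeries.getLast_toList, ← RelSeries.getLast_toList]
    simp only [← hL]
    rw [List.getLast_map]
  have hle : irrIdeal 𝒜 ≤ L.last.asIdeal := by
    rw [← hx.radical_span]
    refine L.last.isPrime.radical_le_iff.2 (Ideal.span_le.2 ?_)
    rintro _ ⟨i, rfl⟩
    have h1 : MvPolynomial.X i ∈ (mvPolynomialChain k d).last.asIdeal :=
      killBelow_X_of_lt (j := d) i.2
    rw [← hlast] at h1
    have h2 : algebraMap A R (MvPolynomial.X i) ∈ L.last.asIdeal := h1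
    have h3 : algebraMap A R (MvPolynomial.X i) = x i := MvPolynomial.aeval_X x i
    rwa [h3] at h2
  have heq : irrIdeal 𝒜 = L.last.asIdeal := hmax.eq_of_le L.last.isPrime.ne_top hle
  have h1 : (L.length : ℕ∞) ≤ Order.height L.last := Order.length_le_height_last
  rw [hLlen, ← PrimeSpectrum.height_eq_orderHeight, ← heq] at h1
  exact h1

lemma IsHomogeneousSOP.ringKrullDim_atPrime [IsNoetherianRing R] (hx : IsHomogeneousSOP 𝒜 x e)
    (hstd : IsStandardGraded 𝒜) [(irrIdeal 𝒜).IsMaximal] :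
    ringKrullDim (Localization.AtPrime (irrIdeal 𝒜)) = d := by
  rw [IsLocalization.AtPrime.ringKrullDim_eq_height (irrIdeal 𝒜)]
  refine le_antisymm ?_ (by exact_mod_cast hx.le_height hstd)
  rw [← hx.1]
  exact Ideal.height_le_ringKrullDim_of_ne_top Ideal.IsPrime.ne_top'

end SOP

/-! ### Regular sequences and socles in graded Gorenstein algebras -/

section RegularFamily

variable {R : Type*} [CommRing R] {d : ℕ}

/-- Every member of the family is a nonzerodivisor modulo any set of other members, so that the
members form a regular sequence in any order. -/
def RegularFamily (X : Fin d → R) : Prop :=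
  ∀ (S : Finset (Fin d)) (i : Fin d), i ∉ S → RegMod (Ideal.span (X '' S)) (X i)

/-- The socle of `R ⧸ I` with respect to the maximal ideal `M` has dimension at most one. -/
def SocleLEOneAt (M I : Ideal R) : Prop :=
  ∀ u v, (∀ a ∈ M, a * u ∈ I) → (∀ a ∈ M, a * v ∈ I) →
    ∃ c c' : R, (c ∉ M ∨ c' ∉ M) ∧ c * u - c' * v ∈ I

end RegularFamily

section SOP

variable {k R : Type*} [Field k] [CommRing R] [Algebra k R] {𝒜 : ℕ → Submodule k R}
  [GradedAlgebra 𝒜] {d : ℕ} {x : Fin d → R} {e : Fin d → ℕ}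

/-- In a graded Gorenstein algebra a homogeneous system of parameters is a regular sequence, and
the quotient by it has a one-dimensional socle. -/
theorem IsHomogeneousSOP.regularFamily_and_socleLEOneAt (hx : IsHomogeneousSOP 𝒜 x e)
    (hstd : IsStandardGraded 𝒜) (hGor : IsGorenstein R) :
    RegularFamily x ∧ SocleLEOneAt (irrIdeal 𝒜) (Ideal.span (Set.range x)) := by
  have := hGor.1
  have := hx.nontrivial
  have hmax := irrelevant_isMaximal hstd
  let A := Localization.AtPrime (irrIdeal 𝒜)
  let f := algebraMap R A
  have hNoeth : IsNoetherianRing A := IsLocalization.isNoetherianRing (irrIdeal 𝒜).primeCompl A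
    inferInstance
  have hG : GorensteinMod d (⊥ : Ideal A) :=
    (hGor.2 (irrIdeal 𝒜)).gorensteinMod (hx.ringKrullDim_atPrime hstd)
  have hcontr : ∀ K : Ideal R, K.IsHomogeneous 𝒜 → ∀ b, f b ∈ K.map f → b ∈ K := by
    intro K hK b hb
    obtain ⟨s, hs, hsb⟩ := (IsLocalization.algebraMap_mem_map_algebraMap_iff
      (irrIdeal 𝒜).primeCompl A K b).1 hb
    exact hstd.mem_of_mul_mem hK hs hsb
  have hmap : ∀ L : List (Fin d), Ideal.ofList (L.map fun i => f (x i)) =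
      (Ideal.span (x '' {i | i ∈ L})).map f := by
    intro L
    rw [Ideal.map_span, Ideal.ofList]
    congr 1
    ext a
    simp
  have main : ∀ L : List (Fin d), L.length = d → (∀ i, i ∈ L) →
      RegListMod (⊥ : Ideal A) (L.map fun i => f (x i)) ∧
        SocleLEOne (⊥ ⊔ Ideal.ofList (L.map fun i => f (x i))) := by
    intro L hL hLmem
    refine GorensteinMod.regListMod_and_socleLEOne (by rwa [List.length_map, hL]) ?_ ?_
    · intro y hy
      obtain ⟨i, -, rfl⟩ := List.mem_map.1 hy
      rw [← Localization.AtPrime.map_eq_maximalIdeal]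
      exact Ideal.mem_map_of_mem _ (hx.mem_irrIdeal i)
    · intro P hP _ hPx
      refine le_antisymm (IsLocalRing.le_maximalIdeal hP.ne_top) ?_
      rw [← Localization.AtPrime.map_eq_maximalIdeal, Ideal.map_le_iff_le_comap]
      refine hx.radical_span.ge.trans ?_
      refine (hP.comap f).radical_le_iff.2 (Ideal.span_le.2 ?_)
      rintro _ ⟨i, rfl⟩
      exact hPx _ (List.mem_map.2 ⟨i, hLmem i, rfl⟩)
  constructor
  · intro S i hi b hb
    classical
    have hlen : (S.toList ++ i :: (Finset.univ \ insert i S).toList).length = d := by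
      have h1 := Finset.card_sdiff_add_card_eq_card (Finset.subset_univ (insert i S))
      rw [Finset.card_insert_of_notMem hi, Finset.card_univ, Fintype.card_fin] at h1
      simp only [List.length_append, List.length_cons, Finset.length_toList]
      omega
    have hreg := (main _ hlen fun j => by
      by_cases h1 : j ∈ S
      · simp [h1]
      · by_cases h2 : j = i <;> simp [h1, h2]).1
    rw [List.map_append, List.map_cons] at hreg
    have h1 := hreg.of_append
    rw [bot_sup_eq, hmap] at h1
    have h2 : {j | j ∈ S.toList} = (S : Set (Fin d)) := by ext; simp
    rw [h2] at h1
    refine hcontr _ (span_isHomogeneous hx.2.1 _) b (h1 _ ?_)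
    rw [← map_mul]
    exact Ideal.mem_map_of_mem f hb
  · intro u v hu hv
    have h1 := (main (List.finRange d) List.length_finRange List.mem_finRange).2
    have h2 : x '' {j | j ∈ List.finRange d} = Set.range x := by simp
    rw [bot_sup_eq, hmap, h2] at h1
    have hI : (Ideal.span (Set.range x)).IsHomogeneous 𝒜 := by
      rw [← Set.image_univ]; exact span_isHomogeneous hx.2.1 _
    set I := Ideal.span (Set.range x)
    have hsoc : ∀ w, (∀ a ∈ irrIdeal 𝒜, a * w ∈ I) →
        ∀ a ∈ IsLocalRing.maximalIdeal A, a * f w ∈ I.map f := by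
      intro w hw a ha
      rw [← Localization.AtPrime.map_eq_maximalIdeal] at ha
      have hle : (irrIdeal 𝒜).map f ≤ Submodule.comap (LinearMap.mulRight A (f w)) (I.map f) := by
        rw [Ideal.map_le_iff_le_comap]
        intro a ha
        change f a * f w ∈ I.map f
        rw [← map_mul]
        exact Ideal.mem_map_of_mem f (hw a ha)
      exact hle ha
    obtain ⟨c, c', hc, hcc⟩ := h1 (f u) (f v) (hsoc u hu) (hsoc v hv)
    obtain ⟨⟨c₁, s⟩, hs⟩ := IsLocalization.surj (irrIdeal 𝒜).primeCompl c
    obtain ⟨⟨c₁', s'⟩, hs'⟩ := IsLocalization.surj (irrIdeal 𝒜).primeCompl c'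
    have hnot : ∀ (c : A) (c₁ : R) (s : (irrIdeal 𝒜).primeCompl), c * f s = f c₁ →
        c ∉ IsLocalRing.maximalIdeal A → c₁ ∉ irrIdeal 𝒜 := by
      intro c c₁ s hs hc hc₁
      have h3 : f c₁ ∈ IsLocalRing.maximalIdeal A := by
        rw [← Localization.AtPrime.map_eq_maximalIdeal]
        exact Ideal.mem_map_of_mem _ hc₁
      rw [← hs] at h3
      have h4 : IsUnit (f s) := IsLocalization.map_units A s
      exact hc ((Ideal.mul_unit_mem_iff_mem _ h4).1 h3)
    refine ⟨c₁ * s', c₁' * s, ?_, hcontr _ hI _ ?_⟩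
    · rcases hc with hc | hc
      · exact Or.inl fun h =>
          s'.2 ((hmax.isPrime.mem_or_mem h).resolve_left (hnot c c₁ s hs hc))
      · exact Or.inr fun h =>
          s.2 ((hmax.isPrime.mem_or_mem h).resolve_left (hnot c' c₁' s' hs' hc))
    · have h3 := (I.map f).mul_mem_left (f s * f s') hcc
      have e1 : f s * f s' * (c * f u - c' * f v) = f (c₁ * s' * u - c₁' * s * v) := by
        simp only [map_sub, map_mul]
        rw [← show c * f s = f c₁ from hs, ← show c' * f s' = f c₁' from hs']
        ring
      rwa [e1] at h3

/-- Powers of the members of a homogeneous system of parameters form another one. -/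
lemma IsHomogeneousSOP.pow (hx : IsHomogeneousSOP 𝒜 x e) {n : Fin d → ℕ} (hn : ∀ i, 1 ≤ n i) :
    IsHomogeneousSOP 𝒜 (fun i => x i ^ n i) (fun i => n i * e i) := by
  refine ⟨hx.1, fun i => ?_, ?_⟩
  · have := SetLike.pow_mem_graded (A := 𝒜) (n i) (hx.2.1 i)
    simpa using this
  · change _ = irrIdeal 𝒜
    rw [← hx.radical_span]
    refine le_antisymm (Ideal.radical_mono (Ideal.span_le.2 ?_)) ?_
    · rintro _ ⟨i, rfl⟩
      exact Ideal.pow_mem_of_mem _ (Ideal.subset_span (Set.mem_range_self i)) _ (hn i)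
    · rw [Ideal.radical_le_radical_iff, Ideal.span_le]
      rintro _ ⟨i, rfl⟩
      exact Ideal.mem_radical_of_pow_mem (m := n i)
        (Ideal.le_radical <| Ideal.subset_span (Set.mem_range_self (f := fun i => x i ^ n i) i))

/-- The socle of an artinian quotient `R ⧸ I` of a standard graded algebra, when one-dimensional,
sits in the top degree `s`, and every nonzero homogeneous element has a homogeneous multiple
there. -/
structure HasSocleDegree (𝒜 : ℕ → Submodule k R) (I : Ideal R) (s : ℕ) : Prop where
  mem_of_lt : ∀ {j : ℕ} {b : R}, s < j → b ∈ 𝒜 j → b ∈ I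
  exists_mul_notMem : ∀ {j : ℕ} {b : R}, b ∈ 𝒜 j → b ∉ I →
    ∃ i, ∃ v ∈ 𝒜 i, j + i = s ∧ b * v ∉ I
  exists_sub_mem : ∀ {u v : R}, u ∈ 𝒜 s → v ∈ 𝒜 s → v ∉ I →
    ∃ c : k, u - algebraMap k R c * v ∈ I

lemma HasSocleDegree.exists_notMem {I : Ideal R} {s : ℕ} (h : HasSocleDegree 𝒜 I s)
    (hI : I ≠ ⊤) : ∃ w ∈ 𝒜 s, w ∉ I := by
  obtain ⟨i, v, hv, hi, hvI⟩ := h.exists_mul_notMem (b := 1) (j := 0) SetLike.GradedOne.one_mem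
    ((Ideal.ne_top_iff_one I).1 hI)
  rw [one_mul] at hvI
  rw [zero_add] at hi
  exact ⟨v, hi ▸ hv, hvI⟩

/-- A homogeneous ideal that contains a power of `R₊` and has a socle of dimension at most one has
a socle degree. -/
lemma exists_hasSocleDegree (hstd : IsStandardGraded 𝒜) {I : Ideal R} (hI : I.IsHomogeneous 𝒜)
    (hItop : I ≠ ⊤) {N : ℕ} (hN : irrIdeal 𝒜 ^ N ≤ I) (hsoc : SocleLEOneAt (irrIdeal 𝒜) I) :
    ∃ s, HasSocleDegree 𝒜 I s := by
  classical
  have hzero : ∀ j, N ≤ j → ∀ b ∈ 𝒜 j, b ∈ I := fun j hj b hb =>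
    hN (hstd.mem_irrelevant_pow hb hj)
  -- a nonzero homogeneous element has a nonzero homogeneous multiple of maximal degree, which
  -- lies in the socle
  have hmul : ∀ j, ∀ b ∈ 𝒜 j, b ∉ I → ∃ i, ∃ v ∈ 𝒜 i, b * v ∉ I ∧
      ∀ a ∈ irrIdeal 𝒜, a * (b * v) ∈ I := by
    intro j b hb hbI
    let P : ℕ → Prop := fun i => ∃ v ∈ 𝒜 i, b * v ∉ I
    have hP0 : P 0 := ⟨1, SetLike.GradedOne.one_mem, by rwa [mul_one]⟩
    have hPN : ∀ i, P i → i ≤ N := by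
      rintro i ⟨v, hv, hvI⟩
      by_contra hi
      exact hvI (I.mul_mem_left b (hzero i (by omega) v hv))
    obtain ⟨v, hv, hvI⟩ := Nat.findGreatest_spec (P := P) (Nat.zero_le N) hP0
    refine ⟨_, v, hv, hvI, fun a ha => ?_⟩
    refine mem_of_forall_proj_mem (𝒜 := 𝒜) fun n => ?_
    have hbv := SetLike.GradedMul.mul_mem hb hv
    rcases lt_or_ge n (j + Nat.findGreatest P N) with hn | hn
    · rw [mul_comm, proj_mul_of_left_mem_of_lt _ hbv hn]; exact I.zero_mem
    obtain ⟨i, rfl⟩ := Nat.exists_eq_add_of_le' hn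
    rw [proj_mul_of_right_mem _ _ hbv]
    rcases Nat.eq_zero_or_pos i with rfl | hi
    · rw [mem_irrelevant_iff_proj.1 ha, zero_mul]; exact I.zero_mem
    · by_contra hcon
      have h1 : P (Nat.findGreatest P N + i) :=
        ⟨v * GradedRing.proj 𝒜 i a, SetLike.GradedMul.mul_mem hv (proj_mem 𝒜 i a), by
          rwa [← mul_assoc, mul_comm]⟩
      have h2 := Nat.le_findGreatest (hPN _ h1) h1
      omega
  have hproj : ∀ {a w : R} {n : ℕ}, w ∈ 𝒜 n → (∀ a ∈ irrIdeal 𝒜, a * w ∈ I) →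
      ∃ c : k, a * w - algebraMap k R c * w ∈ I ∧ (a ∉ irrIdeal 𝒜 → c ≠ 0) := by
    intro a w n _ hw
    obtain ⟨c, hc⟩ := hstd.exists_algebraMap_eq (proj_mem 𝒜 0 a)
    refine ⟨c, ?_, ?_⟩
    · rw [← sub_mul]
      refine hw _ (mem_irrelevant_iff_proj.2 ?_)
      rw [hc, map_sub, proj_of_mem (proj_mem 𝒜 0 a), sub_self]
    · rintro ha rfl
      rw [map_zero] at hc
      exact ha (mem_irrelevant_iff_proj.2 hc.symm)
  have hrel : ∀ {u v : R} {m n : ℕ}, u ∈ 𝒜 m → v ∈ 𝒜 n → (∀ a ∈ irrIdeal 𝒜, a * u ∈ I) →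
      (∀ a ∈ irrIdeal 𝒜, a * v ∈ I) →
      ∃ c c' : k, (c ≠ 0 ∨ c' ≠ 0) ∧ algebraMap k R c * u - algebraMap k R c' * v ∈ I := by
    intro u v m n hu hv hmu hmv
    obtain ⟨a, a', ha, haa⟩ := hsoc u v hmu hmv
    obtain ⟨c, hc, hc0⟩ := hproj (a := a) hu hmu
    obtain ⟨c', hc', hc0'⟩ := hproj (a := a') hv hmv
    refine ⟨c, c', ha.imp hc0 hc0', ?_⟩
    have := I.add_mem (I.sub_mem haa hc) hc'
    have e1 : a * u - a' * v - (a * u - algebraMap k R c * u) +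
      (a' * v - algebraMap k R c' * v) = algebraMap k R c * u - algebraMap k R c' * v := by ring
    rwa [e1] at this
  have hunit : ∀ {c : k} {w : R}, c ≠ 0 → algebraMap k R c * w ∈ I → w ∈ I := by
    intro c w hc hw
    have := I.mul_mem_left (algebraMap k R c⁻¹) hw
    rwa [← mul_assoc, ← map_mul, inv_mul_cancel₀ hc, map_one, one_mul] at this
  have hsmul : ∀ {c : k} {w : R} {n : ℕ}, w ∈ 𝒜 n → algebraMap k R c * w ∈ 𝒜 n := by
    intro c w n hw
    rw [← Algebra.smul_def]; exact (𝒜 n).smul_mem c hw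
  -- two nonzero homogeneous socle elements have the same degree
  have hdeg : ∀ {u v : R} {m n : ℕ}, u ∈ 𝒜 m → v ∈ 𝒜 n → u ∉ I → v ∉ I →
      (∀ a ∈ irrIdeal 𝒜, a * u ∈ I) → (∀ a ∈ irrIdeal 𝒜, a * v ∈ I) → m = n := by
    intro u v m n hu hv huI hvI hmu hmv
    by_contra hmn
    obtain ⟨c, c', hc, hcc⟩ := hrel hu hv hmu hmv
    rcases hc with hc | hc
    · have h1 := hI m hcc
      change GradedRing.proj 𝒜 m _ ∈ I at h1
      rw [map_sub, proj_of_mem (hsmul hu), proj_of_mem_ne (hsmul hv) (Ne.symm hmn), sub_zero] at h1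
      exact huI (hunit hc h1)
    · have h1 := hI n hcc
      change GradedRing.proj 𝒜 n _ ∈ I at h1
      rw [map_sub, proj_of_mem (hsmul hv), proj_of_mem_ne (hsmul hu) hmn, zero_sub,
        neg_mem_iff] at h1
      exact hvI (hunit hc h1)
  obtain ⟨s, w, hw, hwI, hmw⟩ := hmul 0 1 SetLike.GradedOne.one_mem
    ((Ideal.ne_top_iff_one I).1 hItop)
  rw [one_mul] at hwI hmw
  have hex : ∀ {j : ℕ} {b : R}, b ∈ 𝒜 j → b ∉ I → ∃ i, ∃ v ∈ 𝒜 i, j + i = s ∧ b * v ∉ I := by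
    intro j b hb hbI
    obtain ⟨i, v, hv, hvI, hmv⟩ := hmul j b hb hbI
    exact ⟨i, v, hv, hdeg (SetLike.GradedMul.mul_mem hb hv) hw hvI hwI hmv hmw, hvI⟩
  have htop : ∀ {j : ℕ} {b : R}, s < j → b ∈ 𝒜 j → b ∈ I := by
    intro j b hj hb
    by_contra hbI
    obtain ⟨i, v, -, hi, -⟩ := hex hb hbI
    omega
  refine ⟨s, htop, hex, fun {u v} hu hv hvI => ?_⟩
  have hmtop : ∀ {u : R}, u ∈ 𝒜 s → ∀ a ∈ irrIdeal 𝒜, a * u ∈ I := by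
    intro u hu a ha
    refine mem_of_forall_proj_mem (𝒜 := 𝒜) fun n => ?_
    rcases lt_or_ge n s with hn | hn
    · rw [mul_comm, proj_mul_of_left_mem_of_lt _ hu hn]; exact I.zero_mem
    obtain ⟨i, rfl⟩ := Nat.exists_eq_add_of_le' hn
    rw [proj_mul_of_right_mem _ _ hu]
    rcases Nat.eq_zero_or_pos i with rfl | hi
    · rw [mem_irrelevant_iff_proj.1 ha, zero_mul]; exact I.zero_mem
    · exact htop (by omega) (SetLike.GradedMul.mul_mem (proj_mem 𝒜 i a) hu)
  obtain ⟨c, c', hc, hcc⟩ := hrel hu hv (hmtop hu) (hmtop hv)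
  have hc0 : c ≠ 0 := by
    rintro rfl
    rw [map_zero, zero_mul, zero_sub, neg_mem_iff] at hcc
    exact hvI (hunit (hc.resolve_left (by simp)) hcc)
  refine ⟨c⁻¹ * c', hunit hc0 ?_⟩
  rw [mul_sub, ← mul_assoc, ← map_mul, mul_inv_cancel_left₀ hc0]
  exact hcc

end SOP

/-! ### Powers of a system of parameters and the `a`-invariant -/

section AInvariant

variable {k R : Type*} [Field k] [CommRing R] [Algebra k R] {𝒜 : ℕ → Submodule k R}
  [GradedAlgebra 𝒜] {d : ℕ} {x : Fin d → R} {e : Fin d → ℕ}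

lemma mem_powIdeal_iff {R : Type*} [CommRing R] {d : ℕ} {x : Fin d → R} {t : ℕ} {b : R} :
    b ∈ powIdeal x t ↔ ∃ h : Fin d → R, b = ∑ i, h i * x i ^ t := by
  rw [powIdeal, Ideal.mem_span_range_iff_exists_fun]
  exact exists_congr fun h => eq_comm

lemma pow_mem_powIdeal {R : Type*} [CommRing R] {d : ℕ} (x : Fin d → R) (t : ℕ) (i : Fin d) :
    x i ^ t ∈ powIdeal x t :=
  Ideal.subset_span (Set.mem_range_self (f := fun i => x i ^ t) i)

lemma powIdeal_isHomogeneous (hx : IsHomogeneousSOP 𝒜 x e) (t : ℕ) :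
    (powIdeal x t).IsHomogeneous 𝒜 := by
  rw [powIdeal, ← Set.image_univ]
  refine span_isHomogeneous (e := fun i => t * e i) (fun i => ?_) _
  have := SetLike.pow_mem_graded (A := 𝒜) t (hx.2.1 i)
  simpa using this

lemma powIdeal_le_irrIdeal_pow (hx : IsHomogeneousSOP 𝒜 x e) (t : ℕ) :
    powIdeal x t ≤ irrIdeal 𝒜 ^ t := by
  rw [powIdeal, Ideal.span_le]
  rintro _ ⟨i, rfl⟩
  exact Ideal.pow_mem_pow (hx.mem_irrIdeal i) t

lemma powIdeal_ne_top (hx : IsHomogeneousSOP 𝒜 x e) (hstd : IsStandardGraded 𝒜) {t : ℕ}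
    (ht : 1 ≤ t) : powIdeal x t ≠ ⊤ := by
  have := hx.nontrivial
  intro h
  refine (irrelevant_isMaximal hstd).ne_top (top_le_iff.1 ?_)
  rw [← h]
  exact (powIdeal_le_irrIdeal_pow hx t).trans (Ideal.pow_le_self (by omega))

/-- Colon ideals of powers of a system of parameters: `(I_{t + N} : (x₁ ⋯ x_d) ^ N) = I_t`. -/
lemma IsHomogeneousSOP.mem_powIdeal_of_mul_prod_mem (hx : IsHomogeneousSOP 𝒜 x e)
    (hstd : IsStandardGraded 𝒜) (hGor : IsGorenstein R) {t N : ℕ} {b : R}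
    (h : b * (∏ i, x i) ^ N ∈ powIdeal x (t + N)) : b ∈ powIdeal x t := by
  classical
  rcases Nat.eq_zero_or_pos N with rfl | hN
  · simpa using h
  rcases Nat.eq_zero_or_pos t with rfl | ht
  · rcases Nat.eq_zero_or_pos d with rfl | hd
    · have hb : powIdeal x (0 + N) = powIdeal x 0 := by
        simp [powIdeal, Set.range_eq_empty]
      rw [hb] at h
      simpa using h
    · have h1 := pow_mem_powIdeal x 0 ⟨0, hd⟩
      rw [pow_zero] at h1
      rw [(Ideal.eq_top_iff_one _).2 h1]; trivial
  -- the factors `x i ^ N` are cancelled one after the other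
  have key : ∀ (S : Finset (Fin d)) (b : R),
      b * ∏ i ∈ S, x i ^ N ∈ Ideal.span (Set.range fun i => x i ^ (t + if i ∈ S then N else 0)) →
      b ∈ powIdeal x t := by
    intro S
    induction S using Finset.induction_on with
    | empty => intro b hb; simpa [powIdeal] using hb
    | insert i S hi ih =>
      intro b hb
      refine ih b ?_
      rw [Ideal.mem_span_range_iff_exists_fun] at hb
      obtain ⟨c, hc⟩ := hb
      let X : Fin d → R := fun j => x j ^ if j = i then N else t + if j ∈ S then N else 0
      have hreg := (hx.pow (n := fun j => if j = i then N else t + if j ∈ S then N else 0)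
        (fun j => by split_ifs <;> omega)).regularFamily_and_socleLEOneAt hstd hGor |>.1
      have hXi : X i = x i ^ N := by simp [X]
      have hXj : ∀ j, j ≠ i → X j = x j ^ (t + if j ∈ insert i S then N else 0) := by
        intro j hj; simp [X, hj]
      have h1 : b * ∏ j ∈ S, x j ^ N - c i * x i ^ t ∈
          Ideal.span (X '' (Finset.univ.erase i : Finset (Fin d))) := by
        refine hreg _ i (Finset.notMem_erase i _) _ ?_
        change X i * _ ∈ _
        rw [hXi]
        have e1 : x i ^ N * (b * ∏ j ∈ S, x j ^ N - c i * x i ^ t) =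
            ∑ j ∈ Finset.univ.erase i, c j * X j := by
          rw [Finset.prod_insert hi, ← Finset.add_sum_erase _ _ (Finset.mem_univ i),
            if_pos (Finset.mem_insert_self i S)] at hc
          rw [Finset.sum_congr rfl fun j hj => by rw [hXj j (Finset.ne_of_mem_erase hj)]]
          have e2 : x i ^ N * (b * ∏ j ∈ S, x j ^ N - c i * x i ^ t) =
            b * (x i ^ N * ∏ j ∈ S, x j ^ N) - c i * x i ^ (t + N) := by ring
          rw [e2, ← hc]
          ring
        rw [e1]
        exact Ideal.sum_mem _ fun j hj => Ideal.mul_mem_left _ _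
          (Ideal.subset_span ⟨j, hj, rfl⟩)
      have h2 : Ideal.span (X '' (Finset.univ.erase i : Finset (Fin d))) ≤
          Ideal.span (Set.range fun i => x i ^ (t + if i ∈ S then N else 0)) := by
        rw [Ideal.span_le]
        rintro _ ⟨j, hj, rfl⟩
        have hj' : j ≠ i := Finset.ne_of_mem_erase (Finset.mem_coe.1 hj)
        rw [hXj j hj']
        exact Ideal.subset_span ⟨j, by simp [hj']⟩
      have h3 : c i * x i ^ t ∈
          Ideal.span (Set.range fun i => x i ^ (t + if i ∈ S then N else 0)) :=
        Ideal.mul_mem_left _ _ (Ideal.subset_span ⟨i, by simp [hi]⟩)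
      have := Ideal.add_mem _ (h2 h1) h3
      rwa [sub_add_cancel] at this
  refine key Finset.univ b ?_
  rw [Finset.prod_pow]
  simpa [powIdeal] using h

lemma prod_pow_mul_mem_powIdeal {R : Type*} [CommRing R] {d : ℕ} {x : Fin d → R} {t : ℕ} (N : ℕ)
    {b : R} (h : b ∈ powIdeal x t) : (∏ i, x i) ^ N * b ∈ powIdeal x (t + N) := by
  classical
  obtain ⟨c, rfl⟩ := mem_powIdeal_iff.1 h
  rw [Finset.mul_sum]
  refine Ideal.sum_mem _ fun i _ => ?_
  have : (∏ i, x i) ^ N * (c i * x i ^ t) =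
      ((∏ j ∈ Finset.univ.erase i, x j) ^ N * c i) * x i ^ (t + N) := by
    rw [← Finset.mul_prod_erase _ _ (Finset.mem_univ i)]; ring
  rw [this]
  exact Ideal.mul_mem_left _ _ (pow_mem_powIdeal x _ i)

/-- The class of `b / (x₁ ⋯ x_d) ^ t` in the top local cohomology vanishes if and only if
`b ∈ I_t`. -/
lemma IsHomogeneousSOP.mem_cechBoundary_iff (hx : IsHomogeneousSOP 𝒜 x e)
    (hstd : IsStandardGraded 𝒜) (hGor : IsGorenstein R) {t : ℕ} {b : R}
    {z : Localization.Away (∏ i, x i)}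
    (hz : algebraMap R _ ((∏ i, x i) ^ t) * z = algebraMap R _ b) :
    z ∈ cechBoundary x ↔ b ∈ powIdeal x t := by
  classical
  let f := algebraMap R (Localization.Away (∏ i, x i))
  have hfz : f ((∏ i, x i) ^ t) * z = f b := hz
  have hunit : ∀ n, IsUnit (f ((∏ i, x i) ^ n)) := fun n => by
    rw [map_pow]
    exact (IsLocalization.Away.algebraMap_isUnit (∏ i, x i)).pow n
  have herase : ∀ i n, f ((∏ i, x i) ^ n) =
      f (x i) ^ n * f ((∏ j ∈ Finset.univ.erase i, x j) ^ n) := fun i n => by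
    rw [← map_pow, ← map_mul, ← mul_pow, Finset.mul_prod_erase _ _ (Finset.mem_univ i)]
  constructor
  · intro hmem
    have key : ∃ N, ∃ c ∈ powIdeal x N, f ((∏ i, x i) ^ N) * z = f c := by
      clear hz hfz
      induction hmem using Submodule.span_induction with
      | mem z hz =>
        obtain ⟨i, n, c, hc⟩ := hz
        refine ⟨n, c * x i ^ n, Ideal.mul_mem_left _ _ (pow_mem_powIdeal x n i), ?_⟩
        change f _ * z = f c at hc
        rw [herase i, mul_assoc, hc, map_mul, map_pow, mul_comm]
      | zero => exact ⟨0, 0, Ideal.zero_mem _, by simp⟩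
      | add z w _ _ ihz ihw =>
        obtain ⟨N, c, hc, hcz⟩ := ihz
        obtain ⟨N', c', hc', hcw⟩ := ihw
        refine ⟨N + N', (∏ i, x i) ^ N' * c + (∏ i, x i) ^ N * c', Ideal.add_mem _
          (prod_pow_mul_mem_powIdeal N' hc) ?_, ?_⟩
        · rw [add_comm]; exact prod_pow_mul_mem_powIdeal N hc'
        · rw [map_add, map_mul, map_mul, ← hcz, ← hcw, pow_add, map_mul]; ring
      | smul r z _ ih =>
        obtain ⟨N, c, hc, hcz⟩ := ih
        refine ⟨N, r * c, Ideal.mul_mem_left _ _ hc, ?_⟩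
        rw [Algebra.smul_def, map_mul, ← hcz]
        change _ * (f r * z) = _
        ring
    obtain ⟨N, c, hc, hcz⟩ := key
    have h1 : f ((∏ i, x i) ^ t * c) = f ((∏ i, x i) ^ N * b) := by
      rw [map_mul, map_mul, ← hcz, ← hfz]
      ring
    obtain ⟨⟨_, M, rfl⟩, hM⟩ := (IsLocalization.eq_iff_exists (Submonoid.powers (∏ i, x i))
      (Localization.Away (∏ i, x i))).1 h1
    refine hx.mem_powIdeal_of_mul_prod_mem hstd hGor (N := N + M) ?_
    have h2 := prod_pow_mul_mem_powIdeal (t + M) hc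
    have e1 : b * (∏ i, x i) ^ (N + M) = (∏ i, x i) ^ (t + M) * c := by
      have hM' : (∏ i, x i) ^ M * ((∏ i, x i) ^ t * c) =
        (∏ i, x i) ^ M * ((∏ i, x i) ^ N * b) := hM
      calc b * (∏ i, x i) ^ (N + M) = (∏ i, x i) ^ M * ((∏ i, x i) ^ N * b) := by ring
        _ = (∏ i, x i) ^ (t + M) * c := by rw [← hM']; ring
    rw [e1, show t + (N + M) = N + (t + M) by ring]
    exact h2
  · intro hb
    obtain ⟨h, rfl⟩ := mem_powIdeal_iff.1 hb
    have hxi : ∀ i, IsUnit (f (x i)) := fun i => by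
      have := hunit 1
      rw [herase i, pow_one] at this
      exact isUnit_of_mul_isUnit_left this
    choose w hw using fun i : Fin d => (hunit t).exists_right_inv
    have hz' : z = ∑ i, w i * f (h i * x i ^ t) := by
      refine (hunit t).mul_left_cancel ?_
      rw [hfz, Finset.mul_sum, map_sum]
      exact Finset.sum_congr rfl fun i _ => by rw [← mul_assoc, hw, one_mul]
    rw [hz']
    refine Submodule.sum_mem _ fun i _ => Submodule.subset_span ⟨i, t, h i, ?_⟩
    refine ((hxi i).pow t).mul_left_cancel ?_
    change f (x i) ^ t * (f _ * _) = f (x i) ^ t * f (h i)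
    rw [← mul_assoc, ← herase, ← mul_assoc, hw, one_mul, map_mul, map_pow, mul_comm]

/-- The quotient by `I_t` has its socle in degree `a + t ∑ deg x_i`. -/
theorem IsHomogeneousSOP.exists_hasSocleDegree_powIdeal (hx : IsHomogeneousSOP 𝒜 x e)
    (hstd : IsStandardGraded 𝒜) (hGor : IsGorenstein R) {t : ℕ} (ht : 1 ≤ t) :
    ∃ s : ℕ, (s : ℤ) = aInvariant 𝒜 x e + t * ∑ i, (e i : ℤ) ∧
      HasSocleDegree 𝒜 (powIdeal x t) s := by
  have := hGor.1
  have hsoc : ∀ t, 1 ≤ t → ∃ s, HasSocleDegree 𝒜 (powIdeal x t) s := by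
    intro t ht
    have hxt := hx.pow (n := fun _ => t) fun _ => ht
    obtain ⟨N, hN⟩ := hxt.exists_irrIdeal_pow_le
    exact exists_hasSocleDegree hstd (powIdeal_isHomogeneous hx t) (powIdeal_ne_top hx hstd ht) hN
      (hxt.regularFamily_and_socleLEOneAt hstd hGor).2
  have hprod : ∏ i, x i ∈ 𝒜 (∑ i, e i) := SetLike.prod_mem_graded 𝒜 e x fun i _ => hx.2.1 i
  have hstep : ∀ t s s', 1 ≤ t → HasSocleDegree 𝒜 (powIdeal x t) s →
      HasSocleDegree 𝒜 (powIdeal x (t + 1)) s' → s' = s + ∑ i, e i := by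
    intro t s s' ht hs hs'
    obtain ⟨w, hw, hwI⟩ := hs.exists_notMem (powIdeal_ne_top hx hstd ht)
    have h1 : w * ∏ i, x i ∉ powIdeal x (t + 1) := fun h =>
      hwI (hx.mem_powIdeal_of_mul_prod_mem hstd hGor (N := 1) (by rwa [pow_one]))
    obtain ⟨i, v, hv, hi, hvI⟩ := hs'.exists_mul_notMem (SetLike.GradedMul.mul_mem hw hprod) h1
    rcases Nat.eq_zero_or_pos i with rfl | hi0
    · omega
    · refine absurd ?_ hvI
      have h2 : w * v ∈ powIdeal x t :=
        hs.mem_of_lt (j := s + i) (by omega) (SetLike.GradedMul.mul_mem hw hv)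
      have h3 := prod_pow_mul_mem_powIdeal 1 h2
      rwa [pow_one, ← mul_assoc, mul_comm _ w] at h3
  obtain ⟨s₁, hs₁⟩ := hsoc 1 le_rfl
  have hall : ∀ t, 1 ≤ t → ∀ s, HasSocleDegree 𝒜 (powIdeal x t) s →
      (s : ℤ) = (s₁ - ∑ i, (e i : ℤ)) + t * ∑ i, (e i : ℤ) := by
    intro t ht
    induction t, ht using Nat.le_induction with
    | base =>
      intro s hs
      have h2 := hsoc 2 (by omega)
      obtain ⟨s₂, hs₂⟩ := h2
      have := hstep 1 s s₂ le_rfl hs hs₂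
      have := hstep 1 s₁ s₂ le_rfl hs₁ hs₂
      have h3 : s = s₁ := by omega
      rw [h3]; push_cast; ring
    | succ t ht ih =>
      intro s hs
      obtain ⟨s', hs'⟩ := hsoc t ht
      rw [hstep t s' s ht hs' hs]
      push_cast
      rw [ih s' hs']
      ring
  have ha : aInvariant 𝒜 x e = s₁ - ∑ i, (e i : ℤ) := by
    refine IsGreatest.csSup_eq ⟨?_, ?_⟩
    · obtain ⟨w, hw, hwI⟩ := hs₁.exists_notMem (powIdeal_ne_top hx hstd le_rfl)
      obtain ⟨v, hv⟩ := (IsLocalization.Away.algebraMap_isUnit (S := Localization.Away (∏ i, x i))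
        (∏ i, x i)).exists_right_inv
      have hz : algebraMap R _ ((∏ i, x i) ^ 1) * (v * algebraMap R _ w) = algebraMap R _ w := by
        rw [pow_one, ← mul_assoc, hv, one_mul]
      refine ⟨v * algebraMap R _ w, ⟨1, s₁, by push_cast; ring, w, hw, hz⟩, ?_⟩
      rwa [hx.mem_cechBoundary_iff hstd hGor hz]
    · rintro n ⟨z, ⟨t, m, hm, b, hb, hz⟩, hzB⟩
      by_contra! hn
      refine hzB ?_
      obtain ⟨s, hs⟩ := hsoc (t + 1) (by omega)
      have h1 := hall (t + 1) (by omega) s hs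
      have hz' : algebraMap R _ ((∏ i, x i) ^ (t + 1)) * z =
          algebraMap R _ ((∏ i, x i) * b) := by
        rw [pow_succ', map_mul, mul_assoc, hz, map_mul]
      rw [hx.mem_cechBoundary_iff hstd hGor hz']
      refine hs.mem_of_lt (j := ∑ i, e i + m) ?_ (SetLike.GradedMul.mul_mem hprod hb)
      have : (s : ℤ) < ((∑ i, e i + m : ℕ) : ℤ) := by
        rw [h1]; push_cast; linarith
      exact_mod_cast this
  obtain ⟨s, hs⟩ := hsoc t ht
  exact ⟨s, by rw [ha]; exact hall t ht s hs, hs⟩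

end AInvariant

/-! ### Frobenius powers and closures -/

section Closures

variable {R : Type*} [CommRing R]

lemma pow_mul_mem_bracketPower {I J : Ideal R} {v : R} (hv : ∀ b ∈ I, v * b ∈ J) {q : ℕ} {b : R}
    (hb : b ∈ bracketPower I q) : v ^ q * b ∈ bracketPower J q := by
  have h : bracketPower I q ≤
      Submodule.colon (bracketPower J q) {v ^ q} := by
    rw [bracketPower, Ideal.span_le]
    rintro _ ⟨i, hi, rfl⟩
    rw [SetLike.mem_coe, Submodule.mem_colon_singleton, smul_eq_mul, mul_comm, ← mul_pow]
    exact Ideal.subset_span ⟨_, hv i hi, rfl⟩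
  rw [mul_comm]
  exact Submodule.mem_colon_singleton.1 (h hb)

lemma mem_circ_of_forall_mul_eq_zero {b : R} (hb : ∀ c, b * c = 0 → c = 0) : b ∈ circ R := by
  intro P hP hbP
  have h1 := Ideal.disjoint_nonZeroDivisors_of_mem_minimalPrimes hP
  refine Set.disjoint_left.1 h1 hbP ?_
  rw [SetLike.mem_coe, mem_nonZeroDivisors_iff]
  refine ⟨fun c hc => hb c hc, fun c hc => hb c (by rwa [mul_comm])⟩

variable (p : ℕ)

/-- The elements `z` for which some `c ∈ R°` satisfies `c z ^ q 𝔞 ^ l(n) ⊆ I^{[q]}` for all large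
powers `q = p ^ n`. The tight closure is the case `l = 0`; the closure with exponent `r` is
contained in the case `l n = ⌈r q⌉`. -/
def exponentClosure (𝔞 : Ideal R) (l : ℕ → ℕ) (I : Ideal R) : Set R :=
  {z | ∃ c ∈ circ R, ∀ᶠ n : ℕ in Filter.atTop, ∀ y ∈ 𝔞 ^ l n,
    c * z ^ p ^ n * y ∈ bracketPower I (p ^ n)}

section

variable {p} {𝔞 I J : Ideal R} {l : ℕ → ℕ} {z : R}

lemma exponentClosure_zero_subset :
    exponentClosure p 𝔞 (fun _ => 0) I ⊆ exponentClosure p 𝔞 l I := by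
  rintro z ⟨c, hc, h⟩
  refine ⟨c, hc, h.mono fun n hn y _ => Ideal.mul_mem_right _ _ ?_⟩
  simpa using hn 1 (by simp)

lemma mul_mem_exponentClosure {v : R} (hv : ∀ b ∈ I, v * b ∈ J)
    (hz : z ∈ exponentClosure p 𝔞 l I) : v * z ∈ exponentClosure p 𝔞 l J := by
  obtain ⟨c, hc, h⟩ := hz
  refine ⟨c, hc, h.mono fun n hn y hy => ?_⟩
  have := pow_mul_mem_bracketPower hv (hn y hy)
  rwa [show c * (v * z) ^ p ^ n * y = v ^ p ^ n * (c * z ^ p ^ n * y) by rw [mul_pow]; ring]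

lemma exponentClosure_mono (h : I ≤ J) : exponentClosure p 𝔞 l I ⊆ exponentClosure p 𝔞 l J := by
  intro z hz
  simpa using mul_mem_exponentClosure (v := 1) (fun b hb => by simpa using h hb) hz

end

variable [Fact p.Prime] [CharP R p]

lemma bracketPower_eq_map (I : Ideal R) (n : ℕ) :
    bracketPower I (p ^ n) = I.map (iterateFrobenius R p n) := rfl

lemma bracketPower_span_range {ι : Type*} (g : ι → R) (n : ℕ) :
    bracketPower (Ideal.span (Set.range g)) (p ^ n) =
      Ideal.span (Set.range fun i => g i ^ p ^ n) := by
  rw [bracketPower_eq_map, Ideal.map_span, ← Set.range_comp]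
  rfl

lemma bracketPower_powIdeal {d : ℕ} (x : Fin d → R) (t n : ℕ) :
    bracketPower (powIdeal x t) (p ^ n) = powIdeal x (t * p ^ n) := by
  rw [powIdeal, bracketPower_span_range, powIdeal]
  simp only [pow_mul]

variable {p} {𝔞 I : Ideal R} {z : R}

lemma mem_tightClosure_iff :
    z ∈ tightClosure p I ↔ z ∈ exponentClosure p 𝔞 (fun _ => 0) I := by
  refine exists_congr fun c => and_congr_right fun _ => Filter.eventually_congr
    (Filter.Eventually.of_forall fun n => ⟨fun h y _ => Ideal.mul_mem_right _ _ h, fun h => ?_⟩)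
  simpa using h 1 (by simp)

lemma aTightClosure_subset_exponentClosure {r : ℝ} :
    (aTightClosure p 𝔞 r I : Set R) ⊆
      exponentClosure p 𝔞 (fun n => ⌈r * (p : ℝ) ^ n⌉₊) I :=
  fun _ ⟨c, hc, h⟩ => ⟨c, hc, Filter.Eventually.of_forall h⟩

lemma le_tightClosure : I ≤ tightClosure p I := fun z hz =>
  ⟨1, (circ R).one_mem, Filter.Eventually.of_forall fun n => by
    rw [one_mul]; exact Ideal.subset_span ⟨z, hz, rfl⟩⟩

end Closures

/-! ### Leading forms of Frobenius powers -/

section Leading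

variable {k R : Type*} [Field k] [CommRing R] [Algebra k R] {𝒜 : ℕ → Submodule k R}
  [GradedAlgebra 𝒜]

lemma proj_mem_of_isHomogeneous {I : Ideal R} (hI : I.IsHomogeneous 𝒜) (i : ℕ) {z : R}
    (hz : z ∈ I) : GradedRing.proj 𝒜 i z ∈ I := hI i hz

lemma pow_mem_graded {i : ℕ} (n : ℕ) {z : R} (hz : z ∈ 𝒜 i) : z ^ n ∈ 𝒜 (i * n) := by
  have := SetLike.pow_mem_graded (A := 𝒜) n hz
  rwa [smul_eq_mul, mul_comm] at this

/-- If `c` has degree less than `q = p ^ n`, the components of `c w ^ q` are the products of the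
components of `c` with the `q`-th powers of the components of `w`. -/
lemma proj_mul_pow_char_pow (p : ℕ) [Fact p.Prime] [CharP R p] {n D : ℕ} (hD : D < p ^ n) {c : R}
    (hc : c ∈ degLE 𝒜 D) (w : R) {i : ℕ} (hi : i ≤ D) (j : ℕ) :
    GradedRing.proj 𝒜 (i + j * p ^ n) (c * w ^ p ^ n) =
      GradedRing.proj 𝒜 i c * GradedRing.proj 𝒜 j w ^ p ^ n := by
  obtain ⟨N, hN⟩ := exists_mem_degLE 𝒜 w
  have hw := sum_proj_of_mem_degLE hN
  have hpow : ∀ m, GradedRing.proj 𝒜 m w ^ p ^ n ∈ 𝒜 (m * p ^ n) := fun m =>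
    pow_mem_graded _ (proj_mem 𝒜 m w)
  conv_lhs => rw [← hw, sum_pow_char_pow, Finset.mul_sum, map_sum]
  have hne : ∀ m, m ≠ j →
      GradedRing.proj 𝒜 (i + j * p ^ n) (c * GradedRing.proj 𝒜 m w ^ p ^ n) = 0 := by
    intro m hm
    rcases lt_or_gt_of_ne hm with h | h
    · have h1 : (m + 1) * p ^ n ≤ j * p ^ n := Nat.mul_le_mul_right _ h
      have h2 : i + j * p ^ n = (i + j * p ^ n - m * p ^ n) + m * p ^ n := by
        rw [add_mul] at h1; omega
      rw [h2, proj_mul_of_right_mem _ _ (hpow m)]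
      have h3 : GradedRing.proj 𝒜 (i + j * p ^ n - m * p ^ n) c = 0 := by
        refine hc _ ?_
        rw [add_mul] at h1
        have : D < i + j * p ^ n - m * p ^ n := by omega
        exact_mod_cast this
      rw [h3, zero_mul]
    · rw [mul_comm c]
      refine proj_mul_of_left_mem_of_lt _ (hpow m) ?_
      have h1 : (j + 1) * p ^ n ≤ m * p ^ n := Nat.mul_le_mul_right _ h
      rw [add_mul] at h1; omega
  rw [Finset.sum_eq_single j (fun m _ hm => hne m hm), proj_mul_of_right_mem _ _ (hpow j)]
  intro hj
  have : GradedRing.proj 𝒜 j w = 0 := by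
    refine hN j ?_
    have : N < j := by simpa using hj
    exact_mod_cast this
  rw [this, zero_pow (pow_ne_zero _ (Fact.out : p.Prime).ne_zero), mul_zero, map_zero]

/-- A congruence `c w ^ q y ≡ u` modulo a homogeneous ideal, in which `u` has low degree, gives
`c w_j ^ q y ≡ 0` for every component `w_j` of `w` of high degree. -/
lemma mul_proj_pow_mul_mem (p : ℕ) [Fact p.Prime] [CharP R p] {n D : ℕ} (hD : D < p ^ n) {c : R}
    (hc : c ∈ degLE 𝒜 D) {w y u : R} {l : ℕ} (hy : y ∈ 𝒜 l) {I : Ideal R}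
    (hI : I.IsHomogeneous 𝒜) {B : ℤ} (hu : u ∈ degLE 𝒜 B) (h : c * w ^ p ^ n * y - u ∈ I) {j : ℕ}
    (hj : B < j * (p : ℤ) ^ n + l) : c * GradedRing.proj 𝒜 j w ^ p ^ n * y ∈ I := by
  rw [← sum_proj_of_mem_degLE hc, Finset.sum_mul, Finset.sum_mul]
  refine Ideal.sum_mem _ fun i hi => ?_
  have h1 := proj_mem_of_isHomogeneous hI (i + j * p ^ n + l) h
  have h2 : GradedRing.proj 𝒜 (i + j * p ^ n + l) u = 0 := by
    refine hu _ (hj.trans_le ?_)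
    push_cast
    linarith [Int.natCast_nonneg i]
  rw [map_sub, h2, sub_zero, proj_mul_of_right_mem _ _ hy,
    proj_mul_pow_char_pow p hD hc w (by simpa [Nat.lt_succ_iff] using hi)] at h1
  exact h1

end Leading

/-! ### Top forms -/

section TopForms

variable {k R : Type*} [Field k] [CommRing R] [Algebra k R] {𝒜 : ℕ → Submodule k R}
  [GradedAlgebra 𝒜] {d : ℕ} {X Y : Fin d → R} {ε : Fin d → ℕ}

/-- If the top forms `X i` of the `Y i` form a regular sequence in every order, then elements of the
ideal generated by the `Y i` are combinations of the `Y i` without cancellation of top degrees. -/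
theorem RegularFamily.exists_sum_of_mem_span (hreg : RegularFamily X) (hX : ∀ i, X i ∈ 𝒜 (ε i))
    (hY : ∀ i, Y i - X i ∈ degLE 𝒜 (ε i - 1)) (S : Finset (Fin d)) {z : R} {D : ℤ}
    (hz : z ∈ Ideal.span (Y '' S)) (hD : z ∈ degLE 𝒜 D) :
    ∃ h : Fin d → R, (∀ i, h i ∈ degLE 𝒜 (D - ε i)) ∧ z = ∑ i ∈ S, h i * Y i := by
  classical
  have hXle : ∀ i, X i ∈ degLE 𝒜 (ε i) := fun i => mem_degLE_of_mem le_rfl (hX i)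
  have hYle : ∀ i, Y i ∈ degLE 𝒜 (ε i) := fun i => by
    have := Submodule.add_mem _ (degLE_mono (by omega) (hY i)) (hXle i)
    rwa [sub_add_cancel] at this
  have hYproj : ∀ i, GradedRing.proj 𝒜 (ε i) (Y i) = X i := fun i => by
    have h1 := hY i (ε i) (by omega)
    rwa [map_sub, proj_of_mem (hX i), sub_eq_zero] at h1
  have htop : ∀ (E : ℕ) (i : Fin d) (h : R), h ∈ degLE 𝒜 ((E : ℤ) - ε i) →
      (E < ε i ∧ h = 0) ∨ ∃ m, m + ε i = E ∧ h ∈ degLE 𝒜 (m : ℤ) ∧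
        GradedRing.proj 𝒜 E (h * Y i) = GradedRing.proj 𝒜 m h * X i := by
    intro E i h hh
    rcases lt_or_ge E (ε i) with hE | hE
    · exact .inl ⟨hE, eq_zero_of_mem_degLE (by omega) hh⟩
    · obtain ⟨m, rfl⟩ := Nat.exists_eq_add_of_le hE
      have hh' : h ∈ degLE 𝒜 (m : ℤ) := degLE_mono (by push_cast; omega) hh
      refine .inr ⟨m, add_comm _ _, hh', ?_⟩
      rw [add_comm, proj_add_mul_of_mem_degLE hh' (hYle i), hYproj]
  induction S using Finset.induction_on generalizing z D with
  | empty =>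
    refine ⟨0, fun i => Submodule.zero_mem _, ?_⟩
    simpa using hz
  | insert i S hi ih =>
    -- the coefficient of `Y i` can be lowered one degree at a time
    have key : ∀ (n : ℕ) (h : R), h ∈ degLE 𝒜 (D + n - ε i) →
        z - h * Y i ∈ Ideal.span (Y '' S) →
        ∃ h ∈ degLE 𝒜 (D - ε i), z - h * Y i ∈ Ideal.span (Y '' S) := by
      intro n
      induction n with
      | zero => exact fun h hh hzh => ⟨h, by simpa using hh, hzh⟩
      | succ n ihn =>
        intro h hh hzh
        rcases lt_or_ge (D + (n + 1 : ℕ)) 0 with hneg | hpos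
        · refine ⟨0, Submodule.zero_mem _, ?_⟩
          rwa [eq_zero_of_mem_degLE (by omega) hh] at hzh
        obtain ⟨E, hE⟩ := Int.eq_ofNat_of_zero_le hpos
        rw [hE] at hh
        rcases htop E i h hh with ⟨_, rfl⟩ | ⟨m, hm, hhm, hproj⟩
        · exact ⟨0, Submodule.zero_mem _, hzh⟩
        have hz' : z - h * Y i ∈ degLE 𝒜 (E : ℤ) := by
          refine Submodule.sub_mem _ (degLE_mono (by omega) hD) ?_
          exact degLE_mono (by omega) (mul_mem_degLE hh (hYle i))
        obtain ⟨a, ha, hasum⟩ := ih hzh hz'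
        have hzE : GradedRing.proj 𝒜 E z = 0 := hD E (by omega)
        have hg : GradedRing.proj 𝒜 m h ∈ Ideal.span (X '' S) := by
          refine hreg S i hi _ ?_
          have h1 : X i * GradedRing.proj 𝒜 m h = -∑ j ∈ S, GradedRing.proj 𝒜 E (a j * Y j) := by
            rw [← map_sum, ← hasum, map_sub, hzE, hproj]; ring
          rw [h1]
          refine Submodule.neg_mem _ (Ideal.sum_mem _ fun j hj => ?_)
          rcases htop E j (a j) (ha j) with ⟨_, h0⟩ | ⟨m', _, _, h2⟩
          · rw [h0, zero_mul, map_zero]; exact Ideal.zero_mem _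
          · rw [h2]
            exact Ideal.mul_mem_left _ _ (Ideal.subset_span ⟨j, hj, rfl⟩)
        obtain ⟨b, hb, hbsum⟩ := exists_sum_of_mem_span_homogeneous (D := (m : ℤ)) hX hg
          (mem_degLE_of_mem le_rfl (proj_mem 𝒜 m h))
        refine ihn (h - ∑ j ∈ S, b j * Y j) ?_ ?_
        · have h1 : h - ∑ j ∈ S, b j * Y j =
              (h - GradedRing.proj 𝒜 m h) - ∑ j ∈ S, b j * (Y j - X j) := by
            simp only [mul_sub, Finset.sum_sub_distrib]
            rw [← hbsum]; ring
          rw [h1]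
          refine Submodule.sub_mem _ (degLE_mono (by omega) (sub_proj_mem_degLE hhm)) ?_
          refine Submodule.sum_mem _ fun j _ => ?_
          exact degLE_mono (by omega) (mul_mem_degLE (hb j) (hY j))
        · have h1 : z - (h - ∑ j ∈ S, b j * Y j) * Y i =
              (z - h * Y i) + ∑ j ∈ S, b j * Y i * Y j := by
            rw [sub_mul, Finset.sum_mul]
            rw [Finset.sum_congr rfl fun j _ => mul_right_comm (b j) (Y j) (Y i)]
            ring
          rw [h1]
          exact Ideal.add_mem _ hzh (Ideal.sum_mem _ fun j hj =>
            Ideal.mul_mem_left _ _ (Ideal.subset_span ⟨j, hj, rfl⟩))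
    have hz0 : ∃ h, z - h * Y i ∈ Ideal.span (Y '' S) := by
      rw [Finset.coe_insert, Set.image_insert_eq, Ideal.span_insert, sup_comm,
        mem_sup_span_singleton_iff] at hz
      obtain ⟨c, hc⟩ := hz
      exact ⟨c, by rwa [mul_comm]⟩
    obtain ⟨h, hh⟩ := hz0
    obtain ⟨N, hN⟩ := exists_mem_degLE 𝒜 h
    obtain ⟨h, hdeg, hmem⟩ := key (N + ε i + D.natAbs) h
      (degLE_mono (by push_cast [Int.natCast_natAbs]; have := neg_abs_le D; omega) hN) hh
    obtain ⟨a, ha, hasum⟩ := ih hmem (D := D) (Submodule.sub_mem _ hD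
      (degLE_mono (by omega) (mul_mem_degLE hdeg (hYle i))))
    refine ⟨Function.update a i h, fun j => ?_, ?_⟩
    · rcases eq_or_ne j i with rfl | hj
      · rwa [Function.update_self]
      · rw [Function.update_of_ne hj]; exact ha j
    · rw [Finset.sum_insert hi, Function.update_self]
      have h1 : ∑ j ∈ S, Function.update a i h j * Y j = ∑ j ∈ S, a j * Y j := by
        refine Finset.sum_congr rfl fun j hj => ?_
        rw [Function.update_of_ne (ne_of_mem_of_not_mem hj hi)]
      rw [h1, ← hasum]
      ring

end TopForms

/-! ### The closure of `I_t` with exponent `r` -/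

section PowIdealClosure

variable {k R : Type*} [Field k] [CommRing R] [Algebra k R] {𝒜 : ℕ → Submodule k R}
  [GradedAlgebra 𝒜] {d : ℕ} {x : Fin d → R} {e : Fin d → ℕ}

lemma IsStandardGraded.mul_mem_of_mem_irrelevant_pow (hstd : IsStandardGraded 𝒜) {I : Ideal R}
    {b : R} {n : ℕ} (h : ∀ y ∈ 𝒜 n, b * y ∈ I) {y : R} (hy : y ∈ irrIdeal 𝒜 ^ n) : b * y ∈ I := by
  have h1 : irrIdeal 𝒜 ^ n ≤ Submodule.colon I {b} := hstd.irrelevant_pow_le fun y hy => by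
    rw [Submodule.mem_colon_singleton, smul_eq_mul, mul_comm]
    exact h y hy
  have := Submodule.mem_colon_singleton.1 (h1 hy)
  rwa [smul_eq_mul, mul_comm] at this

lemma IsHomogeneousSOP.eq_zero_of_pow_mul_eq_zero (hx : IsHomogeneousSOP 𝒜 x e)
    (hstd : IsStandardGraded 𝒜) (hGor : IsGorenstein R) (i : Fin d) (N : ℕ) {b : R}
    (h : x i ^ N * b = 0) : b = 0 := by
  induction N with
  | zero => simpa using h
  | succ N ih =>
    refine ih ?_
    have h1 := (hx.regularFamily_and_socleLEOneAt hstd hGor).1 ∅ i (by simp) (x i ^ N * b)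
    simp only [Finset.coe_empty, Set.image_empty, Ideal.span_empty, Ideal.mem_bot] at h1
    exact h1 (by rw [← h]; ring)

lemma IsHomogeneousSOP.pow_mem_circ (hx : IsHomogeneousSOP 𝒜 x e)
    (hstd : IsStandardGraded 𝒜) (hGor : IsGorenstein R) (i : Fin d) (N : ℕ) :
    x i ^ N ∈ circ R :=
  mem_circ_of_forall_mul_eq_zero fun _ hc => hx.eq_zero_of_pow_mul_eq_zero hstd hGor i N hc

lemma IsHomogeneousSOP.one_le_degree (hx : IsHomogeneousSOP 𝒜 x e)
    (hstd : IsStandardGraded 𝒜) (hGor : IsGorenstein R) (i : Fin d) : 1 ≤ e i := by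
  by_contra h
  have h0 : e i = 0 := by omega
  have := hx.nontrivial
  have h1 := mem_irrelevant_iff_proj.1 (hx.mem_irrIdeal i)
  have h2 := hx.2.1 i
  rw [h0] at h2
  rw [proj_of_mem h2] at h1
  exact one_ne_zero (hx.eq_zero_of_pow_mul_eq_zero hstd hGor i 1 (b := 1) (by rw [h1]; simp))

lemma colon_irrelevantPow_isHomogeneous (hstd : IsStandardGraded 𝒜) {I : Ideal R}
    (hI : I.IsHomogeneous 𝒜) (n : ℤ) {z : R}
    (hz : z ∈ Submodule.colon I (irrelevantPow 𝒜 n : Set R)) (j : ℕ) :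
    GradedRing.proj 𝒜 j z ∈ Submodule.colon I (irrelevantPow 𝒜 n : Set R) := by
  refine Submodule.mem_colon.2 fun y hy => hstd.mul_mem_of_mem_irrelevant_pow (fun y hy => ?_) hy
  have h1 := Submodule.mem_colon.1 hz y (hstd.mem_irrelevant_pow hy le_rfl)
  have h2 := proj_mem_of_isHomogeneous hI (j + n.toNat) h1
  rwa [smul_eq_mul, proj_mul_of_right_mem _ _ hy] at h2

section

variable (p : ℕ) [Fact p.Prime] [CharP R p]

/-- For the ideals `I_t`, finitely many exponents do not matter. -/
lemma IsHomogeneousSOP.mem_aTightClosure_of_mem_exponentClosure (hx : IsHomogeneousSOP 𝒜 x e)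
    (hstd : IsStandardGraded 𝒜) (hGor : IsGorenstein R) (hd : 0 < d) {r : ℝ} {t : ℕ} {z : R}
    (hz : z ∈ exponentClosure p (irrIdeal 𝒜) (fun n => ⌈r * (p : ℝ) ^ n⌉₊) (powIdeal x t)) :
    z ∈ aTightClosure p (irrIdeal 𝒜) r (powIdeal x t) := by
  obtain ⟨c, hc, h⟩ := hz
  obtain ⟨n₀, hn₀⟩ := Filter.eventually_atTop.1 h
  refine ⟨c * x ⟨0, hd⟩ ^ (t * p ^ n₀), (circ R).mul_mem hc (hx.pow_mem_circ hstd hGor _ _),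
    fun n y hy => ?_⟩
  rcases le_total n₀ n with hn | hn
  · rw [show c * x ⟨0, hd⟩ ^ (t * p ^ n₀) * z ^ p ^ n * y =
      x ⟨0, hd⟩ ^ (t * p ^ n₀) * (c * z ^ p ^ n * y) by ring]
    exact Ideal.mul_mem_left _ _ (hn₀ n hn y hy)
  · rw [bracketPower_powIdeal]
    have h1 : t * p ^ n ≤ t * p ^ n₀ :=
      Nat.mul_le_mul_left _ (Nat.pow_le_pow_right (Fact.out : p.Prime).pos hn)
    have h2 : x ⟨0, hd⟩ ^ (t * p ^ n₀) ∈ powIdeal x (t * p ^ n) := by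
      rw [← Nat.sub_add_cancel h1, pow_add]
      exact Ideal.mul_mem_left _ _ (pow_mem_powIdeal x _ _)
    exact Ideal.mul_mem_right _ _ (Ideal.mul_mem_right _ _ (Ideal.mul_mem_left _ _ h2))

/-- Elements of degree at least `t ∑ deg x_i - ⌊r⌋` are in the closure of `I_t` with exponent `r`,
because `c z ^ q R₊ ^ ⌈r q⌉` lies in degrees above the socle of `R / I_{tq}`. -/
lemma IsHomogeneousSOP.mem_aTightClosure_of_le (hx : IsHomogeneousSOP 𝒜 x e)
    (hstd : IsStandardGraded 𝒜) (hGor : IsGorenstein R) (hd : 0 < d) {r : ℝ} {t : ℕ} (ht : 1 ≤ t)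
    {z : R} {j : ℕ} (hz : z ∈ 𝒜 j) (hj : t * ∑ i, (e i : ℤ) - ⌊r⌋ ≤ j) :
    z ∈ aTightClosure p (irrIdeal 𝒜) r (powIdeal x t) := by
  have hp := (Fact.out : p.Prime).pos
  let i₀ : Fin d := ⟨0, hd⟩
  let N := (aInvariant 𝒜 x e + 1).toNat
  refine ⟨x i₀ ^ N, hx.pow_mem_circ hstd hGor _ _, fun n y hy => ?_⟩
  rw [bracketPower_powIdeal]
  obtain ⟨s, hs, hsoc⟩ := hx.exists_hasSocleDegree_powIdeal hstd hGor (t := t * p ^ n)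
    (Nat.mul_pos ht (pow_pos hp n))
  refine hstd.mul_mem_of_mem_irrelevant_pow (fun y hy => ?_) hy
  refine hsoc.mem_of_lt ?_ (SetLike.GradedMul.mul_mem (SetLike.GradedMul.mul_mem
    (pow_mem_graded N (hx.2.1 i₀)) (pow_mem_graded (p ^ n) hz)) hy)
  have h1 : (1 : ℤ) ≤ e i₀ := by exact_mod_cast hx.one_le_degree hstd hGor i₀
  have h2 : aInvariant 𝒜 x e + 1 ≤ N := Int.self_le_toNat _
  have h3 : (⌊r⌋ : ℤ) * (p : ℤ) ^ n ≤ ⌈r * (p : ℝ) ^ n⌉₊ := by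
    have : ((⌊r⌋ * (p : ℤ) ^ n : ℤ) : ℝ) ≤ ((⌈r * (p : ℝ) ^ n⌉₊ : ℤ) : ℝ) := by
      push_cast
      exact (mul_le_mul_of_nonneg_right (Int.floor_le r) (by positivity)).trans (Nat.le_ceil _)
    exact_mod_cast this
  have h4 : (t * ∑ i, (e i : ℤ) - ⌊r⌋) * (p : ℤ) ^ n ≤ j * (p : ℤ) ^ n :=
    mul_le_mul_of_nonneg_right hj (by positivity)
  have h5 : (N : ℤ) ≤ e i₀ * N := by nlinarith [Int.natCast_nonneg N]
  zify
  rw [hs]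
  push_cast
  linarith

lemma IsHomogeneousSOP.tightClosure_sup_colon_le (hx : IsHomogeneousSOP 𝒜 x e)
    (hstd : IsStandardGraded 𝒜) (hGor : IsGorenstein R) (hd : 0 < d) (r : ℝ) {t : ℕ}
    (ht : 1 ≤ t) :
    tightClosure p (powIdeal x t) ⊔ Submodule.colon (powIdeal x t)
        (irrelevantPow 𝒜 (aInvariant 𝒜 x e + 1 + ⌊r⌋) : Set R) ≤
      aTightClosure p (irrIdeal 𝒜) r (powIdeal x t) := by
  have htc : tightClosure p (powIdeal x t) ≤ aTightClosure p (irrIdeal 𝒜) r (powIdeal x t) :=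
    fun z hz => hx.mem_aTightClosure_of_mem_exponentClosure p hstd hGor hd
      (exponentClosure_zero_subset (mem_tightClosure_iff.1 hz))
  refine sup_le htc fun z hz => mem_of_forall_proj_mem (𝒜 := 𝒜) fun j => ?_
  have hzj := colon_irrelevantPow_isHomogeneous hstd (powIdeal_isHomogeneous hx t) _ hz j
  by_cases hmem : GradedRing.proj 𝒜 j z ∈ powIdeal x t
  · exact htc (le_tightClosure hmem)
  obtain ⟨s, hs, hsoc⟩ := hx.exists_hasSocleDegree_powIdeal hstd hGor ht
  obtain ⟨i, v, hv, hij, hvI⟩ := hsoc.exists_mul_notMem (proj_mem 𝒜 j z) hmem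
  have hi : i < (aInvariant 𝒜 x e + 1 + ⌊r⌋).toNat := by
    by_contra! hi
    exact hvI (Submodule.mem_colon.1 hzj v (hstd.mem_irrelevant_pow hv hi))
  refine hx.mem_aTightClosure_of_le p hstd hGor hd ht (proj_mem 𝒜 j z) ?_
  omega

lemma IsHomogeneousSOP.aTightClosure_le (hx : IsHomogeneousSOP 𝒜 x e)
    (hstd : IsStandardGraded 𝒜) (hGor : IsGorenstein R) (r : ℝ) {t : ℕ}
    (ht : 1 ≤ t) :
    aTightClosure p (irrIdeal 𝒜) r (powIdeal x t) ≤
      tightClosure p (powIdeal x t) ⊔ Submodule.colon (powIdeal x t)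
        (irrelevantPow 𝒜 (aInvariant 𝒜 x e + 1 + ⌊r⌋) : Set R) := by
  have hp := (Fact.out : p.Prime)
  rintro z ⟨c, hc, hcz⟩
  refine mem_of_forall_proj_mem (𝒜 := 𝒜) fun j => ?_
  rcases le_or_gt (t * ∑ i, (e i : ℤ) - ⌊r⌋) j with hj | hj
  · refine Submodule.mem_sup_right (Submodule.mem_colon.2 fun y hy => ?_)
    refine hstd.mul_mem_of_mem_irrelevant_pow (fun y hy => ?_) hy
    obtain ⟨s, hs, hsoc⟩ := hx.exists_hasSocleDegree_powIdeal hstd hGor ht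
    refine hsoc.mem_of_lt ?_ (SetLike.GradedMul.mul_mem (proj_mem 𝒜 j z) hy)
    omega
  · refine Submodule.mem_sup_left ⟨c, hc, ?_⟩
    obtain ⟨D, hD⟩ := exists_mem_degLE 𝒜 c
    have hlarge : ∀ᶠ n : ℕ in Filter.atTop, D < p ^ n ∧
        (D + 1 - aInvariant 𝒜 x e : ℝ) ≤ (⌊r⌋ + 1 - r) * (p : ℝ) ^ n := by
      have h1 : Filter.Tendsto (fun n : ℕ => p ^ n) Filter.atTop Filter.atTop :=
        tendsto_pow_atTop_atTop_of_one_lt hp.one_lt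
      have h2 : Filter.Tendsto (fun n : ℕ => (⌊r⌋ + 1 - r) * (p : ℝ) ^ n) Filter.atTop
          Filter.atTop :=
        (tendsto_pow_atTop_atTop_of_one_lt (by exact_mod_cast hp.one_lt)).const_mul_atTop
          (by linarith [Int.lt_floor_add_one r])
      exact (h1.eventually_gt_atTop D).and (h2.eventually_ge_atTop _)
    refine hlarge.mono fun n hn => ?_
    have hzn := hcz n
    rw [bracketPower_powIdeal] at hzn ⊢
    obtain ⟨s, hs, hsoc⟩ := hx.exists_hasSocleDegree_powIdeal hstd hGor (t := t * p ^ n)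
      (Nat.mul_pos ht (pow_pos hp.pos n))
    have hI := powIdeal_isHomogeneous hx (t * p ^ n)
    rw [← sum_proj_of_mem_degLE hD, Finset.sum_mul]
    refine Ideal.sum_mem _ fun i hi => ?_
    rw [Finset.mem_range, Nat.lt_succ_iff] at hi
    have hdeg := SetLike.GradedMul.mul_mem (proj_mem 𝒜 i c)
      (pow_mem_graded (p ^ n) (proj_mem 𝒜 j z))
    -- a nonzero class would have a multiple by a form of degree less than `⌈r q⌉` in the socle
    by_contra hmem
    obtain ⟨m, v, hv, hij, hvI⟩ := hsoc.exists_mul_notMem hdeg hmem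
    have hm : m < ⌈r * (p : ℝ) ^ n⌉₊ := by
      by_contra! hm
      refine hvI ?_
      have h1 := proj_mem_of_isHomogeneous hI (i + j * p ^ n + m)
        (hzn v (hstd.mem_irrelevant_pow hv hm))
      rwa [proj_mul_of_right_mem _ _ hv, proj_mul_pow_char_pow p hn.1 hD z hi] at h1
    have h1 : (m : ℝ) < r * (p : ℝ) ^ n := Nat.lt_ceil.1 hm
    have h2 : ((i + j * p ^ n + m : ℕ) : ℤ) =
        aInvariant 𝒜 x e + (t * p ^ n) * ∑ i, (e i : ℤ) := by
      rw [hij, hs]; push_cast; ring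
    have h3 : (i + j * (p : ℝ) ^ n + m : ℝ) =
        aInvariant 𝒜 x e + (t * (p : ℝ) ^ n) * ((∑ i, (e i : ℤ) : ℤ) : ℝ) := by
      exact_mod_cast congrArg (Int.cast : ℤ → ℝ) h2
    have h4 : (j : ℝ) + 1 ≤ t * ((∑ i, (e i : ℤ) : ℤ) : ℝ) - ⌊r⌋ := by
      have : (j : ℤ) + 1 ≤ t * ∑ i, (e i : ℤ) - ⌊r⌋ := hj
      exact_mod_cast this
    have h5 := mul_le_mul_of_nonneg_right h4 (show (0 : ℝ) ≤ (p : ℝ) ^ n by positivity)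
    have h6 : (i : ℝ) ≤ D := by exact_mod_cast hi
    have h7 := hn.2
    nlinarith

/-- The closure of `I_t` with exponent `r` is `I_t^* + (I_t : R₊ ^ {a + 1 + ⌊r⌋})`. -/
theorem IsHomogeneousSOP.aTightClosure_powIdeal_eq (hx : IsHomogeneousSOP 𝒜 x e)
    (hstd : IsStandardGraded 𝒜) (hGor : IsGorenstein R) (hd : 0 < d) (r : ℝ) {t : ℕ}
    (ht : 1 ≤ t) :
    aTightClosure p (irrIdeal 𝒜) r (powIdeal x t) =
      tightClosure p (powIdeal x t) ⊔ Submodule.colon (powIdeal x t)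
        (irrelevantPow 𝒜 (aInvariant 𝒜 x e + 1 + ⌊r⌋) : Set R) :=
  le_antisymm (hx.aTightClosure_le p hstd hGor r ht)
    (hx.tightClosure_sup_colon_le p hstd hGor hd r ht)

end

end PowIdealClosure

/-! ### Inhomogeneous deformations of the ideals `I_n` -/

section Deformation

variable {k R : Type*} [Field k] [CommRing R] [Algebra k R] {𝒜 : ℕ → Submodule k R}
  [GradedAlgebra 𝒜] {d : ℕ} {x : Fin d → R} {e : Fin d → ℕ} {n : ℕ} {F : Fin d → R}

lemma sum_mul_mem_degLE {ι : Type*} {s : Finset ι} {ε : ι → ℤ} {h a : ι → R} {D E : ℤ}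
    (hh : ∀ i, h i ∈ degLE 𝒜 (D - ε i)) (ha : ∀ i, a i ∈ degLE 𝒜 (ε i - E)) :
    ∑ i ∈ s, h i * a i ∈ degLE 𝒜 (D - E) :=
  sum_mem fun i _ => degLE_mono (by omega) (mul_mem_degLE (hh i) (ha i))

/-- If `F i` has the top form `x i ^ n`, members of the ideal `(F₁, …, F_d)` are congruent to
members of `I_n` modulo lower degrees. -/
lemma IsHomogeneousSOP.exists_mem_powIdeal_sub_mem_degLE (hx : IsHomogeneousSOP 𝒜 x e)
    (hstd : IsStandardGraded 𝒜) (hGor : IsGorenstein R) (hn : 1 ≤ n) {E : ℤ} (hE : 1 ≤ E)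
    (hF : ∀ i, F i - x i ^ n ∈ degLE 𝒜 (((n * e i : ℕ) : ℤ) - E)) {z : R} {D : ℤ}
    (hz : z ∈ Ideal.span (Set.range F)) (hD : z ∈ degLE 𝒜 D) :
    ∃ z' ∈ powIdeal x n, z - z' ∈ degLE 𝒜 (D - E) := by
  have hxn := hx.pow (n := fun _ => n) fun _ => hn
  rw [← Set.image_univ, ← Finset.coe_univ] at hz
  obtain ⟨h, hh, rfl⟩ := (hxn.regularFamily_and_socleLEOneAt hstd hGor).1.exists_sum_of_mem_span
    hxn.2.1 (fun i => degLE_mono (by omega) (hF i)) Finset.univ hz hD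
  refine ⟨∑ i, h i * x i ^ n, mem_powIdeal_iff.2 ⟨h, rfl⟩, ?_⟩
  rw [← Finset.sum_sub_distrib]
  simp only [← mul_sub]
  exact sum_mul_mem_degLE hh hF

lemma IsHomogeneousSOP.proj_mem_powIdeal_of_mem_span (hx : IsHomogeneousSOP 𝒜 x e)
    (hstd : IsStandardGraded 𝒜) (hGor : IsGorenstein R) (hn : 1 ≤ n)
    (hF : ∀ i, F i - x i ^ n ∈ degLE 𝒜 (((n * e i : ℕ) : ℤ) - 1)) {z : R} {D : ℕ}
    (hz : z ∈ Ideal.span (Set.range F)) (hD : z ∈ degLE 𝒜 D) :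
    GradedRing.proj 𝒜 D z ∈ powIdeal x n := by
  obtain ⟨z', hz', hsub⟩ := hx.exists_mem_powIdeal_sub_mem_degLE hstd hGor hn le_rfl hF hz hD
  have h1 := proj_mem_of_isHomogeneous (powIdeal_isHomogeneous hx n) D hz'
  have h2 := hsub D (by omega)
  rw [map_sub, sub_eq_zero] at h2
  rwa [h2]

/-- Conversely to `exists_mem_powIdeal_sub_mem_degLE`, members of `I_n` lift to the deformed
ideal. -/
lemma IsHomogeneousSOP.exists_mem_span_sub_mem_degLE (hx : IsHomogeneousSOP 𝒜 x e) {E : ℤ}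
    (hF : ∀ i, F i - x i ^ n ∈ degLE 𝒜 (((n * e i : ℕ) : ℤ) - E)) {z : R} {D : ℤ}
    (hz : z ∈ powIdeal x n) (hD : z ∈ degLE 𝒜 D) :
    ∃ z' ∈ Ideal.span (Set.range F), z - z' ∈ degLE 𝒜 (D - E) := by
  have hX : ∀ i, x i ^ n ∈ 𝒜 (n * e i) := fun i => by
    rw [mul_comm]; exact pow_mem_graded n (hx.2.1 i)
  rw [powIdeal, ← Set.image_univ, ← Finset.coe_univ] at hz
  obtain ⟨h, hh, rfl⟩ := exists_sum_of_mem_span_homogeneous hX hz hD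
  refine ⟨∑ i, h i * F i, Ideal.sum_mem _ fun i _ => Ideal.mul_mem_left _ _
    (Ideal.subset_span ⟨i, rfl⟩), ?_⟩
  rw [← Finset.sum_sub_distrib]
  simp only [← mul_sub]
  refine sum_mul_mem_degLE hh fun i => ?_
  have := neg_mem (hF i)
  rwa [neg_sub] at this

lemma IsHomogeneousSOP.exists_mem_span_sub_mem_degLE_of_proj_mem (hx : IsHomogeneousSOP 𝒜 x e)
    (hF : ∀ i, F i - x i ^ n ∈ degLE 𝒜 (((n * e i : ℕ) : ℤ) - 1)) {b : R} {U : ℕ}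
    (hb : b ∈ degLE 𝒜 U) (hbU : GradedRing.proj 𝒜 U b ∈ powIdeal x n) :
    ∃ a ∈ Ideal.span (Set.range F), b - a ∈ degLE 𝒜 ((U : ℤ) - 1) := by
  obtain ⟨a, ha, hsub⟩ := hx.exists_mem_span_sub_mem_degLE hF hbU
    (mem_degLE_of_mem le_rfl (proj_mem 𝒜 U b))
  refine ⟨a, ha, ?_⟩
  rw [← sub_add_sub_cancel b (GradedRing.proj 𝒜 U b) a]
  exact add_mem (sub_proj_mem_degLE hb) hsub

/-- Normal forms modulo the deformed ideal: the top form can be assumed to be outside `I_n`. -/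
lemma IsHomogeneousSOP.mem_span_or_exists_sub_mem_span (hx : IsHomogeneousSOP 𝒜 x e)
    (hF : ∀ i, F i - x i ^ n ∈ degLE 𝒜 (((n * e i : ℕ) : ℤ) - 1)) (b : R) :
    b ∈ Ideal.span (Set.range F) ∨ ∃ (b' : R) (U : ℕ), b - b' ∈ Ideal.span (Set.range F) ∧
      b' ∈ degLE 𝒜 U ∧ GradedRing.proj 𝒜 U b' ∉ powIdeal x n := by
  have key : ∀ (N : ℕ) (b : R), b ∈ degLE 𝒜 ((N : ℤ) - 1) → b ∈ Ideal.span (Set.range F) ∨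
      ∃ (b' : R) (U : ℕ), b - b' ∈ Ideal.span (Set.range F) ∧
      b' ∈ degLE 𝒜 U ∧ GradedRing.proj 𝒜 U b' ∉ powIdeal x n := by
    intro N
    induction N with
    | zero =>
      intro b hb
      rw [eq_zero_of_mem_degLE (by simp) hb]
      exact .inl (Ideal.zero_mem _)
    | succ N ih =>
      intro b hb
      have hb' : b ∈ degLE 𝒜 (N : ℤ) := degLE_mono (by push_cast; omega) hb
      by_cases hbN : GradedRing.proj 𝒜 N b ∈ powIdeal x n
      · obtain ⟨a, ha, hsub⟩ := hx.exists_mem_span_sub_mem_degLE_of_proj_mem hF hb' hbN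
        rcases ih _ hsub with h | ⟨b', U, h1, h2⟩
        · left
          have := Ideal.add_mem _ h ha
          rwa [sub_add_cancel] at this
        · refine .inr ⟨b', U, ?_, h2⟩
          have := Ideal.add_mem _ h1 ha
          rwa [show b - a - b' + a = b - b' by ring] at this
      · exact .inr ⟨b, N, by simp, hb', hbN⟩
  obtain ⟨N, hN⟩ := exists_mem_degLE 𝒜 b
  exact key (N + 1) b (degLE_mono (by push_cast; omega) hN)

lemma degLE_fg (hstd : IsStandardGraded 𝒜) (s : ℕ) : (degLE 𝒜 s).FG := by
  have h : (⨆ i ∈ Finset.range (s + 1), 𝒜 i).FG :=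
    Submodule.fg_biSup _ _ fun i _ => hstd.fg i
  have := Module.Finite.iff_fg.2 h
  refine Submodule.FG.of_le h fun z hz => ?_
  rw [← sum_proj_of_mem_degLE hz]
  exact sum_mem fun i hi => Submodule.mem_iSup_of_mem i
    (Submodule.mem_iSup_of_mem hi (proj_mem 𝒜 i z))

/-- On a finite-dimensional algebra with a nondegenerate functional `φ`, every functional is
`φ (v * ·)` for some `v`. -/
lemma exists_eq_functional_mul {k Q : Type*} [Field k] [CommRing Q] [Algebra k Q]
    [Module.Finite k Q] (φ : Q →ₗ[k] k) (hφ : ∀ b, b ≠ 0 → ∃ v, φ (b * v) ≠ 0) (f : Q →ₗ[k] k) :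
    ∃ v, ∀ b, f b = φ (v * b) := by
  let Ψ : Q →ₗ[k] Module.Dual k Q := (LinearMap.mul k Q).compr₂ φ
  have hinj : Function.Injective Ψ := by
    rw [← LinearMap.ker_eq_bot, LinearMap.ker_eq_bot']
    intro b hb
    by_contra hb0
    obtain ⟨v, hv⟩ := hφ b hb0
    exact hv (LinearMap.congr_fun hb v)
  have hsurj : Function.Surjective Ψ :=
    (LinearMap.injective_iff_surjective_of_finrank_eq_finrank
      (Subspace.dual_finrank_eq).symm).1 hinj
  obtain ⟨v, hv⟩ := hsurj f
  exact ⟨v, fun b => by rw [← hv]; rfl⟩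

/-- Gorenstein duality in `R / (F₁, …, F_d)`, where `F i` has the top form `x i ^ n`: for an ideal
`I'` above `J = (F₁, …, F_d)`, `J : (J : I') = I'`. -/
theorem IsHomogeneousSOP.exists_mul_notMem_span (hx : IsHomogeneousSOP 𝒜 x e)
    (hstd : IsStandardGraded 𝒜) (hGor : IsGorenstein R) (hn : 1 ≤ n)
    (hF : ∀ i, F i - x i ^ n ∈ degLE 𝒜 (((n * e i : ℕ) : ℤ) - 1)) {I' : Ideal R}
    (hI' : Ideal.span (Set.range F) ≤ I') {u : R} (hu : u ∉ I') :
    ∃ v, (∀ b ∈ I', v * b ∈ Ideal.span (Set.range F)) ∧ v * u ∉ Ideal.span (Set.range F) := by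
  obtain ⟨s, -, hsoc⟩ := hx.exists_hasSocleDegree_powIdeal hstd hGor hn
  obtain ⟨w, hw, hwI⟩ := hsoc.exists_notMem (powIdeal_ne_top hx hstd hn)
  let J := Ideal.span (Set.range F)
  let π : R →ₗ[k] R ⧸ J := (Ideal.Quotient.mkₐ k J).toLinearMap
  have hπ : ∀ b, π b = 0 ↔ b ∈ J := fun b => Ideal.Quotient.eq_zero_iff_mem
  have hπmul : ∀ a b, π (a * b) = π a * π b := fun a b => map_mul (Ideal.Quotient.mkₐ k J) a b
  have hπsurj : Function.Surjective π := Ideal.Quotient.mk_surjective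
  have hfin : Module.Finite k (R ⧸ J) := by
    have := Module.Finite.iff_fg.2 (degLE_fg hstd s)
    refine Module.Finite.of_surjective (π ∘ₗ (degLE 𝒜 (s : ℤ)).subtype) fun q => ?_
    obtain ⟨b, rfl⟩ := hπsurj q
    rcases hx.mem_span_or_exists_sub_mem_span hF b with hb | ⟨b', U, hsub, hb', hU⟩
    · exact ⟨0, by rw [map_zero, (hπ b).2 hb]⟩
    · have hUs : U ≤ s := by
        by_contra! h
        exact hU (hsoc.mem_of_lt h (proj_mem 𝒜 U b'))
      refine ⟨⟨b', degLE_mono (by omega) hb'⟩, ?_⟩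
      rw [← sub_eq_zero, ← neg_sub, neg_eq_zero]
      change π b - π b' = 0
      rw [← map_sub, hπ]
      exact hsub
  have hwnot : π w ∉ (degLE 𝒜 ((s : ℤ) - 1)).map π := by
    rintro ⟨h, hh, hhw⟩
    have h1 : w - h ∈ J := by rw [← hπ, map_sub, hhw, sub_self]
    have h2 := hx.proj_mem_powIdeal_of_mem_span hstd hGor hn hF h1 (D := s)
      (sub_mem (mem_degLE_of_mem le_rfl hw) (degLE_mono (by omega) hh))
    rw [map_sub, hh s (by omega), sub_zero, proj_of_mem hw] at h2
    exact hwI h2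
  obtain ⟨φ, hφw, hφ⟩ := Submodule.exists_le_ker_of_notMem hwnot
  have hφlow : ∀ b ∈ degLE 𝒜 ((s : ℤ) - 1), φ (π b) = 0 := fun b hb => hφ ⟨b, hb, rfl⟩
  have hφtop : ∀ g ∈ 𝒜 s, g ∈ powIdeal x n → φ (π g) = 0 := by
    intro g hg hgI
    obtain ⟨a, ha, hsub⟩ := hx.exists_mem_span_sub_mem_degLE hF hgI (mem_degLE_of_mem le_rfl hg)
    have h1 := hφlow _ hsub
    rwa [map_sub, (hπ a).2 ha, sub_zero] at h1
  have hnondeg : ∀ b, b ≠ 0 → ∃ v, φ (b * v) ≠ 0 := by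
    intro b hb
    obtain ⟨b, rfl⟩ := hπsurj b
    rcases hx.mem_span_or_exists_sub_mem_span hF b with h | ⟨b', U, hsub, hb', hU⟩
    · exact absurd ((hπ b).2 h) hb
    obtain ⟨i, v, hv, hi, hvI⟩ := hsoc.exists_mul_notMem (proj_mem 𝒜 U b') hU
    refine ⟨π v, fun h0 => ?_⟩
    have hbb' : π b = π b' := by rw [← sub_eq_zero, ← map_sub, hπ]; exact hsub
    have hprod : b' * v ∈ degLE 𝒜 (s : ℤ) := degLE_mono (by omega)
      (mul_mem_degLE hb' (mem_degLE_of_mem le_rfl hv))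
    have hproj : GradedRing.proj 𝒜 s (b' * v) = GradedRing.proj 𝒜 U b' * v := by
      rw [← hi, proj_mul_of_right_mem _ _ hv]
    have hg : GradedRing.proj 𝒜 U b' * v ∈ 𝒜 s := hproj ▸ proj_mem 𝒜 s _
    have h1 := hφlow _ (sub_proj_mem_degLE hprod)
    rw [hproj, map_sub, map_sub, hπmul, ← hbb', h0, zero_sub, neg_eq_zero] at h1
    obtain ⟨c, hc⟩ := hsoc.exists_sub_mem hw hg hvI
    have h2 := hφtop _ (sub_mem hw (by
      rw [← Algebra.smul_def]; exact Submodule.smul_mem _ _ hg)) hc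
    rw [← Algebra.smul_def, map_sub, map_sub, map_smul, map_smul, h1, smul_zero, sub_zero] at h2
    exact hφw h2
  have hunot : π u ∉ (I'.restrictScalars k).map π := by
    rintro ⟨h, hh, hhu⟩
    have h1 : u - h ∈ J := by rw [← hπ, map_sub, hhu, sub_self]
    have := Ideal.add_mem _ (hI' h1) hh
    rw [sub_add_cancel] at this
    exact hu this
  obtain ⟨f, hfu, hf⟩ := Submodule.exists_le_ker_of_notMem hunot
  obtain ⟨v, hv⟩ := exists_eq_functional_mul φ hnondeg f
  obtain ⟨v, rfl⟩ := hπsurj v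
  refine ⟨v, fun b hb => ?_, fun h => ?_⟩
  · by_contra h
    obtain ⟨y, hy⟩ := hnondeg (π (v * b)) (fun h0 => h ((hπ _).1 h0))
    obtain ⟨y, rfl⟩ := hπsurj y
    rw [hπmul, mul_assoc, ← hπmul, ← hv] at hy
    exact hy (hf ⟨b * y, Ideal.mul_mem_right _ _ hb, rfl⟩)
  · rw [hv, ← hπmul, (hπ _).2 h, map_zero] at hfu
    exact hfu rfl

end Deformation

/-! ### Multipliers of closures -/

section Multipliers

variable {k R : Type*} [Field k] [CommRing R] [Algebra k R] {𝒜 : ℕ → Submodule k R}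
  [GradedAlgebra 𝒜] {d : ℕ} {x : Fin d → R} {e : Fin d → ℕ}

lemma prod_sub_prod_mem_degLE {ι : Type*} (s : Finset ι) {D : ι → ℤ} {a b : ι → R}
    (ha : ∀ i, a i ∈ degLE 𝒜 (D i)) (hab : ∀ i, a i - b i ∈ degLE 𝒜 (D i - 1)) :
    ∏ i ∈ s, a i - ∏ i ∈ s, b i ∈ degLE 𝒜 (∑ i ∈ s, D i - 1) := by
  classical
  have hb : ∀ i, b i ∈ degLE 𝒜 (D i) := fun i => by
    have := sub_mem (ha i) (degLE_mono (by omega) (hab i))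
    rwa [sub_sub_cancel] at this
  induction s using Finset.induction_on with
  | empty => simp
  | insert i s hi ih =>
    rw [Finset.prod_insert hi, Finset.prod_insert hi, Finset.sum_insert hi,
      show a i * ∏ i ∈ s, a i - b i * ∏ i ∈ s, b i =
        (a i - b i) * ∏ i ∈ s, a i + b i * (∏ i ∈ s, a i - ∏ i ∈ s, b i) by ring]
    exact add_mem
      (degLE_mono (by omega) (mul_mem_degLE (hab i) (prod_mem_degLE s fun i _ => ha i)))
      (degLE_mono (by omega) (mul_mem_degLE (hb i) ih))

/-- The components of high degree of an element of the closure of a deformed ideal are in the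
closure of the ideal of top forms. -/
lemma IsHomogeneousSOP.proj_mem_exponentClosure (hx : IsHomogeneousSOP 𝒜 x e)
    (hstd : IsStandardGraded 𝒜) (hGor : IsGorenstein R) (p : ℕ) [Fact p.Prime] [CharP R p]
    {l : ℕ → ℕ} {N s : ℕ} (hN : 1 ≤ N) (hs : 1 ≤ s) {K : Fin d → R}
    (hK : ∀ i, K i - x i ^ N ∈ degLE 𝒜 (((N * e i : ℕ) : ℤ) - s)) {w : R} {W : ℤ}
    (hw : w ∈ exponentClosure p (irrIdeal 𝒜) l (Ideal.span (Set.range K)))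
    (hW : w ∈ degLE 𝒜 W) {j : ℕ} (hj : W - s < j) :
    GradedRing.proj 𝒜 j w ∈ exponentClosure p (irrIdeal 𝒜) l (powIdeal x N) := by
  have hp := (Fact.out : p.Prime)
  obtain ⟨c, hc, hcw⟩ := hw
  obtain ⟨D, hD⟩ := exists_mem_degLE 𝒜 c
  have hlarge : ∀ᶠ n : ℕ in Filter.atTop, D < p ^ n :=
    (tendsto_pow_atTop_atTop_of_one_lt hp.one_lt).eventually_gt_atTop D
  refine ⟨c, hc, (hcw.and hlarge).mono fun n hn y hy => ?_⟩
  refine hstd.mul_mem_of_mem_irrelevant_pow (fun y hy => ?_) hy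
  have hpos : 0 < p ^ n := pow_pos hp.pos n
  have hmem := hn.1 y (hstd.mem_irrelevant_pow hy le_rfl)
  rw [bracketPower_span_range] at hmem
  rw [bracketPower_powIdeal]
  have hK' : ∀ i, K i ^ p ^ n - x i ^ (N * p ^ n) ∈
      degLE 𝒜 (((N * p ^ n * e i : ℕ) : ℤ) - (s * p ^ n : ℕ)) := fun i => by
    rw [pow_mul, ← sub_pow_char_pow]
    exact degLE_mono (by push_cast; linarith) (pow_mem_degLE (hK i) (p ^ n))
  have hdeg : c * w ^ p ^ n * y ∈ degLE 𝒜 (D + (p ^ n : ℕ) * W + l n) :=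
    mul_mem_degLE (mul_mem_degLE hD (pow_mem_degLE hW _)) (mem_degLE_of_mem le_rfl hy)
  obtain ⟨z', hz', hsub⟩ := hx.exists_mem_powIdeal_sub_mem_degLE hstd hGor
    (Nat.mul_pos hN hpos) (by exact_mod_cast Nat.mul_pos hs hpos) hK' hmem hdeg
  refine mul_proj_pow_mul_mem p hn.2 hD hy (powIdeal_isHomogeneous hx _) hsub (j := j) ?_ ?_
  · rwa [sub_sub_cancel]
  · have h1 : (D : ℤ) < (p : ℤ) ^ n := by exact_mod_cast hn.2
    have h2 : (W - s + 1) * (p : ℤ) ^ n ≤ j * (p : ℤ) ^ n :=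
      mul_le_mul_of_nonneg_right hj (by positivity)
    push_cast
    linarith

/-- If `c` multiplies the closure of `I_N` into `I_N`, it multiplies the closure of a deformation
of `I_N` into the deformation, up to low degrees. -/
lemma IsHomogeneousSOP.exists_mem_span_mul_sub_mem_degLE (hx : IsHomogeneousSOP 𝒜 x e)
    (hstd : IsStandardGraded 𝒜) (hGor : IsGorenstein R) (p : ℕ) [Fact p.Prime] [CharP R p]
    {l : ℕ → ℕ} {N s : ℕ} (hN : 1 ≤ N) (hs : 1 ≤ s) {K : Fin d → R}
    (hK : ∀ i, K i - x i ^ N ∈ degLE 𝒜 (((N * e i : ℕ) : ℤ) - s)) {c : R} {C : ℤ}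
    (hC : c ∈ degLE 𝒜 C)
    (hc : ∀ z ∈ exponentClosure p (irrIdeal 𝒜) l (powIdeal x N), c * z ∈ powIdeal x N)
    {w : R} {W : ℤ} (hw : w ∈ exponentClosure p (irrIdeal 𝒜) l (Ideal.span (Set.range K)))
    (hW : w ∈ degLE 𝒜 W) :
    ∃ z' ∈ Ideal.span (Set.range K), c * w - z' ∈ degLE 𝒜 (C + W - s) := by
  obtain ⟨w', hw', hproj⟩ := exists_truncation (𝒜 := 𝒜) (W - s) w
  have h1 : c * (w - w') ∈ powIdeal x N := by
    obtain ⟨M, hM⟩ := exists_mem_degLE 𝒜 (w - w')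
    rw [← sum_proj_of_mem_degLE hM, Finset.mul_sum]
    refine Ideal.sum_mem _ fun j _ => ?_
    rcases le_or_gt (j : ℤ) (W - s) with hj | hj
    · rw [hproj j hj, mul_zero]
      exact Ideal.zero_mem _
    · rw [map_sub, hw' j hj, sub_zero]
      exact hc _ (hx.proj_mem_exponentClosure hstd hGor p hN hs hK hw hW hj)
  have h2 : c * (w - w') ∈ degLE 𝒜 (C + W) :=
    mul_mem_degLE hC (sub_mem hW (degLE_mono (by omega) hw'))
  obtain ⟨z', hz', hsub⟩ := hx.exists_mem_span_sub_mem_degLE hK h1 h2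
  refine ⟨z', hz', ?_⟩
  rw [show c * w - z' = (c * (w - w') - z') + c * w' by ring]
  exact add_mem hsub (degLE_mono (by omega) (mul_mem_degLE hC hw'))

/-- If `F i` and `G i` have the top forms `x i ^ n` and `x i ^ (n * m)`, and if `u ∏ G i` has low
degree modulo the ideal of the products `F i * G i`, then `u` is in the ideal of the `F i`. -/
lemma IsHomogeneousSOP.mem_span_of_mul_prod_sub_mem_degLE (hx : IsHomogeneousSOP 𝒜 x e)
    (hstd : IsStandardGraded 𝒜) (hGor : IsGorenstein R) {n m : ℕ} (hn : 1 ≤ n) {F G : Fin d → R}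
    (hF : ∀ i, F i - x i ^ n ∈ degLE 𝒜 (((n * e i : ℕ) : ℤ) - 1))
    (hFG : ∀ i, F i * G i - x i ^ (n + n * m) ∈ degLE 𝒜 ((((n + n * m) * e i : ℕ) : ℤ) - 1))
    (hG : ∏ i, G i - (∏ i, x i) ^ (n * m) ∈ degLE 𝒜 (∑ i, (n * m * e i : ℤ) - 1)) {u z : R}
    (hz : z ∈ Ideal.span (Set.range fun i => F i * G i))
    (hu : u * ∏ i, G i - z ∈ degLE 𝒜 (∑ i, (n * m * e i : ℤ) - 1)) :
    u ∈ Ideal.span (Set.range F) := by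
  classical
  rcases hx.mem_span_or_exists_sub_mem_span hF u with h | ⟨u', U, hsub, hu', hU⟩
  · exact h
  exfalso
  refine hU (hx.mem_powIdeal_of_mul_prod_mem hstd hGor (N := n * m) ?_)
  obtain ⟨V, hV⟩ : ∃ V : ℕ, (V : ℤ) = ∑ i, (n * m * e i : ℤ) :=
    ⟨∑ i, n * m * e i, by push_cast; rfl⟩
  rw [← hV] at hu hG
  have hprod : (∏ i, x i) ^ (n * m) ∈ 𝒜 V := by
    have h0 : ∏ i, x i ∈ 𝒜 (∑ i, e i) := SetLike.prod_mem_graded 𝒜 e x fun i _ => hx.2.1 i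
    have h1 := pow_mem_graded (n * m) h0
    convert h1 using 2
    zify
    rw [hV, Finset.sum_mul]
    exact Finset.sum_congr rfl fun i _ => by ring
  have hG' : ∏ i, G i ∈ degLE 𝒜 (V : ℤ) := by
    have := add_mem (degLE_mono (by omega) hG) (mem_degLE_of_mem le_rfl hprod)
    rwa [sub_add_cancel] at this
  have hmul : (u - u') * ∏ i, G i ∈ Ideal.span (Set.range fun i => F i * G i) := by
    have h1 : Ideal.span (Set.range F) ≤
        Submodule.colon (Ideal.span (Set.range fun i => F i * G i)) {∏ i, G i} := by
      rw [Ideal.span_le]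
      rintro _ ⟨i, rfl⟩
      rw [SetLike.mem_coe, Submodule.mem_colon_singleton, smul_eq_mul,
        ← Finset.mul_prod_erase _ _ (Finset.mem_univ i), ← mul_assoc]
      exact Ideal.mul_mem_right _ _ (Ideal.subset_span ⟨i, rfl⟩)
    exact Submodule.mem_colon_singleton.1 (h1 hsub)
  have hz' := Ideal.sub_mem _ hz hmul
  have hlow : u' * ∏ i, G i - (z - (u - u') * ∏ i, G i) ∈ degLE 𝒜 ((V : ℤ) - 1) := by
    rwa [show u' * ∏ i, G i - (z - (u - u') * ∏ i, G i) = u * ∏ i, G i - z by ring]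
  have huG : u' * ∏ i, G i ∈ degLE 𝒜 ((U + V : ℕ) : ℤ) := by
    push_cast; exact mul_mem_degLE hu' hG'
  have hzdeg : z - (u - u') * ∏ i, G i ∈ degLE 𝒜 ((U + V : ℕ) : ℤ) := by
    have := sub_mem huG (degLE_mono (by push_cast; omega) hlow)
    rwa [sub_sub_cancel] at this
  have h1 := hx.proj_mem_powIdeal_of_mem_span hstd hGor (by omega) hFG hz' hzdeg
  have h2 := hlow (U + V) (by push_cast; omega)
  have h3 := hG V (by omega)
  rw [map_sub, sub_eq_zero, proj_of_mem hprod] at h3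
  rw [map_sub, sub_eq_zero, proj_add_mul_of_mem_degLE hu' hG', h3] at h2
  rwa [h2]

/-- If `c` multiplies the closures of all the `I_t` into the `I_t`, it multiplies the closure of
a deformation `J = (x i ^ n - B i)` of `I_n` into `J`. The deformation is removed by passing to the
`x i ^ (n s) - B i ^ s`, which are close to homogeneous for large `s`. -/
theorem IsHomogeneousSOP.mul_mem_span_of_mem_exponentClosure (hx : IsHomogeneousSOP 𝒜 x e)
    (hstd : IsStandardGraded 𝒜) (hGor : IsGorenstein R) (p : ℕ) [Fact p.Prime] [CharP R p]
    {l : ℕ → ℕ} {c : R} (hc : ∀ t, 1 ≤ t →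
      ∀ z ∈ exponentClosure p (irrIdeal 𝒜) l (powIdeal x t), c * z ∈ powIdeal x t)
    {n : ℕ} (hn : 1 ≤ n) {B : Fin d → R} (hB : ∀ i, B i ∈ degLE 𝒜 (((n * e i : ℕ) : ℤ) - 1))
    {z : R} (hz : z ∈ exponentClosure p (irrIdeal 𝒜) l
      (Ideal.span (Set.range fun i => x i ^ n - B i))) :
    c * z ∈ Ideal.span (Set.range fun i => x i ^ n - B i) := by
  classical
  obtain ⟨C, hC⟩ := exists_mem_degLE 𝒜 c
  obtain ⟨Z, hZ⟩ := exists_mem_degLE 𝒜 z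
  -- the value of `s = m + 1` that outweighs the degrees of `c` and `z`
  let m := C + Z
  let F : Fin d → R := fun i => x i ^ n - B i
  let G : Fin d → R := fun i => ∑ a ∈ Finset.range (m + 1), (x i ^ n) ^ a * B i ^ (m + 1 - 1 - a)
  have hxn : ∀ i (a : ℕ), (x i ^ n) ^ a ∈ degLE 𝒜 (a * (n * e i : ℕ)) := fun i a => by
    refine pow_mem_degLE (mem_degLE_of_mem le_rfl ?_) a
    rw [mul_comm]; exact pow_mem_graded n (hx.2.1 i)
  have hF : ∀ i, F i - x i ^ n ∈ degLE 𝒜 (((n * e i : ℕ) : ℤ) - 1) := fun i => by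
    have := neg_mem (hB i)
    rwa [show F i - x i ^ n = -B i by simp [F]]
  have hFG : ∀ i, F i * G i - x i ^ (n + n * m) ∈
      degLE 𝒜 ((((n + n * m) * e i : ℕ) : ℤ) - (m + 1 : ℕ)) := fun i => by
    have h1 : G i * F i = (x i ^ n) ^ (m + 1) - B i ^ (m + 1) := geom_sum₂_mul _ _ _
    rw [mul_comm (F i), h1, ← pow_mul, show n * (m + 1) = n + n * m by ring, sub_sub_cancel_left]
    refine neg_mem (degLE_mono ?_ (pow_mem_degLE (hB i) (m + 1)))
    push_cast; linarith
  have hGtop : ∀ i, G i - x i ^ (n * m) ∈ degLE 𝒜 ((n * m * e i : ℤ) - 1) := fun i => by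
    have h1 : G i - x i ^ (n * m) =
        ∑ a ∈ Finset.range m, (x i ^ n) ^ a * B i ^ (m + 1 - 1 - a) := by
      simp only [G]
      rw [Finset.sum_range_succ, ← pow_mul (x i) n m]
      simp
    rw [h1]
    refine sum_mem fun a ha => degLE_mono ?_
      (mul_mem_degLE (hxn i a) (pow_mem_degLE (hB i) (m + 1 - 1 - a)))
    rw [Finset.mem_range] at ha
    obtain ⟨b, hb⟩ : ∃ b, m = a + b + 1 := ⟨m - a - 1, by omega⟩
    rw [show m + 1 - 1 - a = b + 1 by omega, hb]
    push_cast
    nlinarith [Int.natCast_nonneg b]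
  have hGle : ∀ i, G i ∈ degLE 𝒜 (n * m * e i : ℤ) := fun i => by
    have h1 := hxn i m
    rw [← pow_mul] at h1
    have h2 : (m : ℤ) * ((n * e i : ℕ) : ℤ) = n * m * e i := by push_cast; ring
    have := add_mem (degLE_mono (by omega) (hGtop i)) (h2 ▸ h1)
    rwa [sub_add_cancel] at this
  have hGprod : ∏ i, G i - (∏ i, x i) ^ (n * m) ∈ degLE 𝒜 (∑ i, (n * m * e i : ℤ) - 1) := by
    rw [← Finset.prod_pow]
    exact prod_sub_prod_mem_degLE _ hGle hGtop
  have hw : (∏ i, G i) * z ∈ exponentClosure p (irrIdeal 𝒜) l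
      (Ideal.span (Set.range fun i => F i * G i)) := by
    refine mul_mem_exponentClosure (fun b hb => ?_) hz
    obtain ⟨h, rfl⟩ := Ideal.mem_span_range_iff_exists_fun.1 hb
    rw [Finset.mul_sum]
    refine Ideal.sum_mem _ fun i _ => ?_
    have h1 : (∏ j, G j) * (h i * (x i ^ n - B i)) =
        (∏ j ∈ Finset.univ.erase i, G j) * h i * (F i * G i) := by
      rw [← Finset.prod_erase_mul _ _ (Finset.mem_univ i)]
      change _ * (h i * F i) = _
      ring
    rw [h1]
    exact Ideal.mul_mem_left _ _ (Ideal.subset_span ⟨i, rfl⟩)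
  obtain ⟨z', hz', hsub⟩ := hx.exists_mem_span_mul_sub_mem_degLE hstd hGor p
    (N := n + n * m) (by omega) (by omega) hFG hC (hc _ (by omega)) hw
    (mul_mem_degLE (prod_mem_degLE Finset.univ fun i _ => hGle i) hZ)
  refine hx.mem_span_of_mul_prod_sub_mem_degLE hstd hGor (m := m) hn hF
    (fun i => degLE_mono (by push_cast; omega) (hFG i)) hGprod hz' ?_
  rw [show c * z * ∏ i, G i - z' = c * ((∏ i, G i) * z) - z' by ring]
  refine degLE_mono ?_ hsub
  simp only [m]
  push_cast
  omega

end Multipliers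

/-! ### Krull's intersection theorem and the Nullstellensatz -/

section KrullNullstellensatz

/-- Krull's intersection theorem: an ideal of a Noetherian ring is the intersection of the ideals
`I + M ^ N`, over all maximal ideals `M`. -/
lemma exists_isMaximal_notMem_sup_pow {R : Type*} [CommRing R] [IsNoetherianRing R] {I : Ideal R}
    {u : R} (hu : u ∉ I) : ∃ M : Ideal R, M.IsMaximal ∧ ∃ N : ℕ, u ∉ I ⊔ M ^ N := by
  have hne : Submodule.colon I {u} ≠ ⊤ := fun h => hu (by
    have h1 : (1 : R) ∈ Submodule.colon I {u} := h ▸ Submodule.mem_top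
    rwa [Submodule.mem_colon_singleton, one_smul] at h1)
  obtain ⟨M, hM, hle⟩ := Ideal.exists_le_maximal _ hne
  refine ⟨M, hM, ?_⟩
  by_contra! hall
  have hmem : (Submodule.Quotient.mk u : R ⧸ I) ∈
      (⨅ i : ℕ, M ^ i • ⊤ : Submodule R (R ⧸ I)) := by
    rw [Submodule.mem_iInf]
    intro N
    obtain ⟨a, ha, b, hb, rfl⟩ := Submodule.mem_sup.1 (hall N)
    have h1 : (Submodule.Quotient.mk (a + b) : R ⧸ I) =
        b • (Submodule.Quotient.mk 1 : R ⧸ I) := by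
      rw [← Submodule.Quotient.mk_smul, smul_eq_mul, mul_one, Submodule.Quotient.eq]
      simpa using ha
    rw [h1]
    exact Submodule.smul_mem_smul hb Submodule.mem_top
  obtain ⟨⟨r, hr⟩, hru⟩ := (Ideal.mem_iInf_smul_pow_eq_bot_iff M _).1 hmem
  have h1 : 1 - r ∈ Submodule.colon I {u} := by
    rw [Submodule.mem_colon_singleton, smul_eq_mul, ← Submodule.Quotient.mk_eq_zero]
    change r • (Submodule.Quotient.mk u : R ⧸ I) = Submodule.Quotient.mk u at hru
    rw [sub_mul, one_mul, Submodule.Quotient.mk_sub, ← smul_eq_mul r u,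
      Submodule.Quotient.mk_smul, hru, sub_self]
  have := M.add_mem (hle h1) hr
  rw [sub_add_cancel] at this
  exact hM.ne_top ((Ideal.eq_top_iff_one M).2 this)

open Polynomial in
/-- By the Nullstellensatz, finitely many elements of an algebra of finite type are, modulo a power
of a maximal ideal, roots of a common monic polynomial. -/
lemma exists_monic_aeval_mem_pow {k R : Type*} [Field k] [CommRing R] [Algebra k R]
    [Algebra.FiniteType k R] (M : Ideal R) [M.IsMaximal] (N : ℕ) {d : ℕ} (x : Fin d → R) :
    ∃ f : k[X], f.Monic ∧ 1 ≤ f.natDegree ∧ ∀ i, aeval (x i) f ∈ M ^ N := by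
  let _ : Field (R ⧸ M) := Ideal.Quotient.field M
  have hft : Algebra.FiniteType k (R ⧸ M) :=
    Algebra.FiniteType.of_surjective (Ideal.Quotient.mkₐ k M) Ideal.Quotient.mk_surjective
  have hfin : Module.Finite k (R ⧸ M) := finite_of_finite_type_of_isJacobsonRing k (R ⧸ M)
  have hint : ∀ i, IsIntegral k (Ideal.Quotient.mk M (x i)) := fun i =>
    Algebra.IsIntegral.isIntegral _
  let g : k[X] := ∏ i, minpoly k (Ideal.Quotient.mk M (x i))
  have hg : g.Monic := monic_prod_of_monic _ _ fun i _ => minpoly.monic (hint i)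
  refine ⟨X * g ^ N, monic_X.mul (hg.pow N), ?_, fun i => ?_⟩
  · rw [monic_X.natDegree_mul (hg.pow N), natDegree_X]
    omega
  · have h1 : aeval (x i) g ∈ M := by
      rw [← Ideal.Quotient.eq_zero_iff_mem]
      change Ideal.Quotient.mkₐ k M _ = 0
      rw [← aeval_algHom_apply, map_prod]
      exact Finset.prod_eq_zero (Finset.mem_univ i) (minpoly.aeval k _)
    rw [map_mul, map_pow]
    exact Ideal.mul_mem_left _ _ (Ideal.pow_mem_pow h1 N)

end KrullNullstellensatz

/-! ### Test ideals -/

section TestIdeals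

variable {k R : Type*} [Field k] [CommRing R] [Algebra k R] {𝒜 : ℕ → Submodule k R}
  [GradedAlgebra 𝒜] {d : ℕ} {x : Fin d → R} {e : Fin d → ℕ}

/-- If `c` multiplies the closures of all the `I_t` into the `I_t`, it multiplies the closure of
every ideal `I` into `I`: it is enough to treat ideals `I + M ^ N`, with `M` maximal, and by duality
the deformations of the `I_n` contained in them. -/
theorem IsHomogeneousSOP.mul_mem_of_mem_exponentClosure (hx : IsHomogeneousSOP 𝒜 x e)
    (hstd : IsStandardGraded 𝒜) (hGor : IsGorenstein R) (p : ℕ) [Fact p.Prime] [CharP R p]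
    {l : ℕ → ℕ} {c : R} (hc : ∀ t, 1 ≤ t →
      ∀ z ∈ exponentClosure p (irrIdeal 𝒜) l (powIdeal x t), c * z ∈ powIdeal x t)
    {I : Ideal R} {z : R} (hz : z ∈ exponentClosure p (irrIdeal 𝒜) l I) : c * z ∈ I := by
  have := hGor.1
  have := hstd.finiteType
  by_contra hcz
  obtain ⟨M, hM, N, hN⟩ := exists_isMaximal_notMem_sup_pow hcz
  obtain ⟨f, hf, hfdeg, hfx⟩ := exists_monic_aeval_mem_pow (k := k) M N x
  let n := f.natDegree
  let B : Fin d → R := fun i => x i ^ n - Polynomial.aeval (x i) f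
  have hB : ∀ i, B i ∈ degLE 𝒜 (((n * e i : ℕ) : ℤ) - 1) := by
    intro i
    have h1 : B i = -∑ j ∈ Finset.range n, f.coeff j • x i ^ j := by
      have h2 := congrArg (Polynomial.aeval (x i)) hf.as_sum
      rw [map_add, map_pow, Polynomial.aeval_X, map_sum] at h2
      simp only [B]
      rw [h2, sub_add_cancel_left]
      congr 1
      refine Finset.sum_congr rfl fun j _ => ?_
      rw [map_mul, map_pow, Polynomial.aeval_X, Polynomial.aeval_C, Algebra.smul_def]
    rw [h1]
    refine neg_mem (sum_mem fun j hj => Submodule.smul_mem _ _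
      (mem_degLE_of_mem ?_ (pow_mem_graded j (hx.2.1 i))))
    have h2 := hx.one_le_degree hstd hGor i
    have h3 : (j + 1) * e i ≤ n * e i := Nat.mul_le_mul_right _ (Finset.mem_range.1 hj)
    rw [add_mul, one_mul, mul_comm j] at h3
    omega
  have hF : ∀ i, x i ^ n - B i = Polynomial.aeval (x i) f := fun i => by simp [B]
  have hle : Ideal.span (Set.range fun i => x i ^ n - B i) ≤ I ⊔ M ^ N := by
    rw [Ideal.span_le]
    rintro _ ⟨i, rfl⟩
    have h1 := hfx i
    rw [← hF i] at h1
    exact Ideal.mem_sup_right h1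
  obtain ⟨v, hv, hvc⟩ := hx.exists_mul_notMem_span hstd hGor hfdeg
    (F := fun i => x i ^ n - B i) (fun i => by
      have := neg_mem (hB i)
      rwa [sub_sub_cancel_left]) hle hN
  refine hvc ?_
  rw [mul_left_comm]
  exact hx.mul_mem_span_of_mem_exponentClosure hstd hGor p hc hfdeg hB
    (mul_mem_exponentClosure hv (exponentClosure_mono le_sup_left hz))

variable (p : ℕ) [Fact p.Prime] [CharP R p]

/-- The test ideal is determined by the tight closures of the `I_t`. -/
lemma IsHomogeneousSOP.mem_testIdeal_iff (hx : IsHomogeneousSOP 𝒜 x e)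
    (hstd : IsStandardGraded 𝒜) (hGor : IsGorenstein R) {c : R} :
    c ∈ testIdeal R p ↔
      ∀ t, 1 ≤ t → ∀ z ∈ tightClosure p (powIdeal x t), c * z ∈ powIdeal x t := by
  rw [testIdeal, Submodule.mem_iInf]
  refine ⟨fun h t _ z hz => Submodule.mem_colon.1 (h _) z hz, fun h I =>
    Submodule.mem_colon.2 fun z hz => ?_⟩
  exact hx.mul_mem_of_mem_exponentClosure hstd hGor p
    (fun t ht z hz => h t ht z (mem_tightClosure_iff.2 hz)) (mem_tightClosure_iff.1 hz)

/-- The test ideal with exponent `r` is determined by the closures of the `I_t`. -/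
lemma IsHomogeneousSOP.mem_aTestIdeal_iff (hx : IsHomogeneousSOP 𝒜 x e)
    (hstd : IsStandardGraded 𝒜) (hGor : IsGorenstein R) (hd : 0 < d) {r : ℝ} {c : R} :
    c ∈ aTestIdeal p (irrIdeal 𝒜) r ↔ ∀ t, 1 ≤ t →
      ∀ z ∈ aTightClosure p (irrIdeal 𝒜) r (powIdeal x t), c * z ∈ powIdeal x t := by
  rw [aTestIdeal, Submodule.mem_iInf]
  refine ⟨fun h t _ z hz => Submodule.mem_colon.1 (h _) z hz, fun h I =>
    Submodule.mem_colon.2 fun z hz => ?_⟩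
  exact hx.mul_mem_of_mem_exponentClosure hstd hGor p
    (fun t ht z hz => h t ht z (hx.mem_aTightClosure_of_mem_exponentClosure p hstd hGor hd hz))
    (aTightClosure_subset_exponentClosure hz)

/-- An element that multiplies `I_t : R₊ ^ n` into `I_t` for all `t` is in `R₊ ^ n`, by duality in
the quotients `R / I_t`. -/
lemma IsHomogeneousSOP.mem_irrelevantPow_of_forall (hx : IsHomogeneousSOP 𝒜 x e)
    (hstd : IsStandardGraded 𝒜) (hGor : IsGorenstein R) {n : ℤ} {c : R}
    (hc : ∀ t, 1 ≤ t → ∀ z ∈ Submodule.colon (powIdeal x t) (irrelevantPow 𝒜 n : Set R),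
      c * z ∈ powIdeal x t) : c ∈ irrelevantPow 𝒜 n := by
  refine hstd.mem_irrelevant_pow_iff.2 fun j hj => ?_
  by_contra hcj
  obtain ⟨s, -, hsoc⟩ := hx.exists_hasSocleDegree_powIdeal hstd hGor (t := j + 1) (by omega)
  have hnot : GradedRing.proj 𝒜 j c ∉ powIdeal x (j + 1) := by
    intro h
    have h1 := hstd.mem_irrelevant_pow_iff.1 (powIdeal_le_irrIdeal_pow hx _ h) j (by omega)
    rw [proj_of_mem (proj_mem 𝒜 j c)] at h1
    exact hcj h1
  obtain ⟨i, v, hv, hij, hvI⟩ := hsoc.exists_mul_notMem (proj_mem 𝒜 j c) hnot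
  have h1 : c * v ∈ powIdeal x (j + 1) := by
    refine hc _ (by omega) v (Submodule.mem_colon.2 fun y hy => ?_)
    refine hstd.mul_mem_of_mem_irrelevant_pow (fun y hy => ?_) hy
    exact hsoc.mem_of_lt (by omega) (SetLike.GradedMul.mul_mem hv hy)
  have h2 := proj_mem_of_isHomogeneous (powIdeal_isHomogeneous hx _) (j + i) h1
  rw [proj_mul_of_right_mem _ _ hv] at h2
  exact hvI h2

theorem IsHomogeneousSOP.aTestIdeal_eq (hx : IsHomogeneousSOP 𝒜 x e)
    (hstd : IsStandardGraded 𝒜) (hGor : IsGorenstein R) (hd : 0 < d) (r : ℝ) :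
    aTestIdeal p (irrIdeal 𝒜) r =
      testIdeal R p ⊓ irrelevantPow 𝒜 (aInvariant 𝒜 x e + 1 + ⌊r⌋) := by
  ext c
  rw [Ideal.mem_inf, hx.mem_aTestIdeal_iff p hstd hGor hd, hx.mem_testIdeal_iff p hstd hGor]
  constructor
  · intro h
    refine ⟨fun t ht z hz => h t ht z ?_, hx.mem_irrelevantPow_of_forall hstd hGor
      fun t ht z hz => h t ht z ?_⟩
    · rw [hx.aTightClosure_powIdeal_eq p hstd hGor hd r ht]
      exact Ideal.mem_sup_left hz
    · rw [hx.aTightClosure_powIdeal_eq p hstd hGor hd r ht]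
      exact Ideal.mem_sup_right hz
  · rintro ⟨h, hc⟩ t ht z hz
    rw [hx.aTightClosure_powIdeal_eq p hstd hGor hd r ht] at hz
    obtain ⟨a, ha, b, hb, rfl⟩ := Submodule.mem_sup.1 hz
    rw [mul_add]
    refine Ideal.add_mem _ (h t ht a ha) ?_
    rw [mul_comm]
    exact Submodule.mem_colon.1 hb c hc

end TestIdeals

end ATightClosure

theorem proposition4p5 {k R : Type*} [Field k] [CommRing R] [Algebra k R]
    (p : ℕ) [Fact p.Prime] [CharP R p]
    (𝒜 : ℕ → Submodule k R) [GradedAlgebra 𝒜]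
    (hstd : ATightClosure.IsStandardGraded 𝒜) (hGor : ATightClosure.IsGorenstein R)
    {d : ℕ} (hd : 0 < d) (x : Fin d → R) (e : Fin d → ℕ)
    (hx : ATightClosure.IsHomogeneousSOP 𝒜 x e) (r : ℝ) (hr : 0 ≤ r) :
    (∀ t : ℕ, 1 ≤ t →
      ATightClosure.aTightClosure p (HomogeneousIdeal.irrelevant 𝒜).toIdeal r
          (ATightClosure.powIdeal x t) =
        ATightClosure.tightClosure p (ATightClosure.powIdeal x t) ⊔
          Submodule.colon (ATightClosure.powIdeal x t)
            (ATightClosure.irrelevantPow 𝒜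
              (ATightClosure.aInvariant 𝒜 x e + 1 + ⌊r⌋) : Set R)) ∧
    ATightClosure.aTestIdeal p (HomogeneousIdeal.irrelevant 𝒜).toIdeal r =
      ATightClosure.testIdeal R p ⊓
        ATightClosure.irrelevantPow 𝒜 (ATightClosure.aInvariant 𝒜 x e + 1 + ⌊r⌋) :=
  ⟨fun _ ht => hx.aTightClosure_powIdeal_eq p hstd hGor hd r ht,
    hx.aTestIdeal_eq p hstd hGor hd r⟩
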